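/- **Setting.** A server is connected to $n\ge 2$ nodes. In each time step $t=0,\dots,T-1$ ($T\ge1$) node $i$ observes a value $v_i^t\in\{1,\dots,\Delta\}$; the input $(v_i^t)$ is fixed in advance. Nodes may broadcast, the server may broadcast or send to a single node, and every message costs $1$. Let $D_t$ be the set of values observed by at least one node at time $t$, and $|D|=\min_{t<T}|D_t|$. The input has *change rate* at most $\sigma$ if $|D_{t-1}\setminus D_t|+|D_t\setminus D_{t-1}|\le\sigma|D_t|$ for $1\le t<T$. (For $0\le\sigma<1$ this holds in particular if for every value $v$ the set $N_t^v$ of nodes observing $v$ satisfies $|N_{t-1}^v\setminus N_t^v|+|N_t^v\setminus N_{t-1}^v|\le\sigma|N_t^v|$ for $1\le t<T$; then $D_t$ does not depend on $t$.) Let $R^*$ be the minimum, over all ways to choose at every time $t<T$ a representative for each $v\in D_t$ among the nodes observing $v$ at time $t$ (and nil for each $v\notin D_t$), of the total number of component-wise changes of the sequence of representatives, starting from the sequence that is nil everywhere before time $0$. **Maximum protocol** (for a set $P$ of nodes observing the same value). Each node of $P$ draws a geometric random variable with parameter $1/2$, truncated at $\lceil\log_2 n\rceil$; the nodes of $P$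 with the largest result broadcast. **Algorithm** (with parameters $\varepsilon,\delta$, constants $c,\kappa>0$, and $\delta'=2\delta^2$). *Start of a run:* The server broadcasts a seed for public coins. A rough estimate $\hat d$ of the size of the current domain is computed as the median of $\lceil\kappa\ln(1/\delta')\rceil$ independent copies of this experiment: by public coins each value $v$ gets a height $h_v$, the number of leading zeros among $\lceil\log_2 n\rceil$ bits; by private coins each node gets a truncated geometric height $g_i$ as above; the nodes for which the pair ($h_v$ of the observed value, $g_i$) is lexicographically largest broadcast, and $2^{h_v}$ is the result. The server broadcasts $p=2^{-q}$, $q\in\mathbb N$, which is $c\ln(1/\delta')/(\varepsilon^2\hat d)$ up to rounding to a power of two and truncation at $1$. By public coins each value is put into the *sample* independently with probability $p$. For each sampled value the nodes observing it run the maximum protocol, and the server picks a responding node uniformly at random as its representative and notifies it. The output is the number of received values divided by $p$. All nodes get status $1$. *Every later time step of the run:* Nodes that change their value get status $0$. The DomainMonitoring algorithm is applied to each sampled value $v$: if the representative of $v$ no longer observes $v$ it informs the server, which calls the maximum protocol on the nodes of status $1$ observing $v$ and, if nobody responds, on those of status $0$ observing $v$; a uniformly random responding node becomes the new representative and is notified,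 and if nobody responds, $v$ is deleted. If $v$ had no representative and is now observed, the nodes observing it run the maximum protocol and a random responding node becomes the representative and is notified. Whenever the representative was found among nodes of status $0$, all nodes observing $v$ get status $1$. The output is the first output of the run, plus $1/p$ times the number of sampled values that have entered, minus $1/p$ times the number of sampled values that have left the domain during the run (a value is counted each time). If the run has reached its step number $t\ge1/\delta$ (its first step has number $1$), or the estimated number of changes ($1/p$ times the number of these entries and exits) exceeds half of the first output, a new run is started within the same time step. All broadcasts, notifications and calls by the server are counted as messages. **Theorem.** There are constants $c,\kappa,C_1,C_2>0$ such that the following holds for this algorithm. 1. For all $n\ge2$, $\Delta$, $T\ge1$, $0<\varepsilon<1$, $0<\delta\le\frac12$, $0\le\sigma\le\frac12$ and every input with change rate at most $\sigma$: in each time step $t<T$ the output $\tilde d_t$ satisfies $(1-\varepsilon)|D_t|\le\tilde d_t\le(1+\varepsilon)|D_t|$ with probability at least $1-\delta$, and the expected number of messages is at most $$C_2\cdot B,\qquad B=\bigl(1+T\max\{2\sigma,\delta\}\bigr)\,\frac{\log_2 n\cdot R^*}{|D|\,\varepsilon^2}\,\log\frac1\delta .$$ 2. The bound is asymptotically attained: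 for every $0<\varepsilon<1$ there are inputs with arbitrarily large $n$, together with $T\ge1$, $0<\delta\le\frac12$ and $0\le\sigma\le\frac12$ bounding their change rate, for which the expected number of messages is at least $C_1\cdot B$. -/

import Mathlib

namespace CountDistinct

open Finset

/-! ## Inputs, domain, change rate, changes of representatives -/

/-- `x t i` is the value observed by node `i` in time step `t`. There are `n` nodes, the values are
the `Δ` elements of `Fin Δ`, and the considered time steps are `0, 1, …, T - 1`. -/
abbrev Input (n Δ : ℕ) : Type := ℕ → Fin n → Fin Δ

/-- The nodes that observe the value `v`. -/
def observers {n Δ : ℕ} (x : Fin n → Fin Δ) (v : Fin Δ) : Finset (Fin n) :=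
  univ.filter fun i => x i = v

/-- The set of values observed by at least one node. -/
def domain {n Δ : ℕ} (x : Fin n → Fin Δ) : Finset (Fin Δ) := univ.image x

/-- Between consecutive time steps the domain changes by at most a `σ`-fraction of its size. -/
def DomainChangeRate {n Δ : ℕ} (x : Input n Δ) (T : ℕ) (σ : ℝ) : Prop :=
  ∀ t : ℕ, t + 1 < T →
    ((domain (x t) \ domain (x (t + 1))).card : ℝ) + ((domain (x (t + 1)) \ domain (x t)).card : ℝ)
      ≤ σ * ((domain (x (t + 1))).card : ℝ)

/-- Between consecutive time steps, for every value `v`, the set of nodes observing `v` changes by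
at most a `σ`-fraction of its size. -/
def FrequencyChangeRate {n Δ : ℕ} (x : Input n Δ) (T : ℕ) (σ : ℝ) : Prop :=
  ∀ t : ℕ, t + 1 < T → ∀ v : Fin Δ,
    ((observers (x t) v \ observers (x (t + 1)) v).card : ℝ)
        + ((observers (x (t + 1)) v \ observers (x t) v).card : ℝ)
      ≤ σ * ((observers (x (t + 1)) v).card : ℝ)

theorem mem_domain_iff {n Δ : ℕ} (x : Fin n → Fin Δ) (v : Fin Δ) :
    v ∈ domain x ↔ (observers x v).Nonempty := by
  simp [domain, observers, Finset.Nonempty]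

/-- A bound `σ < 1` on the change of every frequency forces the domain to be constant. -/
theorem FrequencyChangeRate.domain_eq {n Δ : ℕ} {x : Input n Δ} {T : ℕ} {σ : ℝ}
    (h : FrequencyChangeRate x T σ) (hσ : σ < 1) (t : ℕ) (ht : t + 1 < T) :
    domain (x (t + 1)) = domain (x t) := by
  ext v
  have hv := h t ht v
  rw [mem_domain_iff, mem_domain_iff]
  constructor
  · intro hne
    by_contra hemp
    rw [Finset.not_nonempty_iff_eq_empty] at hemp
    rw [hemp] at hv
    have hpos : (0 : ℝ) < ((observers (x (t + 1)) v).card : ℝ) := by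
      exact_mod_cast Finset.card_pos.mpr hne
    simp at hv
    nlinarith
  · intro hne
    by_contra hemp
    rw [Finset.not_nonempty_iff_eq_empty] at hemp
    rw [hemp] at hv
    have hpos : (0 : ℝ) < ((observers (x t) v).card : ℝ) := by
      exact_mod_cast Finset.card_pos.mpr hne
    simp at hv
    rw [hv] at hne
    exact Finset.not_nonempty_empty hne

/-- Hence a bound on the change of the frequencies is a special case of a bound on the change of
the domain. -/
theorem FrequencyChangeRate.domainChangeRate {n Δ : ℕ} {x : Input n Δ} {T : ℕ} {σ : ℝ}
    (h : FrequencyChangeRate x T σ) (h0 : 0 ≤ σ) (h1 : σ < 1) : DomainChangeRate x T σ := by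
  intro t ht
  rw [h.domain_eq h1 t ht]
  simp only [sdiff_self, Finset.bot_eq_empty, Finset.card_empty, Nat.cast_zero, add_zero]
  positivity

/-- `R` assigns to every observed value a node observing it, and `none` (nil) to all others. -/
def ValidReps {n Δ : ℕ} (x : Fin n → Fin Δ) (R : Fin Δ → Option (Fin n)) : Prop :=
  (∀ v ∈ domain x, ∃ i, R v = some i ∧ x i = v) ∧ ∀ v ∉ domain x, R v = none

/-- Number of component-wise differences of two sequences of representatives. -/
def repChanges {n Δ : ℕ} (R R' : Fin Δ → Option (Fin n)) : ℕ :=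
  (univ.filter fun v => R v ≠ R' v).card

/-- `R*`: the minimum possible number of changes of representatives during the `T` time steps.
`R (t + 1)` is the sequence used in time step `t`; `R 0` is the situation before the first step, in
which no representative is given. -/
noncomputable def minRepChanges {n Δ : ℕ} (x : Input n Δ) (T : ℕ) : ℕ :=
  sInf {k | ∃ R : ℕ → Fin Δ → Option (Fin n), (∀ v, R 0 v = none) ∧
    (∀ t < T, ValidReps (x t) (R (t + 1))) ∧ k = ∑ t ∈ range T, repChanges (R t) (R (t + 1))}

/-- The smallest size of the domain during the `T` time steps. -/
noncomputable def minDomainSize {n Δ : ℕ} (x : Input n Δ) (T : ℕ) : ℕ :=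
  sInf {k | ∃ t < T, k = (domain (x t)).card}

/-! ## Coins and elementary protocols -/

/-- `log n`, rounded up to an integer. -/
def logN (n : ℕ) : ℕ := Nat.clog 2 n

/-- The number of leading zeros of a finite bit string. -/
def leadingZeros {L : ℕ} (b : Fin L → Bool) : ℕ :=
  (univ.filter fun k => ∀ j ≤ k, b j = false).card

/-- For uniform bits: a geometric random variable with success probability `1/2` (the number of
the first successful toss), truncated at `L`. -/
def truncGeom {L : ℕ} (b : Fin L → Bool) : ℕ := min L (leadingZeros b + 1)

/-- Independent draws from the distributions `μ 0, …, μ (m - 1)`. -/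
noncomputable def indep {α : Type} : (m : ℕ) → (Fin m → PMF α) → PMF (Fin m → α)
  | 0, _ => PMF.pure Fin.elim0
  | m + 1, μ => (μ 0).bind fun a =>
      (indep m fun j => μ j.succ).bind fun f => PMF.pure (Fin.cons (α := fun _ => α) a f)

/-- A uniformly random element of `s` (nil if `s` is empty). -/
noncomputable def pick {n : ℕ} (s : Finset (Fin n)) : PMF (Option (Fin n)) :=
  if h : s.Nonempty then (PMF.uniformOfFinset s h).map some else PMF.pure none

/-- The maximum protocol among a set `P` of nodes which observe the same value: every node of `P`
draws a geometric height `h`, truncated at `log n`, and broadcasts in round `log n - h` unless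
another node of `P` has broadcast in an earlier round. The result is the set of nodes that
broadcast; their number is the number of messages. -/
noncomputable def maxProtocol {n : ℕ} (P : Finset (Fin n)) : PMF (Finset (Fin n)) :=
  (PMF.uniformOfFintype (Fin n → Fin (logN n) → Bool)).map fun b =>
    P.filter fun i => ∀ j ∈ P, logN n - truncGeom (b i) ≤ logN n - truncGeom (b j)

/-! ## Estimation of the size of the domain in a single time step -/

/-- One run of the constant factor estimation. The public coins `ω.1` give every value `v` the
height `h v`; the private coins `ω.2` give every node `i` the height `g i`. Node `i` broadcasts
`h (x i)` in round `log² n - (h (x i) - 1) * log n - g i` unless some node has broadcast before.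
The result is the estimate `2 ^ h` of the size of the domain, with `h` the height received by the
server, together with the number of messages. -/
noncomputable def constFactor {n Δ : ℕ} (x : Fin n → Fin Δ) : PMF (ℕ × ℕ) :=
  (PMF.uniformOfFintype
    ((Fin Δ → Fin (logN n) → Bool) × (Fin n → Fin (logN n) → Bool))).map fun ω =>
    let h : Fin Δ → ℕ := fun v => leadingZeros (ω.1 v)
    let g : Fin n → ℕ := fun i => truncGeom (ω.2 i)
    let round : Fin n → ℤ := fun i =>
      (logN n : ℤ) ^ 2 - ((h (x i) : ℤ) - 1) * (logN n : ℤ) - (g i : ℤ)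
    let senders : Finset (Fin n) := univ.filter fun i => ∀ j, round i ≤ round j
    (2 ^ (senders.sup fun i => h (x i)), senders.card)

/-- The (lower) median: the least `k` such that at least half of the entries are at most `k`. -/
noncomputable def median {m : ℕ} (f : Fin m → ℕ) : ℕ :=
  sInf {k | m ≤ 2 * (univ.filter fun j => f j ≤ k).card}

/-- The constant factor estimation amplified to success probability `1 - δ'`: the median of
`⌈κ log (1/δ')⌉` independent runs, together with the total number of messages. -/
noncomputable def ampConstFactor {n Δ : ℕ} (κ δ' : ℝ) (x : Fin n → Fin Δ) : PMF (ℕ × ℕ) :=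
  (indep ⌈κ * Real.log (1 / δ')⌉₊ fun _ => constFactor x).map fun r =>
    (median fun j => (r j).1, ∑ j, (r j).2)

/-- The natural number `q` for which `2 ^ (-q)` is `c log (1/δ') / (ε² d)` up to rounding to a power
of two and truncation at `1`. -/
noncomputable def sampleExponent (c ε δ' : ℝ) (d : ℕ) : ℕ :=
  ⌊Real.logb 2 (ε ^ 2 * (d : ℝ) / (c * Real.log (1 / δ')))⌋₊

/-! ## The continuous algorithm -/

/-- The joint state of server and nodes at the end of a time step. -/
structure State (n Δ : ℕ) where
  /-- number of the current time step within the current run, starting with 1 -/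
  clock : ℕ
  /-- values are sampled with probability `p = 2 ^ (-q)` -/
  q : ℕ
  /-- the sample: values with a successful public coin flip -/
  sample : Finset (Fin Δ)
  /-- current representatives of the sampled values -/
  rep : Fin Δ → Option (Fin n)
  /-- `true` for the nodes of status 1, `false` for those of status 0 -/
  status : Fin n → Bool
  /-- number of sampled values received in the first step of the current run -/
  first : ℕ
  /-- number of sampled values that entered the domain, accumulated over the current run -/
  entered : ℕ
  /-- number of sampled values that left the domain, accumulated over the current run -/
  left : ℕ
  /-- output of the server in the current time step -/
  output : ℝ
  /-- number of all messages sent so far -/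
  messages : ℕ

/-- (Re)start of the algorithm in a time step with observations `x`, when `m` messages have been
sent before: the server broadcasts a seed; the size of the domain is estimated up to a constant
factor; the server broadcasts `q`; every value is sampled with probability `2 ^ (-q)` by public
coins; for every sampled value the nodes observing it run the maximum protocol, and the server
picks and notifies one of the responding nodes as the representative of the value. -/
noncomputable def start {n Δ : ℕ} (c κ ε δ : ℝ) (x : Fin n → Fin Δ) (m : ℕ) : PMF (State n Δ) := do
  let est ← ampConstFactor κ (2 * δ ^ 2) x
  let q : ℕ := sampleExponent c ε (2 * δ ^ 2) est.1
  let coins ← PMF.uniformOfFintype (Fin Δ → Fin q → Bool)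
  let sample : Finset (Fin Δ) := univ.filter fun v => ∀ j, coins v j = false
  let resp ← indep Δ fun v => maxProtocol (if v ∈ sample then observers x v else ∅)
  let rep ← indep Δ fun v => pick (resp v)
  let received : ℕ := (univ.filter fun v => (resp v).Nonempty).card
  pure
    { clock := 1
      q := q
      sample := sample
      rep := rep
      status := fun _ => true
      first := received
      entered := 0
      left := 0
      output := (received : ℝ) * 2 ^ q
      messages := m + 1 + est.2 + 1 + ∑ v, (resp v).card + received }

/-- What one step of the domain monitoring algorithm does to a single value. -/
structure ValueUpdate (n : ℕ) where
  /-- the new representative -/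
  rep : Option (Fin n)
  /-- whether a new phase of the value starts -/
  newPhase : Bool
  /-- number of messages -/
  messages : ℕ

/-- One step of the domain monitoring algorithm for the value `v` with representative `old`, in a
time step with observations `x`; nodes that have just changed their value already have status 0.

* `v` has no representative, that is, `v` was not observed before: the nodes that now observe `v`
  run the maximum protocol among the nodes of status 0. If there is a response, one responding node
  is picked and notified, and a new phase starts.
* The representative still observes `v`: nothing happens.
* Otherwise the representative informs the server (1 message), which calls the maximum protocol
  among the nodes of status 1 observing `v` (1 message, and the responses), and picks and notifies
  (1 message) a responding node. If there is no response, it calls (1 message, and the responses)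
  the maximum protocol among the nodes of status 0 observing `v`; if there is a response, one
  responding node is picked and notified (1 message) and a new phase starts, and otherwise `v` and
  its representative are deleted. -/
noncomputable def updateValue {n Δ : ℕ} (x : Fin n → Fin Δ) (status : Fin n → Bool) (v : Fin Δ)
    (old : Option (Fin n)) : PMF (ValueUpdate n) :=
  match old with
  | none => do
      let resp ← maxProtocol ((observers x v).filter fun i => status i = false)
      let r ← pick resp
      pure ⟨r, r.isSome, resp.card + if r.isSome then 1 else 0⟩
  | some i =>
      if x i = v then pure ⟨some i, false, 0⟩
      else do
        let resp₁ ← maxProtocol ((observers x v).filter fun j => status j = true)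
        if resp₁.Nonempty then do
          let r ← pick resp₁
          pure ⟨r, false, 1 + (1 + resp₁.card) + 1⟩
        else do
          let resp₀ ← maxProtocol ((observers x v).filter fun j => status j = false)
          let r ← pick resp₀
          pure ⟨r, r.isSome, 1 + 1 + (1 + resp₀.card) + if r.isSome then 1 else 0⟩

open Classical in
/-- One time step of the algorithm after the first one: `xOld` are the previous and `x` the current
observations. The domain monitoring algorithm is applied to the sampled values; the server updates
the estimate; if the current run has lasted `1/δ` steps, or the estimated number of changes of the
domain exceeds half of the first estimate, the algorithm is restarted within this time step. -/
noncomputable def step {n Δ : ℕ} (c κ ε δ : ℝ) (xOld x : Fin n → Fin Δ) (s : State n Δ) :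
    PMF (State n Δ) := do
  let status : Fin n → Bool := fun i => if x i = xOld i then s.status i else false
  let upd ← indep Δ fun v =>
    if v ∈ s.sample then updateValue x status v (s.rep v) else pure ⟨none, false, 0⟩
  let rep : Fin Δ → Option (Fin n) := fun v => (upd v).rep
  let entered : ℕ := s.entered + (univ.filter fun v => s.rep v = none ∧ rep v ≠ none).card
  let left : ℕ := s.left + (univ.filter fun v => s.rep v ≠ none ∧ rep v = none).card
  let messages : ℕ := s.messages + ∑ v, (upd v).messages
  if 1 / δ ≤ ((s.clock + 1 : ℕ) : ℝ) ∨
      ((s.first : ℝ) * 2 ^ s.q) / 2 < ((entered : ℝ) + (left : ℝ)) * 2 ^ s.q then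
    start c κ ε δ x messages
  else
    pure
      { clock := s.clock + 1
        q := s.q
        sample := s.sample
        rep := rep
        status := fun i => if (upd (x i)).newPhase then true else status i
        first := s.first
        entered := entered
        left := left
        output := (s.first : ℝ) * 2 ^ s.q + (entered : ℝ) * 2 ^ s.q - (left : ℝ) * 2 ^ s.q
        messages := messages }

/-- The distribution of the state at the end of time step `t` on the input `x`. -/
noncomputable def run {n Δ : ℕ} (c κ ε δ : ℝ) (x : Input n Δ) : ℕ → PMF (State n Δ)
  | 0 => start c κ ε δ (x 0) 0
  | t + 1 => (run c κ ε δ x t).bind fun s => step c κ ε δ (x t) (x (t + 1)) s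

/-! ## Quality and cost -/

/-- In each of the `T` time steps, with probability at least `1 - δ`, the output is an
`ε`-approximation of the size of the current domain. -/
def IsApproximation {n Δ : ℕ} (c κ ε δ : ℝ) (x : Input n Δ) (T : ℕ) : Prop :=
  ∀ t < T, ENNReal.ofReal (1 - δ) ≤ (run c κ ε δ x t).toOuterMeasure
    {s | (1 - ε) * ((domain (x t)).card : ℝ) ≤ s.output ∧
      s.output ≤ (1 + ε) * ((domain (x t)).card : ℝ)}

/-- The expected number of messages sent during the time steps `0, …, T - 1` (for `1 ≤ T`). -/
noncomputable def expectedMessages {n Δ : ℕ} (c κ ε δ : ℝ) (x : Input n Δ) (T : ℕ) : ENNReal :=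
  ∑' s, run c κ ε δ x (T - 1) s * (s.messages : ENNReal)

/-- `(1 + T max {2σ, δ}) * (log n * R* / (|D| ε²)) * log (1/δ)`. -/
noncomputable def messageBound {n Δ : ℕ} (ε δ σ : ℝ) (x : Input n Δ) (T : ℕ) : ℝ :=
  (1 + (T : ℝ) * max (2 * σ) δ) *
    (Real.logb 2 (n : ℝ) * (minRepChanges x T : ℝ) / ((minDomainSize x T : ℝ) * ε ^ 2)) *
    Real.log (1 / δ)

end CountDistinct

/-!
A run of the algorithm draws one random sample `S` of the values, with a sampling probability `p`.
Domain monitoring keeps a representative for exactly those sampled values that are observed, so in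
every later step `t` of the run the output is `|S ∩ D_t| / p`, and the decision to end the run is a
function of `S` as well (`Tracks.next`, `Tracks.not_restart_iff`). The only other randomness that
matters is the choice of the representatives. The active nodes of a value, those that have observed
it since the beginning of its current phase, form a set that is determined by the input and the
beginning of the run, and by symmetry of the maximum protocol the representative is a uniformly
random active node at all times (`Ex_pick_relocate`). These facts are collected in `Ex_run_eq`, which
gives the joint law of the sample and of one representative at time `s + k` on the event that the
current run began at time `s`.

*Quality.* The median of the rough estimates exceeds `64 |D_s|` only with small probability, so `p`
is large enough for Chernoff bounds. If `D_t` has at least a quarter of the size of `D_s`, then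
`|S ∩ D_t|` is concentrated; if it is smaller, a surviving run means that at most half of the sampled
values are gone, which contradicts concentration at time `s` or at time `t`. Each pair `s ≤ t` fails
with probability at most `δ ^ 2`, and at most `1 / δ` times `s` are possible (`isApproximation`).

*Number of runs.* During `1 / (32 max (2 σ) δ)` steps the domain changes so little that, by Markov's
inequality, a run survives with probability at least `1 / 2`. The events that the current run began
at `s` are disjoint for different `s`, so the expected number of runs starting in such a period is at
most `2` (`sum_startProb_Ico_le`), and `O(1 + T max (2 σ) δ)` in total.

*Cost.* A maximum protocol has `O(1)` responses in expectation. A first step of a run costs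
`O(log (1/δ) / ε²)`: the mean of the reciprocal of the rough estimate is `O(1 / |D_s|)`. In the later
steps messages are sent only when a representative is lost or a value enters. The representative is
lost with probability `|A \ A'| / |A|` when the set of active nodes shrinks from `A` to `A'`, and the
harmonic number of `|A|` is a potential that pays for this within a phase (`lossProb_add_harm_le`).
As no node observes the value throughout a whole phase, every sequence of representatives changes once
per phase (`add_card_newPhase_le`). So a run costs `O(log n)` times `p R*` even if it is charged for
the monitoring of the whole input, and the mean of `p` is `O(log (1/δ) / (ε² |D|))`.

*Attainment.* In `halvingInput` every value loses half of its remaining nodes in each of `k` steps,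
while one node stays. Then `R* = |D|`, there is only one run, and each sampled value loses its
representative with probability `1 / 2` in each of the `k = (log n) / 2` steps.
-/

namespace CountDistinct

open Finset
open scoped ENNReal

/-! ### Expectations with respect to probability mass functions -/

/-- The expectation of a nonnegative function. -/
noncomputable def Ex {α : Type*} (p : PMF α) (f : α → ℝ≥0∞) : ℝ≥0∞ := ∑' a, p a * f a

section Ex

variable {α β : Type*}

theorem Ex_pure (a : α) (f : α → ℝ≥0∞) : Ex (PMF.pure a) f = f a := by
  classical
  rw [Ex, tsum_eq_single a]
  · simp
  · intro b hb; simp [PMF.pure_apply, hb]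

theorem Ex_bind (p : PMF α) (k : α → PMF β) (f : β → ℝ≥0∞) :
    Ex (p.bind k) f = Ex p fun a => Ex (k a) f := by
  simp only [Ex, PMF.bind_apply, ← ENNReal.tsum_mul_right, ← ENNReal.tsum_mul_left, mul_assoc]
  exact ENNReal.tsum_comm

theorem Ex_map (p : PMF α) (g : α → β) (f : β → ℝ≥0∞) :
    Ex (p.map g) f = Ex p fun a => f (g a) := by
  rw [← PMF.bind_pure_comp, Ex_bind]
  simp only [Function.comp_apply, Ex_pure]

theorem Ex_add (p : PMF α) (f g : α → ℝ≥0∞) :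
    Ex p (fun a => f a + g a) = Ex p f + Ex p g := by
  simp only [Ex, mul_add, ENNReal.tsum_add]

theorem Ex_sum {ι : Type*} (p : PMF α) (s : Finset ι) (f : ι → α → ℝ≥0∞) :
    Ex p (fun a => ∑ i ∈ s, f i a) = ∑ i ∈ s, Ex p (f i) := by
  simp only [Ex, Finset.mul_sum]
  exact Summable.tsum_finsetSum fun _ _ => ENNReal.summable

theorem Ex_const_mul (p : PMF α) (c : ℝ≥0∞) (f : α → ℝ≥0∞) :
    Ex p (fun a => c * f a) = c * Ex p f := by
  simp only [Ex, ← ENNReal.tsum_mul_left]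
  exact tsum_congr fun a => by ring

theorem Ex_mul_const (p : PMF α) (c : ℝ≥0∞) (f : α → ℝ≥0∞) :
    Ex p (fun a => f a * c) = Ex p f * c := by
  simp only [mul_comm _ c, Ex_const_mul]

theorem Ex_const (p : PMF α) (c : ℝ≥0∞) : Ex p (fun _ => c) = c := by
  simp [Ex, ENNReal.tsum_mul_right, PMF.tsum_coe]

theorem Ex_mono {p : PMF α} {f g : α → ℝ≥0∞} (h : ∀ a ∈ p.support, f a ≤ g a) :
    Ex p f ≤ Ex p g := by
  refine ENNReal.tsum_le_tsum fun a => ?_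
  by_cases ha : a ∈ p.support
  · gcongr; exact h a ha
  · rw [PMF.mem_support_iff, not_not] at ha; simp [ha]

theorem Ex_congr {p : PMF α} {f g : α → ℝ≥0∞} (h : ∀ a ∈ p.support, f a = g a) :
    Ex p f = Ex p g :=
  le_antisymm (Ex_mono fun a ha => (h a ha).le) (Ex_mono fun a ha => (h a ha).ge)

theorem Ex_le_of_forall {p : PMF α} {f : α → ℝ≥0∞} {c : ℝ≥0∞} (h : ∀ a ∈ p.support, f a ≤ c) :
    Ex p f ≤ c := (Ex_mono h).trans (Ex_const p c).le

theorem le_Ex_of_forall {p : PMF α} {f : α → ℝ≥0∞} {c : ℝ≥0∞} (h : ∀ a ∈ p.support, c ≤ f a) :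
    c ≤ Ex p f := (Ex_const p c).ge.trans (Ex_mono h)

open Classical in
/-- The indicator of a proposition. -/
noncomputable def ind (P : Prop) : ℝ≥0∞ := if P then 1 else 0

@[simp] theorem ind_true {P : Prop} (h : P) : ind P = 1 := if_pos h
@[simp] theorem ind_false {P : Prop} (h : ¬P) : ind P = 0 := if_neg h

theorem ind_le_one (P : Prop) : ind P ≤ 1 := by
  by_cases h : P <;> simp [h]

theorem ind_mono {P Q : Prop} (h : P → Q) : ind P ≤ ind Q := by
  by_cases hP : P
  · simp [hP, h hP]
  · simp [hP]

theorem ind_and (P Q : Prop) : ind (P ∧ Q) = ind P * ind Q := by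
  by_cases hP : P <;> by_cases hQ : Q <;> simp [hP, hQ]

theorem ind_or_le (P Q : Prop) : ind (P ∨ Q) ≤ ind P + ind Q := by
  by_cases hP : P <;> by_cases hQ : Q <;> simp [hP, hQ]

theorem ind_add_not (P : Prop) : ind P + ind (¬P) = 1 := by
  by_cases hP : P <;> simp [hP]

theorem ind_mul_le (P : Prop) (c : ℝ≥0∞) : ind P * c ≤ c := by
  by_cases hP : P <;> simp [hP]

theorem ind_exists_le_sum {ι : Type*} (s : Finset ι) (P : ι → Prop) :
    ind (∃ i ∈ s, P i) ≤ ∑ i ∈ s, ind (P i) := by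
  by_cases h : ∃ i ∈ s, P i
  · obtain ⟨i, hi, hP⟩ := h
    calc ind _ ≤ 1 := ind_le_one _
      _ = ind (P i) := (ind_true hP).symm
      _ ≤ _ := Finset.single_le_sum (f := fun i => ind (P i)) (fun _ _ => zero_le) hi
  · simp [h]

theorem card_filter_eq_sum_ind {ι : Type*} (s : Finset ι) (P : ι → Prop) [DecidablePred P] :
    ((s.filter P).card : ℝ≥0∞) = ∑ i ∈ s, ind (P i) := by
  rw [Finset.card_filter]
  push_cast
  refine Finset.sum_congr rfl fun i _ => ?_
  by_cases h : P i <;> simp [h]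

theorem toOuterMeasure_eq_Ex (p : PMF α) (s : Set α) :
    p.toOuterMeasure s = Ex p fun a => ind (a ∈ s) := by
  rw [PMF.toOuterMeasure_apply, Ex]
  refine tsum_congr fun a => ?_
  by_cases h : a ∈ s <;> simp [h]

theorem Ex_ind_add_not (p : PMF α) (P : α → Prop) :
    Ex p (fun a => ind (P a)) + Ex p (fun a => ind (¬P a)) = 1 := by
  rw [← Ex_add]
  simp only [ind_add_not, Ex_const]

theorem Ex_ind_le_one (p : PMF α) (P : α → Prop) : Ex p (fun a => ind (P a)) ≤ 1 :=
  Ex_le_of_forall fun _ _ => ind_le_one _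

end Ex

/-! ### Independent draws and uniform distributions -/

theorem indep_prod {α : Type} (m : ℕ) (μ : Fin m → PMF α) (g : Fin m → α → ℝ≥0∞) :
    Ex (indep m μ) (fun r => ∏ j, g j (r j)) = ∏ j, Ex (μ j) (g j) := by
  induction m with
  | zero => simp [indep, Ex_pure]
  | succ m ih =>
    simp only [indep, Ex_bind, Ex_pure, Fin.prod_univ_succ, Fin.cons_zero, Fin.cons_succ,
      Ex_const_mul]
    rw [Ex_mul_const, ih (fun j => μ j.succ) fun j => g j.succ]

theorem indep_marginal {α : Type} (m : ℕ) (μ : Fin m → PMF α) (j : Fin m) (f : α → ℝ≥0∞) :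
    Ex (indep m μ) (fun r => f (r j)) = Ex (μ j) f := by
  have h := indep_prod m μ fun i => if i = j then f else fun _ => 1
  have h1 : ∀ r : Fin m → α, ∏ i, (if i = j then f else fun _ => 1) (r i) = f (r j) := by
    intro r
    rw [Finset.prod_eq_single j (by intro b _ hb; simp [hb]) (by simp)]
    simp
  simp only [h1] at h
  rw [h, Finset.prod_eq_single j (by intro b _ hb; simp [hb, Ex_const]) (by simp)]
  simp

theorem mem_support_indep {α : Type} {m : ℕ} {μ : Fin m → PMF α} {r : Fin m → α}
    (h : r ∈ (indep m μ).support) (j : Fin m) : r j ∈ (μ j).support := by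
  induction m with
  | zero => exact j.elim0
  | succ m ih =>
    simp only [indep, PMF.mem_support_bind_iff, PMF.mem_support_pure_iff] at h
    obtain ⟨a, ha, f, hf, rfl⟩ := h
    refine Fin.cases ?_ (fun i => ?_) j
    · simpa using ha
    · simpa using ih hf i

section Uniform

variable {α β ι : Type*} [Fintype α] [Nonempty α] [Fintype β] [Nonempty β] [Fintype ι]

theorem Ex_uniform (f : α → ℝ≥0∞) :
    Ex (PMF.uniformOfFintype α) f = (Fintype.card α : ℝ≥0∞)⁻¹ * ∑ a, f a := by
  simp [Ex, tsum_fintype, Finset.mul_sum]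

theorem Ex_uniform_equiv (e : α ≃ α) (f : α → ℝ≥0∞) :
    Ex (PMF.uniformOfFintype α) (fun a => f (e a)) = Ex (PMF.uniformOfFintype α) f := by
  rw [Ex_uniform, Ex_uniform, Equiv.sum_comp e f]

theorem Ex_uniform_prod (f : α × β → ℝ≥0∞) :
    Ex (PMF.uniformOfFintype (α × β)) f =
      Ex (PMF.uniformOfFintype α) fun a => Ex (PMF.uniformOfFintype β) fun b => f (a, b) := by
  simp only [Ex_uniform, Fintype.card_prod, Fintype.sum_prod_type, ← Finset.mul_sum, Nat.cast_mul]
  rw [ENNReal.mul_inv (by simp) (by simp), mul_assoc]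

theorem Ex_uniform_pi [DecidableEq ι] (g : ι → β → ℝ≥0∞) :
    Ex (PMF.uniformOfFintype (ι → β)) (fun ω => ∏ i, g i (ω i)) =
      ∏ i, Ex (PMF.uniformOfFintype β) (g i) := by
  simp only [Ex_uniform, Finset.prod_mul_distrib, Finset.prod_const, Finset.card_univ,
    Fintype.card_fun, Nat.cast_pow]
  rw [Finset.prod_univ_sum, Fintype.piFinset_univ, ENNReal.inv_pow]

theorem Ex_uniform_marginal [DecidableEq ι] (i : ι) (f : β → ℝ≥0∞) :
    Ex (PMF.uniformOfFintype (ι → β)) (fun ω => f (ω i)) = Ex (PMF.uniformOfFintype β) f := by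
  have h := Ex_uniform_pi (β := β) fun j => if j = i then f else fun _ => 1
  have h1 : ∀ r : ι → β, ∏ j, (if j = i then f else fun _ => 1) (r j) = f (r i) := by
    intro r
    rw [Finset.prod_eq_single i (by intro b _ hb; simp [hb]) (by simp)]
    simp
  simp only [h1] at h
  rw [h, Finset.prod_eq_single i (by intro b _ hb; simp [hb, Ex_const]) (by simp)]
  simp

theorem Ex_uniform_bool (f : Bool → ℝ≥0∞) :
    Ex (PMF.uniformOfFintype Bool) f = 2⁻¹ * (f true + f false) := by
  simp [Ex_uniform]

end Uniform

theorem prod_if_one_half {L k : ℕ} (hk : k ≤ L) :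
    (∏ j : Fin L, if (j : ℕ) < k then (2⁻¹ : ℝ≥0∞) else 1) = 2⁻¹ ^ k := by
  rw [Finset.prod_ite, Finset.prod_const_one, mul_one, Finset.prod_const]
  congr 1
  rw [Fin.card_filter_val_lt]; omega

/-- The first `k` of `L` fair coins all fail with probability `2 ^ (-k)`. -/
theorem Ex_prefix_false {L k : ℕ} (hk : k ≤ L) :
    Ex (PMF.uniformOfFintype (Fin L → Bool)) (fun b => ind (∀ j : Fin L, (j : ℕ) < k → b j = false))
      = 2⁻¹ ^ k := by
  have h := Ex_uniform_pi (β := Bool) (ι := Fin L)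
    fun j x => if (j : ℕ) < k then ind (x = false) else 1
  have h1 : ∀ b : Fin L → Bool, (∏ j : Fin L, if (j : ℕ) < k then ind (b j = false) else 1)
      = ind (∀ j : Fin L, (j : ℕ) < k → b j = false) := by
    intro b
    by_cases hb : ∀ j : Fin L, (j : ℕ) < k → b j = false
    · rw [ind_true hb]
      refine Finset.prod_eq_one fun j _ => ?_
      by_cases hj : (j : ℕ) < k
      · simp [hj, hb j hj]
      · simp [hj]
    · rw [ind_false hb]
      push Not at hb
      obtain ⟨j, hj, hbj⟩ := hb
      exact Finset.prod_eq_zero (Finset.mem_univ j) (by simp [hj, hbj])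
  simp only [h1] at h
  rw [h, ← prod_if_one_half hk]
  refine Finset.prod_congr rfl fun j _ => ?_
  by_cases hj : (j : ℕ) < k
  · simp [hj, Ex_uniform_bool]
  · simp [hj, Ex_const]

theorem le_leadingZeros_iff {L : ℕ} (b : Fin L → Bool) {k : ℕ} (hk : k ≤ L) :
    k ≤ leadingZeros b ↔ ∀ j : Fin L, (j : ℕ) < k → b j = false := by
  constructor
  · intro h j hj
    by_contra hb
    have hsub : (univ.filter fun i : Fin L => ∀ j ≤ i, b j = false) ⊆
        univ.filter fun i : Fin L => (i : ℕ) < j := by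
      intro i hi
      simp only [mem_filter, mem_univ, true_and] at hi ⊢
      by_contra hlt
      exact hb (hi j (by rw [Fin.le_def]; omega))
    have := Finset.card_le_card hsub
    rw [Fin.card_filter_val_lt] at this
    unfold leadingZeros at h
    omega
  · intro h
    have hsub : (univ.filter fun i : Fin L => (i : ℕ) < k) ⊆
        (univ.filter fun i : Fin L => ∀ j ≤ i, b j = false) := by
      intro i hi
      simp only [mem_filter, mem_univ, true_and] at hi ⊢
      intro j hj
      exact h j (by rw [Fin.le_def] at hj; omega)
    have := Finset.card_le_card hsub
    rw [Fin.card_filter_val_lt] at this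
    unfold leadingZeros
    omega

theorem leadingZeros_le {L : ℕ} (b : Fin L → Bool) : leadingZeros b ≤ L := by
  unfold leadingZeros
  exact (Finset.card_filter_le _ _).trans (by simp)

theorem Ex_le_leadingZeros {L k : ℕ} (hk : k ≤ L) :
    Ex (PMF.uniformOfFintype (Fin L → Bool)) (fun b => ind (k ≤ leadingZeros b)) = 2⁻¹ ^ k := by
  simp only [le_leadingZeros_iff _ hk, Ex_prefix_false hk]

theorem Ex_leadingZeros_lt {L k : ℕ} (hk : k ≤ L) :
    Ex (PMF.uniformOfFintype (Fin L → Bool)) (fun b => ind (leadingZeros b < k))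
      = 1 - 2⁻¹ ^ k := by
  have h := Ex_ind_add_not (PMF.uniformOfFintype (Fin L → Bool)) fun b => k ≤ leadingZeros b
  rw [Ex_le_leadingZeros hk] at h
  simp only [not_le] at h
  refine ENNReal.eq_sub_of_add_eq ?_ (by rw [add_comm]; exact h)
  simp

/-! ### The maximum protocol -/

theorem half_pow_eq_ofReal (k : ℕ) : (2⁻¹ : ℝ≥0∞) ^ k = ENNReal.ofReal ((1 / 2) ^ k) := by
  rw [ENNReal.ofReal_pow (by norm_num), one_div, ENNReal.ofReal_inv_of_pos (by norm_num)]
  simp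

theorem one_sub_half_pow_eq_ofReal (k : ℕ) :
    1 - (2⁻¹ : ℝ≥0∞) ^ k = ENNReal.ofReal (1 - (1 / 2) ^ k) := by
  rw [half_pow_eq_ofReal, ENNReal.ofReal_sub _ (by positivity), ENNReal.ofReal_one]

/-- The bound `y exp (-y) ≤ 2 (exp (-y/2) - exp (-y))` makes the sum over a geometric sequence of
`y` telescope. -/
theorem sum_mul_exp_neg_le (y : ℝ) (hy : 0 ≤ y) (m : ℕ) :
    ∑ k ∈ range m, y * (1 / 2) ^ k * Real.exp (-(y * (1 / 2) ^ k)) ≤ 2 := by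
  have hterm : ∀ k : ℕ, y * (1 / 2) ^ k * Real.exp (-(y * (1 / 2) ^ k)) ≤
      2 * Real.exp (-(y * (1 / 2) ^ (k + 1))) - 2 * Real.exp (-(y * (1 / 2) ^ k)) := by
    intro k
    set z := y * (1 / 2) ^ k with hz
    have hz' : y * (1 / 2) ^ (k + 1) = z / 2 := by rw [hz, pow_succ]; ring
    rw [hz']
    have h1 : Real.exp (-(z / 2)) = Real.exp (-z) * Real.exp (z / 2) := by
      rw [← Real.exp_add]; ring_nf
    have h2 : z / 2 + 1 ≤ Real.exp (z / 2) := Real.add_one_le_exp _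
    rw [h1]
    nlinarith [Real.exp_pos (-z), mul_le_mul_of_nonneg_left h2 (Real.exp_pos (-z)).le]
  refine (Finset.sum_le_sum fun k _ => hterm k).trans ?_
  rw [Finset.sum_range_sub (fun k => 2 * Real.exp (-(y * (1 / 2) ^ k)))]
  have h1 : Real.exp (-(y * (1 / 2) ^ m)) ≤ 1 := by
    rw [Real.exp_le_one_iff]; have : 0 ≤ y * (1 / 2) ^ m := by positivity
    linarith
  have h2 := Real.exp_pos (-(y * (1 / 2) ^ 0))
  linarith

theorem one_sub_pow_le_exp {x : ℝ} (hx : x ≤ 1) (N : ℕ) :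
    (1 - x) ^ N ≤ Real.exp (-(N * x)) := by
  calc (1 - x) ^ N ≤ (Real.exp (-x)) ^ N := by
        exact pow_le_pow_left₀ (by linarith) (Real.one_sub_le_exp_neg x) N
    _ = Real.exp (-(N * x)) := by rw [← Real.exp_nat_mul]; ring_nf

theorem truncGeom_le {L : ℕ} (b : Fin L → Bool) : truncGeom b ≤ L := min_le_left _ _

/-- Probability that node `i` has exactly `k` leading zeros and no node of `P` has more. -/
theorem Ex_eq_and_forall_le {n L k : ℕ} (P : Finset (Fin n)) {i : Fin n} (hi : i ∈ P)
    (hk : k + 1 ≤ L) :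
    Ex (PMF.uniformOfFintype (Fin n → Fin L → Bool))
        (fun b => ind (leadingZeros (b i) = k ∧ ∀ j ∈ P, leadingZeros (b j) ≤ k))
      ≤ ENNReal.ofReal ((1 / 2) ^ k * (1 - (1 / 2) ^ (k + 1)) ^ (P.card - 1)) := by
  have hle : ∀ b : Fin n → Fin L → Bool,
      ind (leadingZeros (b i) = k ∧ ∀ j ∈ P, leadingZeros (b j) ≤ k) ≤
        ∏ j, (if j = i then fun c => ind (k ≤ leadingZeros c) else
          if j ∈ P then fun c => ind (leadingZeros c < k + 1) else fun _ => 1) (b j) := by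
    intro b
    by_cases hb : leadingZeros (b i) = k ∧ ∀ j ∈ P, leadingZeros (b j) ≤ k
    · refine (ind_le_one _).trans (Finset.prod_eq_one fun j _ => ?_).ge
      by_cases hji : j = i
      · subst hji; simp [hb.1]
      · by_cases hjP : j ∈ P
        · simp [hji, hjP, Nat.lt_succ_of_le (hb.2 j hjP)]
        · simp [hji, hjP]
    · simp [ind_false hb]
  refine (Ex_mono fun b _ => hle b).trans ?_
  rw [Ex_uniform_pi (ι := Fin n), ← Finset.mul_prod_erase _ _ (Finset.mem_univ i), if_pos rfl,
    Ex_le_leadingZeros (by omega), ENNReal.ofReal_mul (by positivity), ← half_pow_eq_ofReal]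
  refine mul_le_mul_right ?_ _
  have h1 : ∀ j ∈ (univ : Finset (Fin n)).erase i,
      Ex (PMF.uniformOfFintype (Fin L → Bool)) (if j = i then fun c => ind (k ≤ leadingZeros c) else
          if j ∈ P then fun c => ind (leadingZeros c < k + 1) else fun _ => 1)
        = if j ∈ P then ENNReal.ofReal (1 - (1 / 2) ^ (k + 1)) else 1 := by
    intro j hj
    rw [if_neg (Finset.ne_of_mem_erase hj)]
    by_cases hjP : j ∈ P
    · simp only [hjP, if_true]
      rw [Ex_leadingZeros_lt hk, one_sub_half_pow_eq_ofReal]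
    · simp [hjP, Ex_const]
  rw [Finset.prod_congr rfl h1, Finset.prod_ite, Finset.prod_const_one, mul_one,
    Finset.prod_const, ENNReal.ofReal_pow]
  · have h2 : (univ.erase i).filter (· ∈ P) = P.erase i := by ext j; simp
    rw [h2, Finset.card_erase_of_mem hi]
  · have : (1 / 2 : ℝ) ^ (k + 1) ≤ 1 := pow_le_one₀ (by norm_num) (by norm_num)
    linarith

/-- Among at most `2 ^ L` truncated geometric random variables the maximum is attained by a bounded
number in expectation. -/
theorem Ex_card_max_truncGeom_le {n L : ℕ} (hn : n ≤ 2 ^ L) (P : Finset (Fin n)) :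
    Ex (PMF.uniformOfFintype (Fin n → Fin L → Bool))
        (fun b => ((P.filter fun i => ∀ j ∈ P, truncGeom (b j) ≤ truncGeom (b i)).card : ℝ≥0∞))
      ≤ 10 := by
  have hcard : P.card ≤ 2 ^ L := (Finset.card_le_univ P).trans (by simpa using hn)
  -- split by the number of leading zeros: `L - 1` and `L` both give the truncated value `L`
  have hle : ∀ b : Fin n → Fin L → Bool,
      ((P.filter fun i => ∀ j ∈ P, truncGeom (b j) ≤ truncGeom (b i)).card : ℝ≥0∞) ≤
        ∑ i ∈ P, (ind (L - 1 ≤ leadingZeros (b i)) + ∑ k ∈ range (L - 1),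
          ind (leadingZeros (b i) = k ∧ ∀ j ∈ P, leadingZeros (b j) ≤ k)) := by
    intro b
    rw [card_filter_eq_sum_ind]
    refine Finset.sum_le_sum fun i hi => ?_
    by_cases hmax : ∀ j ∈ P, truncGeom (b j) ≤ truncGeom (b i)
    · refine (ind_le_one _).trans ?_
      by_cases hL : L - 1 ≤ leadingZeros (b i)
      · simp [hL]
      · push Not at hL
        have hall : ∀ j ∈ P, leadingZeros (b j) ≤ leadingZeros (b i) := by
          intro j hj
          have := hmax j hj
          unfold truncGeom at this
          have h2 := leadingZeros_le (b j)
          omega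
        have hs : (1 : ℝ≥0∞) ≤ ∑ k ∈ range (L - 1),
            ind (leadingZeros (b i) = k ∧ ∀ j ∈ P, leadingZeros (b j) ≤ k) := by
          refine le_trans ?_ (Finset.single_le_sum (f := fun k =>
            ind (leadingZeros (b i) = k ∧ ∀ j ∈ P, leadingZeros (b j) ≤ k))
            (fun _ _ => zero_le) (Finset.mem_range.2 hL))
          exact (ind_true ⟨rfl, hall⟩).ge
        exact hs.trans le_add_self
    · rw [ind_false hmax]; exact zero_le
  refine (Ex_mono fun b _ => hle b).trans ?_
  simp only [Ex_sum, Ex_add]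
  have hfirst : ∀ i : Fin n, Ex (PMF.uniformOfFintype (Fin n → Fin L → Bool))
      (fun b => ind (L - 1 ≤ leadingZeros (b i))) = ENNReal.ofReal ((1 / 2) ^ (L - 1)) := by
    intro i
    rw [Ex_uniform_marginal i (fun c => ind (L - 1 ≤ leadingZeros c)),
      Ex_le_leadingZeros (by omega), half_pow_eq_ofReal]
  have hbound : ∀ i ∈ P, (Ex (PMF.uniformOfFintype (Fin n → Fin L → Bool))
      (fun b => ind (L - 1 ≤ leadingZeros (b i))) + ∑ k ∈ range (L - 1),
        Ex (PMF.uniformOfFintype (Fin n → Fin L → Bool))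
        (fun b => ind (leadingZeros (b i) = k ∧ ∀ j ∈ P, leadingZeros (b j) ≤ k))) ≤
      ENNReal.ofReal ((1 / 2) ^ (L - 1) + ∑ k ∈ range (L - 1),
        4 * ((1 / 2) ^ (k + 1) * Real.exp (-(P.card * (1 / 2) ^ (k + 1))))) := by
    intro i hi
    rw [hfirst, ENNReal.ofReal_add (by positivity) (by positivity),
      ENNReal.ofReal_sum_of_nonneg (fun k _ => by positivity)]
    gcongr with k hk
    have hk' : k + 1 ≤ L := by have := Finset.mem_range.1 hk; omega
    refine (Ex_eq_and_forall_le P hi hk').trans (ENNReal.ofReal_le_ofReal ?_)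
    have hx : (1 / 2 : ℝ) ^ (k + 1) ≤ 1 / 2 := by
      rw [pow_succ]
      have : (1 / 2 : ℝ) ^ k ≤ 1 := pow_le_one₀ (by norm_num) (by norm_num)
      linarith
    have hexp := one_sub_pow_le_exp (x := (1 / 2 : ℝ) ^ (k + 1)) (by linarith) P.card
    obtain ⟨m, hm⟩ : ∃ m, P.card = m + 1 :=
      ⟨P.card - 1, by have := Finset.card_pos.2 ⟨i, hi⟩; omega⟩
    have hpos : (0 : ℝ) ≤ (1 - (1 / 2) ^ (k + 1)) ^ m := by
      apply pow_nonneg; linarith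
    have h2 : (1 - (1 / 2 : ℝ) ^ (k + 1)) ^ (P.card - 1) ≤
        2 * Real.exp (-(P.card * (1 / 2) ^ (k + 1))) := by
      refine le_trans ?_ (mul_le_mul_of_nonneg_left hexp (by norm_num))
      generalize (1 / 2 : ℝ) ^ (k + 1) = y at hx hpos
      rw [hm, Nat.add_sub_cancel, pow_succ]
      nlinarith
    calc (1 / 2 : ℝ) ^ k * (1 - (1 / 2) ^ (k + 1)) ^ (P.card - 1)
        ≤ (1 / 2 : ℝ) ^ k * (2 * Real.exp (-(P.card * (1 / 2) ^ (k + 1)))) := by gcongr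
      _ = _ := by rw [pow_succ]; ring
  refine (Finset.sum_le_sum hbound).trans ?_
  rw [Finset.sum_const, nsmul_eq_mul, ← ENNReal.ofReal_natCast,
    ← ENNReal.ofReal_mul (by positivity), ← ENNReal.ofReal_ofNat]
  refine ENNReal.ofReal_le_ofReal ?_
  have hsum := sum_mul_exp_neg_le ((P.card : ℝ) * (1 / 2)) (by positivity) (L - 1)
  have h1 : (P.card : ℝ) * (1 / 2) ^ (L - 1) ≤ 2 := by
    have hc : (P.card : ℝ) ≤ 2 ^ L := by exact_mod_cast hcard
    rcases Nat.eq_zero_or_pos L with h | h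
    · subst h; simp at hc ⊢; linarith
    · obtain ⟨M, rfl⟩ : ∃ M, L = M + 1 := ⟨L - 1, by omega⟩
      rw [Nat.add_sub_cancel]
      calc (P.card : ℝ) * (1 / 2) ^ M ≤ 2 ^ (M + 1) * (1 / 2) ^ M := by gcongr
        _ = 2 := by rw [pow_succ, mul_right_comm, ← mul_pow]; norm_num
  have h2 : (P.card : ℝ) * ∑ k ∈ range (L - 1),
        4 * ((1 / 2) ^ (k + 1) * Real.exp (-(P.card * (1 / 2) ^ (k + 1)))) =
      4 * ∑ k ∈ range (L - 1), (P.card : ℝ) * (1 / 2) * (1 / 2) ^ k *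
        Real.exp (-((P.card : ℝ) * (1 / 2) * (1 / 2) ^ k)) := by
    rw [Finset.mul_sum, Finset.mul_sum]
    refine Finset.sum_congr rfl fun k _ => ?_
    have : (P.card : ℝ) * (1 / 2) ^ (k + 1) = (P.card : ℝ) * (1 / 2) * (1 / 2) ^ k := by
      rw [pow_succ]; ring
    rw [← this]; ring
  rw [mul_add, h2]
  linarith

theorem le_two_pow_logN (n : ℕ) : n ≤ 2 ^ logN n := Nat.le_pow_clog (by norm_num) n

theorem logN_sub_truncGeom_le_iff {L : ℕ} (b c : Fin L → Bool) :
    L - truncGeom b ≤ L - truncGeom c ↔ truncGeom c ≤ truncGeom b := by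
  have := truncGeom_le b
  have := truncGeom_le c
  omega

theorem maxProtocol_subset {n : ℕ} {P R : Finset (Fin n)} (h : R ∈ (maxProtocol P).support) :
    R ⊆ P := by
  simp only [maxProtocol, PMF.mem_support_map_iff] at h
  obtain ⟨b, _, rfl⟩ := h
  exact Finset.filter_subset _ _

theorem maxProtocol_nonempty_iff {n : ℕ} {P R : Finset (Fin n)}
    (h : R ∈ (maxProtocol P).support) : R.Nonempty ↔ P.Nonempty := by
  refine ⟨fun hR => hR.mono (maxProtocol_subset h), fun hP => ?_⟩
  simp only [maxProtocol, PMF.mem_support_map_iff] at h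
  obtain ⟨b, _, rfl⟩ := h
  obtain ⟨i, hi, hmin⟩ := Finset.exists_min_image P (fun i => logN n - truncGeom (b i)) hP
  exact ⟨i, by simp only [mem_filter]; exact ⟨hi, hmin⟩⟩

theorem Ex_maxProtocol_card_le {n : ℕ} (P : Finset (Fin n)) :
    Ex (maxProtocol P) (fun R => (R.card : ℝ≥0∞)) ≤ 10 := by
  rw [maxProtocol, Ex_map]
  simp only [logN_sub_truncGeom_le_iff]
  exact Ex_card_max_truncGeom_le (le_two_pow_logN n) P

theorem Ex_pick_of_nonempty {n : ℕ} {s : Finset (Fin n)} (h : s.Nonempty)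
    (f : Option (Fin n) → ℝ≥0∞) :
    Ex (pick s) f = (s.card : ℝ≥0∞)⁻¹ * ∑ i ∈ s, f (some i) := by
  rw [pick, dif_pos h, Ex_map, Ex, tsum_fintype, Finset.mul_sum]
  simp only [PMF.uniformOfFinset_apply, ite_mul, zero_mul, Finset.sum_ite_mem, Finset.univ_inter]

theorem Ex_pick_empty {n : ℕ} (f : Option (Fin n) → ℝ≥0∞) : Ex (pick ∅) f = f none := by
  simp [pick, Ex_pure]

theorem isSome_of_mem_support_pick {n : ℕ} {s : Finset (Fin n)} {r : Option (Fin n)}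
    (h : r ∈ (pick s).support) : r ≠ none ↔ s.Nonempty := by
  unfold pick at h
  split_ifs at h with hs
  · simp only [PMF.mem_support_map_iff] at h
    obtain ⟨a, _, rfl⟩ := h
    simp [hs]
  · simp only [PMF.mem_support_pure_iff] at h
    simp [h, hs]

theorem mem_of_mem_support_pick {n : ℕ} {s : Finset (Fin n)} {i : Fin n}
    (h : some i ∈ (pick s).support) : i ∈ s := by
  unfold pick at h
  split_ifs at h with hs
  · simpa using h
  · simp at h

/-- The nodes that answer to the maximum protocol are exchangeable, so a uniformly random
responding node is a uniformly random node. -/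
theorem Ex_maxProtocol_pick {n : ℕ} (P : Finset (Fin n)) (f : Option (Fin n) → ℝ≥0∞) :
    Ex (maxProtocol P) (fun R => Ex (pick R) f) = Ex (pick P) f := by
  rcases P.eq_empty_or_nonempty with rfl | hP
  · refine (Ex_congr (g := fun _ => Ex (pick ∅) f) fun R hR => ?_).trans (Ex_const _ _)
    rw [Finset.subset_empty.1 (maxProtocol_subset hR)]
  -- the probability that `i` is picked
  let w : Fin n → ℝ≥0∞ := fun i => Ex (maxProtocol P) fun R => (R.card : ℝ≥0∞)⁻¹ * ind (i ∈ R)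
  have hexp : ∀ f : Option (Fin n) → ℝ≥0∞,
      Ex (maxProtocol P) (fun R => Ex (pick R) f) = ∑ i ∈ P, w i * f (some i) := by
    intro f
    have : ∀ R ∈ (maxProtocol P).support, Ex (pick R) f =
        ∑ i ∈ P, (R.card : ℝ≥0∞)⁻¹ * ind (i ∈ R) * f (some i) := by
      intro R hR
      rw [Ex_pick_of_nonempty ((maxProtocol_nonempty_iff hR).2 hP), Finset.mul_sum]
      refine Finset.sum_subset_zero_on_sdiff (maxProtocol_subset hR) ?_ ?_
      · intro i hi
        rw [ind_false (Finset.mem_sdiff.1 hi).2]; simp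
      · intro i hi
        rw [ind_true hi, mul_one]
    rw [Ex_congr this, Ex_sum]
    simp only [Ex_mul_const, w]
  have hsymm : ∀ i ∈ P, ∀ j ∈ P, w i = w j := by
    intro i hi j hj
    simp only [w, maxProtocol, Ex_map]
    rw [← Ex_uniform_equiv (Equiv.arrowCongr (Equiv.swap i j) (Equiv.refl (Fin (logN n) → Bool)))]
    refine Ex_congr fun b _ => ?_
    have hP' : ∀ k, Equiv.swap i j k ∈ P ↔ k ∈ P := by
      intro k
      rcases eq_or_ne k i with rfl | h1
      · simp [hi, hj]
      rcases eq_or_ne k j with rfl | h2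
      · simp [hi, hj]
      rw [Equiv.swap_apply_of_ne_of_ne h1 h2]
    set R := P.filter fun k => ∀ l ∈ P,
      logN n - truncGeom (b k) ≤ logN n - truncGeom (b l) with hR
    have hR' : (P.filter fun k => ∀ l ∈ P, logN n - truncGeom (Equiv.arrowCongr (Equiv.swap i j)
        (Equiv.refl (Fin (logN n) → Bool)) b k) ≤ logN n - truncGeom (Equiv.arrowCongr
        (Equiv.swap i j) (Equiv.refl (Fin (logN n) → Bool)) b l)) =
        R.map (Equiv.swap i j).toEmbedding := by
      ext k
      rw [Finset.mem_map_equiv]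
      simp only [Equiv.arrowCongr_apply, Function.comp_apply, Equiv.symm_swap, Equiv.coe_refl,
        id_eq, mem_filter, hR, hP']
      refine and_congr_right fun _ => ⟨fun h l hl => ?_, fun h l hl => ?_⟩
      · have := h (Equiv.swap i j l) ((hP' l).2 hl)
        rwa [Equiv.swap_apply_self] at this
      · exact h _ ((hP' l).2 hl)
    rw [hR', Finset.card_map, Finset.mem_map_equiv]
    simp
  have hsum := hexp fun _ => 1
  simp only [Ex_const, mul_one] at hsum
  have hw : ∀ i ∈ P, w i = (P.card : ℝ≥0∞)⁻¹ := by
    intro i hi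
    have : ∑ j ∈ P, w j = P.card * w i := by
      rw [Finset.sum_congr rfl fun j hj => hsymm j hj i hi, Finset.sum_const, nsmul_eq_mul]
    rw [this] at hsum
    exact ENNReal.eq_inv_of_mul_eq_one_left (by rw [mul_comm]; exact hsum.symm)
  rw [hexp, Ex_pick_of_nonempty hP, Finset.mul_sum]
  exact Finset.sum_congr rfl fun i hi => by rw [hw i hi]

/-! ### The constant factor estimation -/

theorem domain_card_le {n Δ : ℕ} (x : Fin n → Fin Δ) : (domain x).card ≤ n := by
  simpa [domain] using Finset.card_image_le (s := (univ : Finset (Fin n))) (f := x)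

theorem domain_card_pos {n Δ : ℕ} (hn : 2 ≤ n) (x : Fin n → Fin Δ) : 0 < (domain x).card :=
  Finset.card_pos.2 ⟨x ⟨0, by omega⟩, Finset.mem_image_of_mem x (Finset.mem_univ _)⟩

theorem Ex_constFactor_messages_le {n Δ : ℕ} (x : Fin n → Fin Δ) :
    Ex (constFactor x) (fun r => (r.2 : ℝ≥0∞)) ≤ 10 := by
  rw [constFactor, Ex_map, Ex_uniform_prod]
  refine Ex_le_of_forall fun a _ => ?_
  -- given the public coins, only the nodes observing a value of maximal height can broadcast
  set P : Finset (Fin n) :=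
    univ.filter fun i => ∀ j, leadingZeros (a (x j)) ≤ leadingZeros (a (x i)) with hP
  refine le_trans (Ex_mono fun b _ => ?_) (Ex_card_max_truncGeom_le (le_two_pow_logN n) P)
  rw [Nat.cast_le]
  dsimp only
  refine Finset.card_le_card fun i hi => ?_
  simp only [mem_filter, mem_univ, true_and] at hi
  have hiP : i ∈ P := by
    simp only [hP, mem_filter, mem_univ, true_and]
    intro j
    by_contra hlt
    push Not at hlt
    have h := hi j
    have h1 := truncGeom_le (b i)
    have h2 : 1 ≤ truncGeom (b j) := by
      have := leadingZeros_le (a (x j))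
      unfold truncGeom; omega
    have h3 : ((leadingZeros (a (x i)) : ℤ) + 1) * (logN n : ℤ) ≤
        (leadingZeros (a (x j)) : ℤ) * (logN n : ℤ) := by
      gcongr; exact_mod_cast hlt
    have h4 : (truncGeom (b i) : ℤ) ≤ logN n := by exact_mod_cast h1
    have h5 : (1 : ℤ) ≤ truncGeom (b j) := by exact_mod_cast h2
    linarith
  refine Finset.mem_filter.2 ⟨hiP, fun j hj => ?_⟩
  have h1 : leadingZeros (a (x j)) = leadingZeros (a (x i)) := by
    simp only [hP, mem_filter, mem_univ, true_and] at hiP hj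
    exact le_antisymm (hiP j) (hj i)
  have h := hi j
  rw [h1] at h
  have : (truncGeom (b j) : ℤ) ≤ truncGeom (b i) := by linarith
  exact_mod_cast this

theorem Ex_lt_two_pow_leadingZeros {L y : ℕ} (hy : 0 < y) :
    Ex (PMF.uniformOfFintype (Fin L → Bool)) (fun b => ind (y < 2 ^ leadingZeros b))
      ≤ (y : ℝ≥0∞)⁻¹ := by
  set k := Nat.log 2 y + 1 with hk
  have hyk : y < 2 ^ k := Nat.lt_pow_succ_log_self (by norm_num) y
  have himp : ∀ b : Fin L → Bool, y < 2 ^ leadingZeros b → k ≤ leadingZeros b := by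
    intro b hb
    have := Nat.log_lt_of_lt_pow hy.ne' hb
    omega
  by_cases hkL : k ≤ L
  · calc _ ≤ Ex (PMF.uniformOfFintype (Fin L → Bool)) (fun b => ind (k ≤ leadingZeros b)) :=
          Ex_mono fun b _ => ind_mono (himp b)
      _ = 2⁻¹ ^ k := Ex_le_leadingZeros hkL
      _ ≤ (y : ℝ≥0∞)⁻¹ := by
          rw [← ENNReal.inv_pow, ENNReal.inv_le_inv]
          exact_mod_cast hyk.le
  · refine (Ex_le_of_forall (c := 0) fun b _ => ?_).trans zero_le
    rw [ind_false]
    intro hb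
    exact hkL ((himp b hb).trans (leadingZeros_le b))

/-- The estimate is rarely far too large. -/
theorem Ex_constFactor_large_le {n Δ : ℕ} (hn : 2 ≤ n) (x : Fin n → Fin Δ) :
    Ex (constFactor x) (fun r => ind (64 * (domain x).card < r.1)) ≤ 64⁻¹ := by
  have hd := domain_card_pos hn x
  rw [constFactor, Ex_map, Ex_uniform_prod]
  have h1 : ∀ a : Fin Δ → Fin (logN n) → Bool, ∀ s : Finset (Fin n),
      ind (64 * (domain x).card < 2 ^ (s.sup fun i => leadingZeros (a (x i)))) ≤
        ∑ v ∈ domain x, ind (64 * (domain x).card < 2 ^ leadingZeros (a v)) := by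
    intro a s
    refine (ind_mono fun h => ?_).trans (ind_exists_le_sum _ _)
    rcases s.eq_empty_or_nonempty with rfl | hs
    · rw [Finset.sup_empty, Nat.bot_eq_zero, pow_zero] at h; omega
    · obtain ⟨i, _, hi⟩ := Finset.exists_mem_eq_sup s hs fun i => leadingZeros (a (x i))
      rw [hi] at h
      exact ⟨x i, Finset.mem_image_of_mem x (Finset.mem_univ i), h⟩
  refine (Ex_mono fun a _ => Ex_le_of_forall fun b _ => h1 a _).trans ?_
  rw [Ex_sum]
  have h2 : ∀ v ∈ domain x, Ex (PMF.uniformOfFintype (Fin Δ → Fin (logN n) → Bool))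
      (fun a => ind (64 * (domain x).card < 2 ^ leadingZeros (a v))) ≤
        ((64 * (domain x).card : ℕ) : ℝ≥0∞)⁻¹ := by
    intro v _
    rw [Ex_uniform_marginal v fun c => ind (64 * (domain x).card < 2 ^ leadingZeros c)]
    exact Ex_lt_two_pow_leadingZeros (by omega)
  refine (Finset.sum_le_sum h2).trans ?_
  rw [Finset.sum_const, nsmul_eq_mul, Nat.cast_mul, ENNReal.mul_inv (by simp) (by simp),
    mul_left_comm, ENNReal.mul_inv_cancel (by exact_mod_cast hd.ne') (by simp)]
  simp

theorem half_pow_le_sum {H L : ℕ} (h : H ≤ L) :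
    (2⁻¹ : ℝ≥0∞) ^ H ≤ 2⁻¹ ^ L + ∑ k ∈ range L, 2⁻¹ ^ (k + 1) * ind (H ≤ k) := by
  induction L, h using Nat.le_induction with
  | base => exact le_self_add
  | succ L hL ih =>
    refine ih.trans ?_
    rw [Finset.sum_range_succ, ind_true hL, mul_one]
    have : (2⁻¹ : ℝ≥0∞) ^ L = 2⁻¹ ^ (L + 1) + 2⁻¹ ^ (L + 1) := by
      rw [pow_succ, ← mul_add, ENNReal.inv_two_add_inv_two, mul_one]
    rw [this]
    exact (by ring : _ = _).le

/-- The estimate is rarely far too small, as expressed by the mean of its reciprocal. -/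
theorem Ex_constFactor_inv_le {n Δ : ℕ} (hn : 2 ≤ n) (x : Fin n → Fin Δ) :
    Ex (constFactor x) (fun r => (r.1 : ℝ≥0∞)⁻¹) ≤ ENNReal.ofReal (3 / (domain x).card) := by
  have hd : (0 : ℝ) < (domain x).card := by exact_mod_cast domain_card_pos hn x
  set L := logN n with hL
  have hdL : ((domain x).card : ℝ) ≤ 2 ^ L := by
    exact_mod_cast (domain_card_le x).trans (le_two_pow_logN n)
  rw [constFactor, Ex_map, Ex_uniform_prod]
  simp only
  have h1 : ∀ a : Fin Δ → Fin L → Bool, ∀ b : Fin n → Fin L → Bool,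
      (((2 ^ ((univ.filter fun i => ∀ j,
        (logN n : ℤ) ^ 2 - ((leadingZeros (a (x i)) : ℤ) - 1) * (logN n : ℤ) - (truncGeom (b i) : ℤ)
        ≤ (logN n : ℤ) ^ 2 - ((leadingZeros (a (x j)) : ℤ) - 1) * (logN n : ℤ)
          - (truncGeom (b j) : ℤ)).sup fun i => leadingZeros (a (x i))) : ℕ) : ℝ≥0∞))⁻¹ ≤
      2⁻¹ ^ L + ∑ k ∈ range L, 2⁻¹ ^ (k + 1) *
        ind (∀ v ∈ domain x, leadingZeros (a v) < k + 1) := by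
    intro a b
    set s : Finset (Fin n) := univ.filter fun i => ∀ j,
        (logN n : ℤ) ^ 2 - ((leadingZeros (a (x i)) : ℤ) - 1) * (logN n : ℤ) - (truncGeom (b i) : ℤ)
        ≤ (logN n : ℤ) ^ 2 - ((leadingZeros (a (x j)) : ℤ) - 1) * (logN n : ℤ)
          - (truncGeom (b j) : ℤ) with hs
    set H := s.sup fun i => leadingZeros (a (x i)) with hH
    have hHL : H ≤ L := Finset.sup_le fun i _ => leadingZeros_le _
    have hmax : ∀ v ∈ domain x, leadingZeros (a v) ≤ H := by
      intro v hv
      obtain ⟨j, _, rfl⟩ := Finset.mem_image.1 hv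
      obtain ⟨i, _, hmin⟩ := Finset.exists_min_image (univ : Finset (Fin n)) (fun i =>
        (logN n : ℤ) ^ 2 - ((leadingZeros (a (x i)) : ℤ) - 1) * (logN n : ℤ)
          - (truncGeom (b i) : ℤ)) ⟨j, Finset.mem_univ j⟩
      have his : i ∈ s := by
        simp only [hs, mem_filter, mem_univ, true_and]
        exact fun j => hmin j (Finset.mem_univ j)
      refine le_trans ?_ (Finset.le_sup (f := fun i => leadingZeros (a (x i))) his)
      by_contra hlt
      push Not at hlt
      have h := hmin j (Finset.mem_univ j)
      have h1 := truncGeom_le (b i)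
      have h2 : 1 ≤ truncGeom (b j) := by
        have := leadingZeros_le (a (x j))
        unfold truncGeom; omega
      have h3 : ((leadingZeros (a (x i)) : ℤ) + 1) * (logN n : ℤ) ≤
          (leadingZeros (a (x j)) : ℤ) * (logN n : ℤ) := by
        gcongr; exact_mod_cast hlt
      have h4 : (truncGeom (b i) : ℤ) ≤ logN n := by exact_mod_cast h1
      have h5 : (1 : ℤ) ≤ truncGeom (b j) := by exact_mod_cast h2
      linarith
    rw [Nat.cast_pow, Nat.cast_ofNat, ENNReal.inv_pow]
    refine (half_pow_le_sum hHL).trans ?_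
    gcongr with k hk
    exact ind_mono fun h v hv => Nat.lt_succ_of_le ((hmax v hv).trans h)
  refine (Ex_mono fun a _ => Ex_le_of_forall fun b _ => h1 a b).trans ?_
  rw [Ex_add, Ex_const, Ex_sum]
  simp only [Ex_const_mul]
  have h2 : ∀ k ∈ range L, Ex (PMF.uniformOfFintype (Fin Δ → Fin L → Bool))
      (fun a => ind (∀ v ∈ domain x, leadingZeros (a v) < k + 1)) ≤
        ENNReal.ofReal (Real.exp (-((domain x).card * (1 / 2) ^ (k + 1)))) := by
    intro k hk
    have hk' : k + 1 ≤ L := Finset.mem_range.1 hk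
    have hle : ∀ a : Fin Δ → Fin L → Bool, ind (∀ v ∈ domain x, leadingZeros (a v) < k + 1) ≤
        ∏ v, (if v ∈ domain x then fun c => ind (leadingZeros c < k + 1) else fun _ => 1) (a v) := by
      intro a
      by_cases h : ∀ v ∈ domain x, leadingZeros (a v) < k + 1
      · refine (ind_le_one _).trans (Finset.prod_eq_one fun v _ => ?_).ge
        by_cases hv : v ∈ domain x
        · simp [hv, h v hv]
        · simp [hv]
      · rw [ind_false h]; exact zero_le
    refine (Ex_mono fun a _ => hle a).trans ?_
    rw [Ex_uniform_pi]
    have h3 : ∀ v : Fin Δ, Ex (PMF.uniformOfFintype (Fin L → Bool))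
        (if v ∈ domain x then fun c => ind (leadingZeros c < k + 1) else fun _ => 1)
        = if v ∈ domain x then ENNReal.ofReal (1 - (1 / 2) ^ (k + 1)) else 1 := by
      intro v
      by_cases hv : v ∈ domain x
      · simp only [hv, if_true]
        rw [Ex_leadingZeros_lt hk', one_sub_half_pow_eq_ofReal]
      · simp [hv, Ex_const]
    have hx : (1 / 2 : ℝ) ^ (k + 1) ≤ 1 := pow_le_one₀ (by norm_num) (by norm_num)
    rw [Finset.prod_congr rfl fun v _ => h3 v, Finset.prod_ite, Finset.prod_const_one, mul_one,
      Finset.prod_const, ← ENNReal.ofReal_pow (by linarith)]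
    have h4 : (univ.filter fun v => v ∈ domain x) = domain x := by ext; simp
    rw [h4]
    exact ENNReal.ofReal_le_ofReal (one_sub_pow_le_exp hx _)
  calc _ ≤ (2⁻¹ : ℝ≥0∞) ^ L + ∑ k ∈ range L, 2⁻¹ ^ (k + 1) *
        ENNReal.ofReal (Real.exp (-((domain x).card * (1 / 2) ^ (k + 1)))) := by
        gcongr with k hk; exact h2 k hk
    _ = ENNReal.ofReal ((1 / 2) ^ L + ∑ k ∈ range L, (1 / 2) ^ (k + 1) *
        Real.exp (-((domain x).card * (1 / 2) ^ (k + 1)))) := by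
        rw [ENNReal.ofReal_add (by positivity) (by positivity),
          ENNReal.ofReal_sum_of_nonneg (fun k _ => by positivity), half_pow_eq_ofReal]
        congr 1
        refine Finset.sum_congr rfl fun k _ => ?_
        rw [half_pow_eq_ofReal, ENNReal.ofReal_mul (by positivity)]
    _ ≤ _ := by
        refine ENNReal.ofReal_le_ofReal ?_
        rw [le_div_iff₀ hd, add_mul, Finset.sum_mul]
        have h5 := sum_mul_exp_neg_le ((domain x).card * (1 / 2) : ℝ) (by positivity) L
        have h6 : ∑ k ∈ range L, (1 / 2 : ℝ) ^ (k + 1) *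
            Real.exp (-((domain x).card * (1 / 2) ^ (k + 1))) * (domain x).card =
            ∑ k ∈ range L, ((domain x).card * (1 / 2) : ℝ) * (1 / 2) ^ k *
              Real.exp (-((domain x).card * (1 / 2) * (1 / 2) ^ k)) := by
          refine Finset.sum_congr rfl fun k _ => ?_
          have : ((domain x).card : ℝ) * (1 / 2) ^ (k + 1) =
              (domain x).card * (1 / 2) * (1 / 2) ^ k := by
            rw [pow_succ]; ring
          rw [← this]; ring
        have h7 : (1 / 2 : ℝ) ^ L * (domain x).card ≤ 1 := by
          calc (1 / 2 : ℝ) ^ L * (domain x).card ≤ (1 / 2) ^ L * 2 ^ L := by gcongr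
            _ = 1 := by rw [← mul_pow]; norm_num
        rw [h6]; linarith

/-! ### The median of independent estimates -/

theorem median_spec {m : ℕ} (f : Fin m → ℕ) :
    m ≤ 2 * (univ.filter fun j => f j ≤ median f).card := by
  have hne : {k | m ≤ 2 * (univ.filter fun j => f j ≤ k).card}.Nonempty := by
    refine ⟨univ.sup f, ?_⟩
    have : (univ.filter fun j => f j ≤ univ.sup f) = univ :=
      Finset.filter_true_of_mem fun j hj => Finset.le_sup hj
    simp only [Set.mem_ofPred_eq, this, Finset.card_univ, Fintype.card_fin]
    omega
  exact Nat.sInf_mem hne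

theorem card_gt_of_lt_median {m : ℕ} {f : Fin m → ℕ} {k : ℕ} (h : k < median f) :
    m < 2 * (univ.filter fun j => k < f j).card := by
  have h1 := Nat.notMem_of_lt_sInf h
  simp only [Set.mem_ofPred_eq, not_le] at h1
  have h2 := Finset.card_filter_add_card_filter_not (s := (univ : Finset (Fin m))) (fun j => f j ≤ k)
  simp only [not_le, Finset.card_univ, Fintype.card_fin] at h2
  omega

theorem Ex_indep_median_large_le {α : Type} (m : ℕ) (μ : PMF α) (e : α → ℕ) (K : ℕ)
    (h : Ex μ (fun a => ind (K < e a)) ≤ 64⁻¹) :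
    Ex (indep m fun _ => μ) (fun r => ind (K < median fun j => e (r j))) ≤ 4⁻¹ ^ m := by
  -- exponential Markov inequality with base `64`
  have h1 : ∀ r : Fin m → α, ind (K < median fun j => e (r j)) ≤
      8⁻¹ ^ m * ∏ j, (1 + 64 * ind (K < e (r j))) := by
    intro r
    by_cases hr : K < median fun j => e (r j)
    · have hc := card_gt_of_lt_median hr
      set s := univ.filter fun j => K < e (r j) with hs
      have h2 : (8 : ℝ≥0∞) ^ m ≤ ∏ j, (1 + 64 * ind (K < e (r j))) := by
        calc (8 : ℝ≥0∞) ^ m ≤ 8 ^ (2 * s.card) := pow_le_pow_right₀ (by norm_num) hc.le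
          _ = ∏ j ∈ s, 64 := by rw [pow_mul, Finset.prod_const]; norm_num
          _ ≤ ∏ j ∈ s, (1 + 64 * ind (K < e (r j))) := by
              refine Finset.prod_le_prod' fun j hj => ?_
              rw [ind_true (Finset.mem_filter.1 hj).2, mul_one]
              exact le_add_self
          _ ≤ _ := Finset.prod_le_prod_of_subset_of_one_le' (Finset.filter_subset _ _)
              fun j _ _ => le_self_add
      rw [ind_true hr]
      calc (1 : ℝ≥0∞) = 8⁻¹ ^ m * 8 ^ m := by
            rw [← mul_pow, ENNReal.inv_mul_cancel (by norm_num) (by norm_num), one_pow]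
        _ ≤ _ := by gcongr
    · rw [ind_false hr]; exact zero_le
  refine (Ex_mono fun r _ => h1 r).trans ?_
  rw [Ex_const_mul, indep_prod m (fun _ => μ) fun _ a => 1 + 64 * ind (K < e a)]
  have h2 : Ex μ (fun a => 1 + 64 * ind (K < e a)) ≤ 2 := by
    rw [Ex_add, Ex_const, Ex_const_mul]
    calc 1 + 64 * Ex μ (fun a => ind (K < e a)) ≤ 1 + 64 * 64⁻¹ := by gcongr
      _ = 2 := by rw [ENNReal.mul_inv_cancel (by norm_num) (by norm_num)]; norm_num
  rw [Finset.prod_const, Finset.card_univ, Fintype.card_fin]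
  calc _ ≤ (8⁻¹ : ℝ≥0∞) ^ m * 2 ^ m := by gcongr
    _ = 4⁻¹ ^ m := by
      rw [← mul_pow]
      congr 1
      rw [show (8 : ℝ≥0∞) = 4 * 2 by norm_num, ENNReal.mul_inv (by simp) (by simp), mul_assoc,
        ENNReal.inv_mul_cancel (by norm_num) (by norm_num), mul_one]

theorem Ex_indep_median_inv_le {α : Type} {m : ℕ} (hm : 0 < m) (μ : PMF α) (e : α → ℕ) :
    Ex (indep m fun _ => μ) (fun r => ((median fun j => e (r j) : ℕ) : ℝ≥0∞)⁻¹) ≤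
      2 * Ex μ fun a => (e a : ℝ≥0∞)⁻¹ := by
  have h1 : ∀ r : Fin m → α, (m : ℝ≥0∞) * ((median fun j => e (r j) : ℕ) : ℝ≥0∞)⁻¹ ≤
      2 * ∑ j, (e (r j) : ℝ≥0∞)⁻¹ := by
    intro r
    set k := median fun j => e (r j) with hk
    set s := univ.filter fun j => e (r j) ≤ k with hs
    have h2 : (m : ℝ≥0∞) ≤ 2 * s.card := by exact_mod_cast median_spec fun j => e (r j)
    calc (m : ℝ≥0∞) * (k : ℝ≥0∞)⁻¹ ≤ 2 * s.card * (k : ℝ≥0∞)⁻¹ := by gcongr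
      _ = 2 * ∑ j ∈ s, (k : ℝ≥0∞)⁻¹ := by rw [Finset.sum_const, nsmul_eq_mul, mul_assoc]
      _ ≤ 2 * ∑ j ∈ s, (e (r j) : ℝ≥0∞)⁻¹ := by
          gcongr with j hj
          exact_mod_cast (Finset.mem_filter.1 hj).2
      _ ≤ _ := by gcongr; exact Finset.filter_subset _ _
  have h2 := Ex_mono (p := indep m fun _ => μ) fun r _ => h1 r
  rw [Ex_const_mul, Ex_const_mul, Ex_sum] at h2
  have h3 : ∀ j ∈ (univ : Finset (Fin m)), Ex (indep m fun _ => μ)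
      (fun r => (e (r j) : ℝ≥0∞)⁻¹) = Ex μ fun a => (e a : ℝ≥0∞)⁻¹ :=
    fun j _ => indep_marginal m (fun _ => μ) j fun a => (e a : ℝ≥0∞)⁻¹
  rw [Finset.sum_congr rfl h3, Finset.sum_const, Finset.card_univ, Fintype.card_fin, nsmul_eq_mul,
    mul_left_comm] at h2
  exact (ENNReal.mul_le_mul_iff_right (by exact_mod_cast hm.ne') (by simp)).1 h2

section Amplified

variable {n Δ : ℕ} (κ δ' : ℝ) (x : Fin n → Fin Δ)

theorem Ex_ampConstFactor_messages_le :
    Ex (ampConstFactor κ δ' x) (fun r => (r.2 : ℝ≥0∞)) ≤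
      10 * (⌈κ * Real.log (1 / δ')⌉₊ : ℝ≥0∞) := by
  rw [ampConstFactor, Ex_map]
  push_cast
  rw [Ex_sum]
  have h3 : ∀ j ∈ (univ : Finset (Fin ⌈κ * Real.log (1 / δ')⌉₊)),
      Ex (indep _ fun _ => constFactor x) (fun r => ((r j).2 : ℝ≥0∞)) ≤ 10 := by
    intro j _
    rw [indep_marginal _ (fun _ => constFactor x) j fun r => (r.2 : ℝ≥0∞)]
    exact Ex_constFactor_messages_le x
  refine (Finset.sum_le_sum h3).trans ?_
  rw [Finset.sum_const, Finset.card_univ, Fintype.card_fin, nsmul_eq_mul, mul_comm]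

theorem Ex_ampConstFactor_large_le (hn : 2 ≤ n) :
    Ex (ampConstFactor κ δ' x) (fun r => ind (64 * (domain x).card < r.1)) ≤
      4⁻¹ ^ ⌈κ * Real.log (1 / δ')⌉₊ := by
  rw [ampConstFactor, Ex_map]
  exact Ex_indep_median_large_le _ _ _ _ (Ex_constFactor_large_le hn x)

theorem Ex_ampConstFactor_inv_le (hn : 2 ≤ n) (hm : 0 < κ * Real.log (1 / δ')) :
    Ex (ampConstFactor κ δ' x) (fun r => (r.1 : ℝ≥0∞)⁻¹) ≤
      ENNReal.ofReal (6 / (domain x).card) := by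
  rw [ampConstFactor, Ex_map]
  refine (Ex_indep_median_inv_le (Nat.ceil_pos.2 hm) _ _).trans ?_
  refine (mul_le_mul_right (Ex_constFactor_inv_le hn x) _).trans ?_
  rw [← ENNReal.ofReal_ofNat 2, ← ENNReal.ofReal_mul (by norm_num)]
  exact ENNReal.ofReal_le_ofReal (by ring_nf; exact le_rfl)

end Amplified

/-! ### Sampling with public coins -/

/-- The random set that contains every value independently with probability `2 ^ (-q)`. -/
noncomputable def coinSample (Δ q : ℕ) : PMF (Finset (Fin Δ)) :=
  (PMF.uniformOfFintype (Fin Δ → Fin q → Bool)).map fun coins =>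
    univ.filter fun v => ∀ j, coins v j = false

theorem Ex_all_false (q : ℕ) :
    Ex (PMF.uniformOfFintype (Fin q → Bool)) (fun b => ind (∀ j, b j = false)) = 2⁻¹ ^ q := by
  rw [← Ex_prefix_false (le_refl q)]
  refine Ex_congr fun b _ => ?_
  congr 1
  simp

theorem Ex_coinSample_mem (Δ q : ℕ) (v : Fin Δ) :
    Ex (coinSample Δ q) (fun S => ind (v ∈ S)) = 2⁻¹ ^ q := by
  rw [coinSample, Ex_map]
  simp only [mem_filter, mem_univ, true_and]
  rw [Ex_uniform_marginal v fun b : Fin q → Bool => ind (∀ j, b j = false), Ex_all_false]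

theorem Ex_coinSample_card_inter (Δ q : ℕ) (D : Finset (Fin Δ)) :
    Ex (coinSample Δ q) (fun S => ((S ∩ D).card : ℝ≥0∞)) = D.card * 2⁻¹ ^ q := by
  have h : ∀ S : Finset (Fin Δ), ((S ∩ D).card : ℝ≥0∞) = ∑ v ∈ D, ind (v ∈ S) := by
    intro S
    rw [← card_filter_eq_sum_ind, Finset.filter_mem_eq_inter, Finset.inter_comm]
  simp only [h, Ex_sum, Ex_coinSample_mem, Finset.sum_const, nsmul_eq_mul]

theorem coinSample_zero {Δ : ℕ} {S : Finset (Fin Δ)} (h : S ∈ (coinSample Δ 0).support) :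
    S = univ := by
  simp only [coinSample, PMF.mem_support_map_iff] at h
  obtain ⟨b, _, rfl⟩ := h
  ext v
  simp

theorem Ex_coinSample_exp_le (Δ q : ℕ) (D : Finset (Fin Δ)) {θ : ℝ} (hθ : |θ| ≤ 1) :
    Ex (coinSample Δ q) (fun S => ENNReal.ofReal (Real.exp (θ * (S ∩ D).card))) ≤
      ENNReal.ofReal (Real.exp (D.card * (1 / 2) ^ q * (θ + θ ^ 2))) := by
  have hprod : ∀ coins : Fin Δ → Fin q → Bool,
      ENNReal.ofReal (Real.exp (θ *
        (((univ.filter fun v => ∀ j, coins v j = false) ∩ D).card : ℕ))) =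
      ∏ v, (if v ∈ D then fun b : Fin q → Bool => ENNReal.ofReal (Real.exp θ) *
        ind (∀ j, b j = false) + ind (¬∀ j, b j = false) else fun _ => 1) (coins v) := by
    intro coins
    have h1 : ∀ v : Fin Δ, (if v ∈ D then fun b : Fin q → Bool => ENNReal.ofReal (Real.exp θ) *
        ind (∀ j, b j = false) + ind (¬∀ j, b j = false) else fun _ => 1) (coins v) =
        if v ∈ (univ.filter fun v => ∀ j, coins v j = false) ∩ D then
          ENNReal.ofReal (Real.exp θ) else 1 := by
      intro v
      by_cases hv : v ∈ D <;> by_cases hc : ∀ j, coins v j = false <;> simp [hv, hc]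
    rw [Finset.prod_congr rfl fun v _ => h1 v, Finset.prod_ite, Finset.prod_const_one, mul_one,
      Finset.prod_const, ← ENNReal.ofReal_pow (Real.exp_pos _).le, ← Real.exp_nat_mul, mul_comm]
    congr 5
    ext v
    simp
  rw [coinSample, Ex_map]
  simp only [hprod]
  rw [Ex_uniform_pi]
  have hp1 : (1 / 2 : ℝ) ^ q ≤ 1 := pow_le_one₀ (by norm_num) (by norm_num)
  have hp0 : (0 : ℝ) ≤ (1 / 2) ^ q := by positivity
  have hnot : Ex (PMF.uniformOfFintype (Fin q → Bool)) (fun b => ind (¬∀ j, b j = false)) =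
      ENNReal.ofReal (1 - (1 / 2) ^ q) := by
    have h := Ex_ind_add_not (PMF.uniformOfFintype (Fin q → Bool)) fun b => ∀ j, b j = false
    rw [Ex_all_false, add_comm] at h
    rw [← one_sub_half_pow_eq_ofReal]
    exact ENNReal.eq_sub_of_add_eq (by simp) h
  have hfac : ∀ v : Fin Δ, Ex (PMF.uniformOfFintype (Fin q → Bool))
      (if v ∈ D then fun b : Fin q → Bool => ENNReal.ofReal (Real.exp θ) *
        ind (∀ j, b j = false) + ind (¬∀ j, b j = false) else fun _ => 1) ≤
      if v ∈ D then ENNReal.ofReal (Real.exp ((1 / 2) ^ q * (θ + θ ^ 2))) else 1 := by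
    intro v
    by_cases hv : v ∈ D
    · simp only [hv, if_true]
      rw [Ex_add, Ex_const_mul, Ex_all_false, hnot, half_pow_eq_ofReal,
        ← ENNReal.ofReal_mul (Real.exp_pos _).le,
        ← ENNReal.ofReal_add (by positivity) (by linarith)]
      refine ENNReal.ofReal_le_ofReal ?_
      have h1 := (abs_le.1 (Real.abs_exp_sub_one_sub_id_le hθ)).2
      have h2 := Real.add_one_le_exp ((1 / 2) ^ q * (θ + θ ^ 2))
      nlinarith [mul_le_mul_of_nonneg_left h1 hp0]
    · simp [hv, Ex_const]
  refine (Finset.prod_le_prod' fun v _ => hfac v).trans ?_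
  rw [Finset.prod_ite, Finset.prod_const_one, mul_one, Finset.prod_const,
    ← ENNReal.ofReal_pow (Real.exp_pos _).le, ← Real.exp_nat_mul, mul_assoc]
  have h4 : (univ.filter fun v => v ∈ D) = D := by ext; simp
  rw [h4]

theorem ind_le_ofReal_exp {P : Prop} {y : ℝ} (h : P → 0 ≤ y) :
    ind P ≤ ENNReal.ofReal (Real.exp y) := by
  by_cases hP : P
  · rw [ind_true hP]
    exact ENNReal.one_le_ofReal.2 (Real.one_le_exp (h hP))
  · rw [ind_false hP]; exact zero_le

theorem Ex_coinSample_tail_le (Δ q : ℕ) (D : Finset (Fin Δ)) {θ a : ℝ} (hθ : |θ| ≤ 1)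
    (P : Finset (Fin Δ) → Prop) (hP : ∀ S, P S → a ≤ θ * (S ∩ D).card) :
    Ex (coinSample Δ q) (fun S => ind (P S)) ≤
      ENNReal.ofReal (Real.exp (D.card * (1 / 2) ^ q * (θ + θ ^ 2) - a)) := by
  have h1 : ∀ S, ind (P S) ≤ ENNReal.ofReal (Real.exp (θ * (S ∩ D).card)) *
      ENNReal.ofReal (Real.exp (-a)) := by
    intro S
    rw [← ENNReal.ofReal_mul (Real.exp_pos _).le, ← Real.exp_add]
    exact ind_le_ofReal_exp fun h => by linarith [hP S h]
  refine (Ex_mono fun S _ => h1 S).trans ?_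
  rw [Ex_mul_const, sub_eq_add_neg, Real.exp_add, ENNReal.ofReal_mul (Real.exp_pos _).le]
  gcongr
  exact Ex_coinSample_exp_le Δ q D hθ

/-- Chernoff bound for the upper tail. -/
theorem Ex_coinSample_upper_le (Δ q : ℕ) (D : Finset (Fin Δ)) {η μ : ℝ} (h0 : 0 ≤ η) (h1 : η ≤ 1)
    (hμ : D.card * (1 / 2) ^ q ≤ μ) :
    Ex (coinSample Δ q) (fun S => ind ((1 + η) * μ ≤ (S ∩ D).card)) ≤
      ENNReal.ofReal (Real.exp (-(η ^ 2 * μ / 4))) := by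
  refine (Ex_coinSample_tail_le Δ q D (θ := η / 2) (a := η / 2 * ((1 + η) * μ))
    (by rw [abs_of_nonneg (by linarith)]; linarith) _ fun S hS => by gcongr).trans ?_
  refine ENNReal.ofReal_le_ofReal (Real.exp_le_exp.2 ?_)
  nlinarith [mul_le_mul_of_nonneg_right hμ (by positivity : 0 ≤ η / 2 + (η / 2) ^ 2)]

/-- Chernoff bound for the lower tail. -/
theorem Ex_coinSample_lower_le (Δ q : ℕ) (D : Finset (Fin Δ)) {η μ : ℝ} (h0 : 0 ≤ η) (h1 : η ≤ 1)
    (hμ : μ ≤ D.card * (1 / 2) ^ q) :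
    Ex (coinSample Δ q) (fun S => ind (((S ∩ D).card : ℝ) ≤ (1 - η) * μ)) ≤
      ENNReal.ofReal (Real.exp (-(η ^ 2 * μ / 4))) := by
  refine (Ex_coinSample_tail_le Δ q D (θ := -(η / 2)) (a := -(η / 2) * ((1 - η) * μ))
    (by rw [abs_neg, abs_of_nonneg (by linarith)]; linarith) _ fun S hS => ?_).trans ?_
  · exact mul_le_mul_of_nonpos_left hS (by linarith)
  refine ENNReal.ofReal_le_ofReal (Real.exp_le_exp.2 ?_)
  have : 0 ≤ η / 2 - (η / 2) ^ 2 := by nlinarith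
  nlinarith [mul_le_mul_of_nonneg_right hμ this]

/-! ### The sampling probability -/

theorem half_pow_sampleExponent_le {c ε δ' : ℝ} (hc : 0 < c) (hε : 0 < ε)
    (hδ : 0 < Real.log (1 / δ')) (d : ℕ) :
    (2⁻¹ : ℝ≥0∞) ^ sampleExponent c ε δ' d ≤
      ENNReal.ofReal (2 * (c * Real.log (1 / δ')) / ε ^ 2) * (d : ℝ≥0∞)⁻¹ := by
  have hpos : 0 < 2 * (c * Real.log (1 / δ')) / ε ^ 2 := by positivity
  rcases Nat.eq_zero_or_pos d with rfl | hd
  · simp only [Nat.cast_zero, ENNReal.inv_zero]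
    rw [ENNReal.mul_top (by simpa using hpos)]
    exact le_top
  have hd' : (0 : ℝ) < d := by exact_mod_cast hd
  set y := ε ^ 2 * (d : ℝ) / (c * Real.log (1 / δ')) with hy
  have hy0 : 0 < y := by positivity
  set q := sampleExponent c ε δ' d with hq
  have h1 : Real.logb 2 y < (q : ℝ) + 1 := Nat.lt_floor_add_one _
  have h2 : y < 2 ^ (q + 1) := by
    rw [Real.logb_lt_iff_lt_rpow (by norm_num) hy0] at h1
    calc y < 2 ^ ((q : ℝ) + 1) := h1
      _ = 2 ^ (q + 1) := by exact_mod_cast Real.rpow_natCast 2 (q + 1)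
  rw [half_pow_eq_ofReal, ← ENNReal.ofReal_natCast d, ← ENNReal.ofReal_inv_of_pos hd',
    ← ENNReal.ofReal_mul hpos.le]
  refine ENNReal.ofReal_le_ofReal ?_
  have h3 : 2 * (c * Real.log (1 / δ')) / ε ^ 2 * (d : ℝ)⁻¹ = 2 / y := by
    rw [hy]; field_simp
  rw [h3, le_div_iff₀ hy0, one_div, inv_pow, inv_mul_le_iff₀ (by positivity), ← pow_succ]
  exact h2.le

theorem sampleExponent_eq_zero_or {c ε δ' : ℝ} (hc : 0 < c) (hε : 0 < ε)
    (hδ : 0 < Real.log (1 / δ')) {d : ℕ} (hd : 0 < d) :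
    sampleExponent c ε δ' d = 0 ∨
      c * Real.log (1 / δ') / (ε ^ 2 * d) ≤ (1 / 2) ^ sampleExponent c ε δ' d := by
  rcases Nat.eq_zero_or_pos (sampleExponent c ε δ' d) with h | h
  · exact Or.inl h
  right
  have hd' : (0 : ℝ) < d := by exact_mod_cast hd
  set y := ε ^ 2 * (d : ℝ) / (c * Real.log (1 / δ')) with hy
  have hy0 : 0 < y := by positivity
  set q := sampleExponent c ε δ' d with hq
  have h1 : (q : ℝ) ≤ Real.logb 2 y := by
    refine Nat.floor_le ?_
    by_contra hneg
    push Not at hneg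
    have : q = 0 := Nat.floor_of_nonpos hneg.le
    omega
  rw [Real.le_logb_iff_rpow_le (by norm_num) hy0, Real.rpow_natCast] at h1
  have h3 : c * Real.log (1 / δ') / (ε ^ 2 * d) = 1 / y := by
    rw [hy]; field_simp
  rw [h3, one_div, one_div, inv_pow]
  exact inv_anti₀ (by positivity) h1

/-! ### The first step of a run -/

/-- The joint law of the exponent `q` of the sampling probability and of the sample in a run that
starts with observations `x`. -/
noncomputable def sampleLaw {n Δ : ℕ} (c κ ε δ : ℝ) (x : Fin n → Fin Δ) :
    PMF (ℕ × Finset (Fin Δ)) :=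
  (ampConstFactor κ (2 * δ ^ 2) x).bind fun est =>
    (coinSample Δ (sampleExponent c ε (2 * δ ^ 2) est.1)).map fun S =>
      (sampleExponent c ε (2 * δ ^ 2) est.1, S)

theorem Ex_sampleLaw {n Δ : ℕ} (c κ ε δ : ℝ) (x : Fin n → Fin Δ)
    (F : ℕ × Finset (Fin Δ) → ℝ≥0∞) :
    Ex (sampleLaw c κ ε δ x) F = Ex (ampConstFactor κ (2 * δ ^ 2) x) fun est =>
      Ex (coinSample Δ (sampleExponent c ε (2 * δ ^ 2) est.1)) fun S =>
        F (sampleExponent c ε (2 * δ ^ 2) est.1, S) := by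
  simp only [sampleLaw, Ex_bind, Ex_map]

/-- The state after the first step of a run, in terms of the random choices made. -/
noncomputable def startState {n Δ : ℕ} (q : ℕ) (S : Finset (Fin Δ)) (resp : Fin Δ → Finset (Fin n))
    (rep : Fin Δ → Option (Fin n)) (m : ℕ) : State n Δ :=
  { clock := 1
    q := q
    sample := S
    rep := rep
    status := fun _ => true
    first := (univ.filter fun v => (resp v).Nonempty).card
    entered := 0
    left := 0
    output := ((univ.filter fun v => (resp v).Nonempty).card : ℝ) * 2 ^ q
    messages := m + ∑ v, (resp v).card + (univ.filter fun v => (resp v).Nonempty).card }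

theorem start_eq {n Δ : ℕ} (c κ ε δ : ℝ) (x : Fin n → Fin Δ) (m : ℕ) :
    start c κ ε δ x m = (ampConstFactor κ (2 * δ ^ 2) x).bind fun est =>
      (coinSample Δ (sampleExponent c ε (2 * δ ^ 2) est.1)).bind fun S =>
        (indep Δ fun v => maxProtocol (if v ∈ S then observers x v else ∅)).bind fun resp =>
          (indep Δ fun v => pick (resp v)).bind fun rep =>
            PMF.pure (startState (sampleExponent c ε (2 * δ ^ 2) est.1) S resp rep
              (m + 1 + est.2 + 1)) := by
  simp only [coinSample, PMF.bind_map]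
  rfl

theorem Ex_start {n Δ : ℕ} (c κ ε δ : ℝ) (x : Fin n → Fin Δ) (m : ℕ) (Φ : State n Δ → ℝ≥0∞) :
    Ex (start c κ ε δ x m) Φ = Ex (ampConstFactor κ (2 * δ ^ 2) x) fun est =>
      Ex (coinSample Δ (sampleExponent c ε (2 * δ ^ 2) est.1)) fun S =>
        Ex (indep Δ fun v => maxProtocol (if v ∈ S then observers x v else ∅)) fun resp =>
          Ex (indep Δ fun v => pick (resp v)) fun rep =>
            Φ (startState (sampleExponent c ε (2 * δ ^ 2) est.1) S resp rep
              (m + 1 + est.2 + 1)) := by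
  simp only [start_eq, Ex_bind, Ex_pure]

/-- In the first step of a run the representative of a sampled value is a uniformly random
observer, whatever the sample is. -/
theorem Ex_start_rep {n Δ : ℕ} (c κ ε δ : ℝ) (x : Fin n → Fin Δ) (m : ℕ)
    (F : ℕ × Finset (Fin Δ) → ℝ≥0∞) (v : Fin Δ) (f : Option (Fin n) → ℝ≥0∞) :
    Ex (start c κ ε δ x m)
        (fun st => F (st.q, st.sample) * if v ∈ st.sample then f (st.rep v) else 1) =
      Ex (sampleLaw c κ ε δ x)
        (fun a => F a * if v ∈ a.2 then Ex (pick (observers x v)) f else 1) := by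
  rw [Ex_start, Ex_sampleLaw]
  refine Ex_congr fun est _ => Ex_congr fun S _ => ?_
  simp only [startState]
  simp only [Ex_const_mul]
  congr 1
  by_cases hv : v ∈ S
  · simp only [hv, if_true]
    rw [← Ex_maxProtocol_pick, ← (by simp [hv] : (if v ∈ S then observers x v else ∅) = observers x v),
      ← indep_marginal Δ (fun v => maxProtocol (if v ∈ S then observers x v else ∅)) v]
    exact Ex_congr fun resp _ => indep_marginal Δ (fun v => pick (resp v)) v f
  · simp [hv, Ex_const]

theorem filter_resp_nonempty {n Δ : ℕ} {x : Fin n → Fin Δ} {S : Finset (Fin Δ)}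
    {resp : Fin Δ → Finset (Fin n)} (h : resp ∈ (indep Δ fun v =>
      maxProtocol (if v ∈ S then observers x v else ∅)).support) :
    (univ.filter fun v => (resp v).Nonempty) = S ∩ domain x := by
  ext v
  rw [mem_filter, maxProtocol_nonempty_iff (mem_support_indep h v), mem_inter, mem_domain_iff]
  by_cases hv : v ∈ S <;> simp [hv]

/-- A bound for the mean of the sampling probability. -/
theorem Ex_sampleLaw_prob_le {n Δ : ℕ} {c κ ε δ : ℝ} (hn : 2 ≤ n) (x : Fin n → Fin Δ) (hc : 0 < c)
    (hκ : 0 < κ) (hε : 0 < ε) (hδ : 0 < Real.log (1 / (2 * δ ^ 2))) :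
    Ex (sampleLaw c κ ε δ x) (fun a => 2⁻¹ ^ a.1) ≤
      ENNReal.ofReal (12 * (c * Real.log (1 / (2 * δ ^ 2))) / ε ^ 2 / (domain x).card) := by
  rw [Ex_sampleLaw]
  simp only [Ex_const]
  refine (Ex_mono fun est _ => half_pow_sampleExponent_le hc hε hδ est.1).trans ?_
  rw [Ex_const_mul]
  refine (mul_le_mul_right (Ex_ampConstFactor_inv_le κ _ x hn (by positivity)) _).trans ?_
  rw [← ENNReal.ofReal_mul (by positivity)]
  exact ENNReal.ofReal_le_ofReal (by ring_nf; exact le_rfl)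

theorem Ex_sampleLaw_mem {n Δ : ℕ} (c κ ε δ : ℝ) (x : Fin n → Fin Δ) (v : Fin Δ) :
    Ex (sampleLaw c κ ε δ x) (fun a => ind (v ∈ a.2)) =
      Ex (sampleLaw c κ ε δ x) (fun a => 2⁻¹ ^ a.1) := by
  rw [Ex_sampleLaw, Ex_sampleLaw]
  simp only [Ex_const, Ex_coinSample_mem]

/-- A bound for the mean number of messages in the first step of a run. -/
noncomputable def startCost (c κ ε δ : ℝ) : ℝ :=
  2 + 10 * (κ * Real.log (1 / (2 * δ ^ 2)) + 1) +
    132 * (c * Real.log (1 / (2 * δ ^ 2))) / ε ^ 2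

theorem Ex_start_messages_le {n Δ : ℕ} {c κ ε δ : ℝ} (hn : 2 ≤ n) (x : Fin n → Fin Δ) (hc : 0 < c)
    (hκ : 0 < κ) (hε : 0 < ε) (hδ : 0 < Real.log (1 / (2 * δ ^ 2))) (m : ℕ) :
    Ex (start c κ ε δ x m) (fun st => (st.messages : ℝ≥0∞)) ≤
      m + ENNReal.ofReal (startCost c κ ε δ) := by
  set ℓ := Real.log (1 / (2 * δ ^ 2)) with hℓ
  have hd : (0 : ℝ) < (domain x).card := by exact_mod_cast domain_card_pos hn x
  have h1 : Ex (start c κ ε δ x m) (fun st => (st.messages : ℝ≥0∞)) ≤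
      Ex (ampConstFactor κ (2 * δ ^ 2) x) fun est => (m : ℝ≥0∞) + 2 + est.2 + 11 *
        ((domain x).card * 2⁻¹ ^ sampleExponent c ε (2 * δ ^ 2) est.1) := by
    rw [Ex_start]
    refine Ex_mono fun est _ => ?_
    rw [← Ex_coinSample_card_inter, ← Ex_const_mul,
      ← Ex_const (coinSample Δ (sampleExponent c ε (2 * δ ^ 2) est.1)) ((m : ℝ≥0∞) + 2 + est.2),
      ← Ex_add]
    refine Ex_mono fun S _ => ?_
    have h2 : Ex (indep Δ fun v => maxProtocol (if v ∈ S then observers x v else ∅))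
        (fun resp => ∑ v, ((resp v).card : ℝ≥0∞)) ≤ 10 * (S ∩ domain x).card := by
      rw [Ex_sum]
      have h3 : ∀ v ∈ (univ : Finset (Fin Δ)),
          Ex (indep Δ fun v => maxProtocol (if v ∈ S then observers x v else ∅))
            (fun resp => ((resp v).card : ℝ≥0∞)) ≤ if v ∈ S ∩ domain x then 10 else 0 := by
        intro v _
        rw [indep_marginal Δ (fun v => maxProtocol (if v ∈ S then observers x v else ∅)) v
          fun R => (R.card : ℝ≥0∞)]
        by_cases hv : v ∈ S ∩ domain x
        · rw [if_pos hv]; exact Ex_maxProtocol_card_le _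
        · rw [if_neg hv]
          refine Ex_le_of_forall fun R hR => ?_
          have hemp : ¬R.Nonempty := by
            rw [maxProtocol_nonempty_iff hR]
            intro hne
            by_cases hS : v ∈ S
            · simp only [hS, if_true] at hne
              exact hv (mem_inter.2 ⟨hS, (mem_domain_iff x v).2 hne⟩)
            · simp [hS] at hne
          rw [Finset.not_nonempty_iff_eq_empty.1 hemp]; simp
      refine (Finset.sum_le_sum h3).trans ?_
      rw [Finset.sum_ite_mem, Finset.univ_inter, Finset.sum_const, nsmul_eq_mul, mul_comm]
    calc _ = Ex (indep Δ fun v => maxProtocol (if v ∈ S then observers x v else ∅)) (fun resp =>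
            ((m : ℝ≥0∞) + 2 + est.2 + (S ∩ domain x).card) + ∑ v, ((resp v).card : ℝ≥0∞)) := by
          refine Ex_congr fun resp hresp => ?_
          simp only [startState, Ex_const]
          rw [filter_resp_nonempty hresp]
          push_cast
          ring
      _ = ((m : ℝ≥0∞) + 2 + est.2 + (S ∩ domain x).card) +
          Ex (indep Δ fun v => maxProtocol (if v ∈ S then observers x v else ∅))
            (fun resp => ∑ v, ((resp v).card : ℝ≥0∞)) := by rw [Ex_add, Ex_const]
      _ ≤ ((m : ℝ≥0∞) + 2 + est.2 + (S ∩ domain x).card) + 10 * (S ∩ domain x).card := by gcongr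
      _ = _ := by ring
  refine h1.trans ?_
  rw [Ex_add, Ex_add, Ex_const, Ex_const_mul, Ex_const_mul]
  have h2 : Ex (ampConstFactor κ (2 * δ ^ 2) x)
      (fun est => (2⁻¹ : ℝ≥0∞) ^ sampleExponent c ε (2 * δ ^ 2) est.1) ≤
      ENNReal.ofReal (12 * (c * ℓ) / ε ^ 2 / (domain x).card) := by
    have := Ex_sampleLaw_prob_le hn x hc hκ hε hδ
    rw [Ex_sampleLaw] at this
    simpa only [Ex_const] using this
  have h3 : (⌈κ * ℓ⌉₊ : ℝ≥0∞) ≤ ENNReal.ofReal (κ * ℓ + 1) := by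
    rw [← ENNReal.ofReal_natCast]
    exact ENNReal.ofReal_le_ofReal (Nat.ceil_lt_add_one (by positivity)).le
  calc _ ≤ (m : ℝ≥0∞) + 2 + 10 * ENNReal.ofReal (κ * ℓ + 1) + 11 * ((domain x).card *
        ENNReal.ofReal (12 * (c * ℓ) / ε ^ 2 / (domain x).card)) := by
        gcongr
        exact (Ex_ampConstFactor_messages_le κ _ x).trans (by gcongr)
    _ = _ := by
        have e1 : ((domain x).card : ℝ≥0∞) *
            ENNReal.ofReal (12 * (c * ℓ) / ε ^ 2 / (domain x).card) =
            ENNReal.ofReal (12 * (c * ℓ) / ε ^ 2) := by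
          rw [← ENNReal.ofReal_natCast (domain x).card, ← ENNReal.ofReal_mul (by positivity),
            mul_div_cancel₀ _ hd.ne']
        have e2 : ENNReal.ofReal (startCost c κ ε δ) =
            2 + 10 * ENNReal.ofReal (κ * ℓ + 1) + 11 * ENNReal.ofReal (12 * (c * ℓ) / ε ^ 2) := by
          rw [← ENNReal.ofReal_ofNat 2, ← ENNReal.ofReal_ofNat 10, ← ENNReal.ofReal_ofNat 11,
            ← ENNReal.ofReal_mul (by norm_num), ← ENNReal.ofReal_mul (by norm_num),
            ← ENNReal.ofReal_add (by positivity) (by positivity),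
            ← ENNReal.ofReal_add (by positivity) (by positivity), startCost, ← hℓ]
          congr 1
          ring
        rw [e1, e2]
        simp only [add_assoc]

/-! ### Domain monitoring of a single value -/

/-- The active nodes of a value after a time step, where `A` are the active nodes before and `O` are
the nodes that now observe the value: the phase goes on as long as some active node remains, and
otherwise a new phase starts with all observers. -/
def nextActive {n : ℕ} (A O : Finset (Fin n)) : Finset (Fin n) :=
  if (A ∩ O).Nonempty then A ∩ O else O

/-- The active nodes of the value `v`, `k` time steps after the beginning `s` of a run: those that
have observed `v` ever since the beginning of its current phase. -/
def active {n Δ : ℕ} (x : Input n Δ) (s : ℕ) : ℕ → Fin Δ → Finset (Fin n)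
  | 0, v => observers (x s) v
  | k + 1, v => nextActive (active x s k v) (observers (x (s + k + 1)) v)

/-- The representative `r` of `v` does not observe `v`. -/
def Lost {n Δ : ℕ} (x : Fin n → Fin Δ) (v : Fin Δ) (r : Option (Fin n)) : Prop :=
  ∃ i, r = some i ∧ x i ≠ v

theorem mem_observers {n Δ : ℕ} {x : Fin n → Fin Δ} {v : Fin Δ} {i : Fin n} :
    i ∈ observers x v ↔ x i = v := by simp [observers]

theorem nextActive_subset {n : ℕ} (A O : Finset (Fin n)) : nextActive A O ⊆ O := by
  unfold nextActive
  split_ifs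
  · exact Finset.inter_subset_right
  · exact Finset.Subset.refl _

theorem nextActive_nonempty_iff {n : ℕ} (A O : Finset (Fin n)) :
    (nextActive A O).Nonempty ↔ O.Nonempty := by
  refine ⟨fun h => h.mono (nextActive_subset A O), fun h => ?_⟩
  unfold nextActive
  split_ifs with hA
  · exact hA
  · exact h

theorem active_subset {n Δ : ℕ} (x : Input n Δ) (s k : ℕ) (v : Fin Δ) :
    active x s k v ⊆ observers (x (s + k)) v := by
  cases k with
  | zero => exact Finset.Subset.refl _
  | succ k => exact nextActive_subset _ _

theorem active_nonempty_iff {n Δ : ℕ} (x : Input n Δ) (s k : ℕ) (v : Fin Δ) :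
    (active x s k v).Nonempty ↔ v ∈ domain (x (s + k)) := by
  rw [mem_domain_iff]
  cases k with
  | zero => rfl
  | succ k => exact nextActive_nonempty_iff _ _

section UpdateValue

variable {n Δ : ℕ} {x : Fin n → Fin Δ} {status : Fin n → Bool} {v : Fin Δ} {A : Finset (Fin n)}

theorem filter_status_true (h : ∀ i, x i = v → (status i = true ↔ i ∈ A)) :
    ((observers x v).filter fun i => status i = true) = A ∩ observers x v := by
  ext i
  simp only [mem_filter, mem_inter, mem_observers]
  exact ⟨fun ⟨h1, h2⟩ => ⟨(h i h1).1 h2, h1⟩, fun ⟨h1, h2⟩ => ⟨h2, (h i h2).2 h1⟩⟩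

theorem filter_status_false (h : ∀ i, x i = v → (status i = true ↔ i ∈ A))
    (hA : ¬(A ∩ observers x v).Nonempty) :
    ((observers x v).filter fun i => status i = false) = observers x v := by
  refine Finset.filter_true_of_mem fun i hi => ?_
  by_contra hs
  rw [Bool.not_eq_false] at hs
  exact hA ⟨i, mem_inter.2 ⟨(h i (mem_observers.1 hi)).1 hs, hi⟩⟩

/-- What a step of the monitoring algorithm guarantees for its result, if before the step the nodes
of status 1 observing `v` are those of `A` and the representative is a member of `A`. -/
theorem updateValue_spec {old : Option (Fin n)}
    (h : ∀ i, x i = v → (status i = true ↔ i ∈ A)) (h0 : old = none ↔ A = ∅)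
    (h1 : ∀ i, old = some i → i ∈ A) {u : ValueUpdate n}
    (hu : u ∈ (updateValue x status v old).support) :
    (u.rep = none ↔ observers x v = ∅) ∧
      (∀ i, u.rep = some i → i ∈ nextActive A (observers x v)) ∧
      ∀ i, x i = v → ((if u.newPhase then true else status i) = true ↔
        i ∈ nextActive A (observers x v)) := by
  -- a phase starts with the observers `O`, among which nobody was active
  have hnew : ∀ (R : Finset (Fin n)) (r : Option (Fin n)), ¬(A ∩ observers x v).Nonempty →
      R ∈ (maxProtocol ((observers x v).filter fun i => status i = false)).support →
      r ∈ (pick R).support → (r = none ↔ observers x v = ∅) ∧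
      (∀ i, r = some i → i ∈ nextActive A (observers x v)) ∧
      ∀ i, x i = v → ((if r.isSome then true else status i) = true ↔
        i ∈ nextActive A (observers x v)) := by
    intro R r hemp hR hr
    rw [filter_status_false h hemp] at hR
    have hO : nextActive A (observers x v) = observers x v := if_neg hemp
    have hr' : r ≠ none ↔ (observers x v).Nonempty :=
      (isSome_of_mem_support_pick hr).trans (maxProtocol_nonempty_iff hR)
    rw [hO]
    refine ⟨?_, ?_, ?_⟩
    · rw [← not_iff_not]
      exact hr'.trans Finset.nonempty_iff_ne_empty
    · rintro i rfl
      exact maxProtocol_subset hR (mem_of_mem_support_pick hr)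
    · intro i hi
      have : r.isSome = true := Option.isSome_iff_ne_none.2 (hr'.2 ⟨i, mem_observers.2 hi⟩)
      simp [this, mem_observers, hi]
  cases old with
  | none =>
    have hA : A = ∅ := h0.1 rfl
    simp only [updateValue] at hu
    change u ∈ (PMF.bind _ fun _ => PMF.bind _ _).support at hu
    simp only [PMF.mem_support_bind_iff] at hu
    obtain ⟨R, hR, r, hr, hu⟩ := hu
    rw [(PMF.mem_support_pure_iff _ _).1 hu]
    exact hnew R r (by simp [hA]) hR hr
  | some j =>
    have hjA : j ∈ A := h1 j rfl
    simp only [updateValue] at hu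
    by_cases hj : x j = v
    · rw [if_pos hj] at hu
      rw [(PMF.mem_support_pure_iff _ _).1 hu]
      have hjm : j ∈ A ∩ observers x v := mem_inter.2 ⟨hjA, mem_observers.2 hj⟩
      have hO : nextActive A (observers x v) = A ∩ observers x v := if_pos ⟨j, hjm⟩
      rw [hO]
      refine ⟨?_, ?_, ?_⟩
      · simp only [reduceCtorEq, false_iff]
        exact Finset.ne_empty_of_mem (mem_inter.1 hjm).2
      · rintro i ⟨⟩
        exact hjm
      · intro i hi
        simp [h i hi, mem_observers, hi]
    · rw [if_neg hj] at hu
      change u ∈ (PMF.bind _ _).support at hu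
      rw [PMF.mem_support_bind_iff] at hu
      obtain ⟨R₁, hR₁, hu⟩ := hu
      rw [filter_status_true h] at hR₁
      by_cases hne : R₁.Nonempty
      · rw [if_pos hne] at hu
        change u ∈ (PMF.bind _ _).support at hu
        rw [PMF.mem_support_bind_iff] at hu
        obtain ⟨r, hr, hu⟩ := hu
        rw [(PMF.mem_support_pure_iff _ _).1 hu]
        have hB := (maxProtocol_nonempty_iff hR₁).1 hne
        have hO : nextActive A (observers x v) = A ∩ observers x v := if_pos hB
        rw [hO]
        refine ⟨?_, ?_, ?_⟩
        · have h2 := (isSome_of_mem_support_pick hr).2 hne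
          simp only [h2, false_iff]
          exact Finset.nonempty_iff_ne_empty.1 (hB.mono Finset.inter_subset_right)
        · intro i hi
          simp only at hi
          subst hi
          exact maxProtocol_subset hR₁ (mem_of_mem_support_pick hr)
        · intro i hi
          simp [h i hi, mem_observers, hi]
      · rw [if_neg hne] at hu
        change u ∈ (PMF.bind _ fun _ => PMF.bind _ _).support at hu
        simp only [PMF.mem_support_bind_iff] at hu
        obtain ⟨R, hR, r, hr, hu⟩ := hu
        rw [(PMF.mem_support_pure_iff _ _).1 hu]
        exact hnew R r (by rwa [← maxProtocol_nonempty_iff hR₁]) hR hr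

/-- The mean of `f` at the new representative, if the old one is `r`: it stays or moves to a
uniformly random active node. -/
noncomputable def relocate {n : ℕ} (A O : Finset (Fin n)) (f : Option (Fin n) → ℝ≥0∞) :
    Option (Fin n) → ℝ≥0∞
  | none => Ex (pick (nextActive A O)) f
  | some i => if i ∈ O then f (some i) else Ex (pick (nextActive A O)) f

theorem Ex_updateValue_rep {old : Option (Fin n)}
    (h : ∀ i, x i = v → (status i = true ↔ i ∈ A)) (h0 : old = none ↔ A = ∅)
    (f : Option (Fin n) → ℝ≥0∞) :
    Ex (updateValue x status v old) (fun u => f u.rep) = relocate A (observers x v) f old := by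
  have hnew : ¬(A ∩ observers x v).Nonempty →
      Ex (maxProtocol ((observers x v).filter fun i => status i = false))
        (fun R => Ex (pick R) f) = Ex (pick (nextActive A (observers x v))) f := by
    intro hemp
    rw [Ex_maxProtocol_pick, filter_status_false h hemp, nextActive, if_neg hemp]
  cases old with
  | none =>
    have hA : A = ∅ := h0.1 rfl
    simp only [updateValue, relocate]
    change Ex (PMF.bind _ fun _ => PMF.bind _ fun _ => PMF.pure _) _ = _
    simp only [Ex_bind, Ex_pure]
    exact hnew (by simp [hA])
  | some j =>
    simp only [updateValue, relocate, mem_observers]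
    by_cases hj : x j = v
    · rw [if_pos hj, if_pos hj]
      exact Ex_pure _ _
    · rw [if_neg hj, if_neg hj]
      change Ex (PMF.bind _ _) _ = _
      rw [Ex_bind, filter_status_true h]
      by_cases hB : (A ∩ observers x v).Nonempty
      · rw [nextActive, if_pos hB, ← Ex_maxProtocol_pick]
        refine Ex_congr fun R hR => ?_
        rw [if_pos ((maxProtocol_nonempty_iff hR).2 hB)]
        change Ex (PMF.bind _ fun _ => PMF.pure _) _ = _
        simp only [Ex_bind, Ex_pure]
      · rw [← hnew hB]
        refine (Ex_congr fun R hR => ?_).trans (Ex_const _ _)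
        rw [if_neg (by rwa [maxProtocol_nonempty_iff hR])]
        change Ex (PMF.bind _ fun _ => PMF.bind _ fun _ => PMF.pure _) _ = _
        simp only [Ex_bind, Ex_pure]

/-- A uniformly random active node that is replaced if it drops out remains a uniformly random
active node. -/
theorem Ex_pick_relocate (A O : Finset (Fin n)) (f : Option (Fin n) → ℝ≥0∞) :
    Ex (pick A) (relocate A O f) = Ex (pick (nextActive A O)) f := by
  rcases A.eq_empty_or_nonempty with rfl | hA
  · rw [Ex_pick_empty]; rfl
  rw [Ex_pick_of_nonempty hA]
  have hA0 : (A.card : ℝ≥0∞) ≠ 0 := by exact_mod_cast (Finset.card_pos.2 hA).ne'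
  set E := Ex (pick (nextActive A O)) f with hE
  have hsum : ∑ i ∈ A, relocate A O f (some i) = ∑ i ∈ A ∩ O, f (some i) + (A \ O).card * E := by
    simp only [relocate, ← hE]
    rw [Finset.sum_ite, Finset.sum_const, nsmul_eq_mul, Finset.filter_mem_eq_inter,
      Finset.filter_notMem_eq_sdiff]
  have hB : ∑ i ∈ A ∩ O, f (some i) = (A ∩ O).card * E := by
    by_cases hne : (A ∩ O).Nonempty
    · rw [hE, nextActive, if_pos hne, Ex_pick_of_nonempty hne, ← mul_assoc,
        ENNReal.mul_inv_cancel (by exact_mod_cast (Finset.card_pos.2 hne).ne') (by simp), one_mul]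
    · rw [Finset.not_nonempty_iff_eq_empty] at hne
      simp [hne]
  rw [hsum, hB, ← add_mul, ← Nat.cast_add, Finset.card_inter_add_card_sdiff, ← mul_assoc,
    ENNReal.inv_mul_cancel hA0 (by simp), one_mul]

theorem Ex_updateValue_messages_le (old : Option (Fin n)) :
    Ex (updateValue x status v old) (fun u => (u.messages : ℝ≥0∞)) ≤
      25 * (ind (Lost x v old) + ind (old = none ∧ (observers x v).Nonempty)) := by
  cases old with
  | none =>
    simp only [updateValue]
    change Ex (PMF.bind _ fun _ => PMF.bind _ fun _ => PMF.pure _) _ ≤ _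
    simp only [Ex_bind, Ex_pure]
    by_cases hO : (observers x v).Nonempty
    · have h1 : ∀ R : Finset (Fin n), Ex (pick R)
          (fun r => ((R.card + (if r.isSome then 1 else 0) : ℕ) : ℝ≥0∞)) ≤ R.card + 1 := by
        intro R
        refine Ex_le_of_forall fun r _ => ?_
        push_cast
        gcongr
        split_ifs <;> simp
      refine (Ex_mono fun R _ => h1 R).trans ?_
      have hi : ind (True ∧ (observers x v).Nonempty) = 1 := ind_true ⟨trivial, hO⟩
      rw [Ex_add, Ex_const, hi]
      calc _ ≤ (10 : ℝ≥0∞) + 1 := by gcongr; exact Ex_maxProtocol_card_le _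
        _ ≤ 25 * 1 := by norm_num
        _ ≤ _ := by gcongr; exact le_add_self
    · refine (Ex_le_of_forall (c := 0) fun R hR => Ex_le_of_forall fun r hr => ?_).trans zero_le
      have hR0 : ¬R.Nonempty := by
        rw [maxProtocol_nonempty_iff hR]
        exact fun h => hO (h.mono (Finset.filter_subset _ _))
      have hr0 : r = none := by
        by_contra hr0
        exact hR0 ((isSome_of_mem_support_pick hr).1 hr0)
      rw [Finset.not_nonempty_iff_eq_empty.1 hR0, hr0]
      simp
  | some j =>
    simp only [updateValue]
    by_cases hj : x j = v
    · rw [if_pos hj]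
      change Ex (PMF.pure _) _ ≤ _
      simp [Ex_pure]
    · have hl : Lost x v (some j) := ⟨j, rfl, hj⟩
      rw [if_neg hj, ind_true hl]
      change Ex (PMF.bind _ _) _ ≤ _
      rw [Ex_bind]
      have h1 : ∀ R₁ : Finset (Fin n), Ex (if R₁.Nonempty then
          (PMF.bind (pick R₁) fun r => PMF.pure (⟨r, false, 1 + (1 + R₁.card) + 1⟩ : ValueUpdate n))
          else PMF.bind (maxProtocol ((observers x v).filter fun j => status j = false)) fun R =>
            PMF.bind (pick R) fun r => PMF.pure
              ⟨r, r.isSome, 1 + 1 + (1 + R.card) + if r.isSome then 1 else 0⟩)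
          (fun u => (u.messages : ℝ≥0∞)) ≤ R₁.card + 14 := by
        intro R₁
        split_ifs with hne
        · simp only [Ex_bind, Ex_pure, Ex_const]
          push_cast
          calc (1 : ℝ≥0∞) + (1 + R₁.card) + 1 = R₁.card + 3 := by ring
            _ ≤ _ := by gcongr; norm_num
        · simp only [Ex_bind, Ex_pure]
          have h2 : ∀ R : Finset (Fin n), Ex (pick R) (fun r =>
              ((1 + 1 + (1 + R.card) + (if r.isSome then 1 else 0) : ℕ) : ℝ≥0∞)) ≤ R.card + 4 := by
            intro R
            refine Ex_le_of_forall fun r _ => ?_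
            push_cast
            calc _ ≤ (2 : ℝ≥0∞) + (1 + R.card) + 1 := by gcongr; split_ifs <;> simp
              _ = R.card + 4 := by ring
          refine (Ex_mono fun R _ => h2 R).trans ?_
          rw [Ex_add, Ex_const]
          calc _ ≤ (10 : ℝ≥0∞) + 4 := by gcongr; exact Ex_maxProtocol_card_le _
            _ = 14 := by norm_num
            _ ≤ _ := le_add_self
      refine (Ex_mono fun R _ => h1 R).trans ?_
      rw [Ex_add, Ex_const]
      calc _ ≤ (10 : ℝ≥0∞) + 14 := by gcongr; exact Ex_maxProtocol_card_le _
        _ ≤ 25 * 1 := by norm_num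
        _ ≤ _ := by gcongr; exact le_self_add

theorem ind_lost_le_messages {old : Option (Fin n)} {u : ValueUpdate n}
    (hu : u ∈ (updateValue x status v old).support) : ind (Lost x v old) ≤ (u.messages : ℝ≥0∞) := by
  by_cases hl : Lost x v old
  · obtain ⟨j, rfl, hj⟩ := hl
    refine (ind_le_one _).trans ?_
    rw [Nat.one_le_cast]
    simp only [updateValue, if_neg hj] at hu
    change u ∈ (PMF.bind _ _).support at hu
    rw [PMF.mem_support_bind_iff] at hu
    obtain ⟨R₁, _, hu⟩ := hu
    split_ifs at hu
    · change u ∈ (PMF.bind _ _).support at hu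
      rw [PMF.mem_support_bind_iff] at hu
      obtain ⟨r, _, hu⟩ := hu
      rw [(PMF.mem_support_pure_iff _ _).1 hu]
      dsimp only
      omega
    · change u ∈ (PMF.bind _ fun _ => PMF.bind _ _).support at hu
      simp only [PMF.mem_support_bind_iff] at hu
      obtain ⟨R, _, r, _, hu⟩ := hu
      rw [(PMF.mem_support_pure_iff _ _).1 hu]
      dsimp only
      omega
  · rw [ind_false hl]; exact zero_le

end UpdateValue

/-! ### The state of a run as a function of its sample -/

/-- The number of entries and exits of values of `S` during the `k` steps after time `s`. -/
def changes {n Δ : ℕ} (x : Input n Δ) (s k : ℕ) (S : Finset (Fin Δ)) : ℕ :=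
  ∑ j ∈ range k, ((S ∩ (domain (x (s + j + 1)) \ domain (x (s + j)))).card +
    (S ∩ (domain (x (s + j)) \ domain (x (s + j + 1)))).card)

/-- A run started at time `s` with sample `S` is not ended during its next `k` steps. -/
def Survives {n Δ : ℕ} (x : Input n Δ) (δ : ℝ) (s k : ℕ) (S : Finset (Fin Δ)) : Prop :=
  (k = 0 ∨ (k : ℝ) + 1 < 1 / δ) ∧ 2 * changes x s k S ≤ (S ∩ domain (x s)).card

/-- The state `st` arises `k` steps after the beginning `s` of the current run. Up to the choice of
the representatives among the active nodes it is determined by the sample. -/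
structure Tracks {n Δ : ℕ} (x : Input n Δ) (s k : ℕ) (st : State n Δ) : Prop where
  clock_eq : st.clock = k + 1
  rep_of_notMem : ∀ v ∉ st.sample, st.rep v = none
  rep_eq_none_iff : ∀ v ∈ st.sample, st.rep v = none ↔ active x s k v = ∅
  mem_active : ∀ v i, st.rep v = some i → i ∈ active x s k v
  status_iff : ∀ i, x (s + k) i ∈ st.sample →
    (st.status i = true ↔ i ∈ active x s k (x (s + k) i))
  first_eq : st.first = (st.sample ∩ domain (x s)).card
  changes_eq : st.entered + st.left = changes x s k st.sample
  balance : st.first + st.entered = st.left + (st.sample ∩ domain (x (s + k))).card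
  output_eq : st.output = ((st.sample ∩ domain (x (s + k))).card : ℝ) * 2 ^ st.q

theorem tracks_start {n Δ : ℕ} {c κ ε δ : ℝ} {x : Input n Δ} {s m : ℕ} {st : State n Δ}
    (h : st ∈ (start c κ ε δ (x s) m).support) : Tracks x s 0 st ∧ m ≤ st.messages := by
  rw [start_eq] at h
  simp only [PMF.mem_support_bind_iff, PMF.mem_support_pure_iff] at h
  obtain ⟨est, _, S, _, resp, hresp, rep, hrep, rfl⟩ := h
  have hfirst := filter_resp_nonempty hresp
  have hrep' : ∀ v, rep v ≠ none ↔ (resp v).Nonempty :=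
    fun v => isSome_of_mem_support_pick (mem_support_indep hrep v)
  have hresp' : ∀ v, (resp v).Nonempty ↔ (if v ∈ S then observers (x s) v else ∅).Nonempty :=
    fun v => maxProtocol_nonempty_iff (mem_support_indep hresp v)
  refine ⟨⟨rfl, ?_, ?_, ?_, ?_, ?_, rfl, ?_, ?_⟩, by dsimp only [startState]; omega⟩
  · intro v (hv : v ∉ S)
    by_contra hne
    have := (hresp' v).1 ((hrep' v).1 hne)
    simp [hv] at this
  · intro v (hv : v ∈ S)
    have := (hrep' v).trans (hresp' v)
    rw [if_pos hv, Finset.nonempty_iff_ne_empty] at this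
    exact not_iff_not.1 this
  · intro v i hi
    have h1 := mem_support_indep hrep v
    change rep v = some i at hi
    rw [hi] at h1
    have h2 := maxProtocol_subset (mem_support_indep hresp v) (mem_of_mem_support_pick h1)
    split_ifs at h2
    · exact h2
    · simp at h2
  · intro i _
    simp [startState, active, mem_observers]
  · simp [startState, hfirst]
  · simp [startState, hfirst]
  · simp [startState, hfirst]

section Step

variable {n Δ : ℕ}

/-- The status of the nodes after they have noticed whether their value has changed. -/
def newStatus (xOld x : Fin n → Fin Δ) (st : State n Δ) : Fin n → Bool :=
  fun i => if x i = xOld i then st.status i else false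

/-- The law of the update of every value in one time step. -/
noncomputable def updateLaw (xOld x : Fin n → Fin Δ) (st : State n Δ) (v : Fin Δ) :
    PMF (ValueUpdate n) :=
  if v ∈ st.sample then updateValue x (newStatus xOld x st) v (st.rep v)
  else PMF.pure ⟨none, false, 0⟩

/-- The state after a time step without restart, in terms of the updates of the values. -/
noncomputable def nextState (xOld x : Fin n → Fin Δ) (st : State n Δ)
    (upd : Fin Δ → ValueUpdate n) : State n Δ :=
  { clock := st.clock + 1
    q := st.q
    sample := st.sample
    rep := fun v => (upd v).rep
    status := fun i => if (upd (x i)).newPhase then true else newStatus xOld x st i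
    first := st.first
    entered := st.entered + (univ.filter fun v => st.rep v = none ∧ (upd v).rep ≠ none).card
    left := st.left + (univ.filter fun v => st.rep v ≠ none ∧ (upd v).rep = none).card
    output := (st.first : ℝ) * 2 ^ st.q +
      ((st.entered + (univ.filter fun v => st.rep v = none ∧ (upd v).rep ≠ none).card : ℕ) : ℝ)
        * 2 ^ st.q -
      ((st.left + (univ.filter fun v => st.rep v ≠ none ∧ (upd v).rep = none).card : ℕ) : ℝ)
        * 2 ^ st.q
    messages := st.messages + ∑ v, (upd v).messages }

/-- The condition for a restart, evaluated in the state that the step would otherwise produce. -/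
def Restart (δ : ℝ) (st : State n Δ) : Prop :=
  1 / δ ≤ (st.clock : ℝ) ∨
    ((st.first : ℝ) * 2 ^ st.q) / 2 < ((st.entered : ℝ) + (st.left : ℝ)) * 2 ^ st.q

open Classical in
theorem step_eq (c κ ε δ : ℝ) (xOld x : Fin n → Fin Δ) (st : State n Δ) :
    step c κ ε δ xOld x st = (indep Δ (updateLaw xOld x st)).bind fun upd =>
      if Restart δ (nextState xOld x st upd) then
        start c κ ε δ x (nextState xOld x st upd).messages
      else PMF.pure (nextState xOld x st upd) := by
  unfold step
  change PMF.bind _ _ = _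
  congr 1
  funext upd
  by_cases hR : Restart δ (nextState xOld x st upd)
  · rw [if_pos hR]; exact if_pos hR
  · rw [if_neg hR]; exact if_neg hR

open Classical in
theorem Ex_step (c κ ε δ : ℝ) (xOld x : Fin n → Fin Δ) (st : State n Δ) (Φ : State n Δ → ℝ≥0∞) :
    Ex (step c κ ε δ xOld x st) Φ = Ex (indep Δ (updateLaw xOld x st)) fun upd =>
      if Restart δ (nextState xOld x st upd) then
        Ex (start c κ ε δ x (nextState xOld x st upd).messages) Φ
      else Φ (nextState xOld x st upd) := by
  rw [step_eq, Ex_bind]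
  refine Ex_congr fun upd _ => ?_
  split_ifs
  · rfl
  · rw [Ex_pure]

variable {x : Input n Δ} {s k : ℕ} {st : State n Δ}

theorem Tracks.newStatus_iff (h : Tracks x s k st) {v : Fin Δ} (hv : v ∈ st.sample) (i : Fin n)
    (hi : x (s + k + 1) i = v) :
    newStatus (x (s + k)) (x (s + k + 1)) st i = true ↔ i ∈ active x s k v := by
  unfold newStatus
  by_cases hx : x (s + k + 1) i = x (s + k) i
  · rw [if_pos hx, h.status_iff i (by rwa [← hx, hi]), ← hx, hi]
  · rw [if_neg hx]
    simp only [Bool.false_eq_true, false_iff]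
    intro hmem
    have := mem_observers.1 (active_subset x s k v hmem)
    exact hx (by rw [hi, this])

theorem Tracks.mem_update (h : Tracks x s k st) {v : Fin Δ} (hv : v ∈ st.sample)
    {u : ValueUpdate n} (hu : u ∈ (updateLaw (x (s + k)) (x (s + k + 1)) st v).support) :
    (u.rep = none ↔ observers (x (s + k + 1)) v = ∅) ∧
      (∀ i, u.rep = some i → i ∈ active x s (k + 1) v) ∧
      ∀ i, x (s + k + 1) i = v → ((if u.newPhase then true else
        newStatus (x (s + k)) (x (s + k + 1)) st i) = true ↔ i ∈ active x s (k + 1) v) := by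
  rw [updateLaw, if_pos hv] at hu
  exact updateValue_spec (h.newStatus_iff hv) (h.rep_eq_none_iff v hv)
    (fun i hi => h.mem_active v i hi) hu

theorem not_mem_domain_iff (x : Fin n → Fin Δ) (v : Fin Δ) :
    v ∉ domain x ↔ observers x v = ∅ := by
  rw [mem_domain_iff, Finset.not_nonempty_iff_eq_empty]

theorem active_eq_empty_iff (x : Input n Δ) (s k : ℕ) (v : Fin Δ) :
    active x s k v = ∅ ↔ v ∉ domain (x (s + k)) := by
  rw [← active_nonempty_iff, Finset.not_nonempty_iff_eq_empty]

theorem Tracks.next (h : Tracks x s k st) {upd : Fin Δ → ValueUpdate n}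
    (hupd : upd ∈ (indep Δ (updateLaw (x (s + k)) (x (s + k + 1)) st)).support) :
    Tracks x s (k + 1) (nextState (x (s + k)) (x (s + k + 1)) st upd) := by
  have hu : ∀ v, upd v ∈ (updateLaw (x (s + k)) (x (s + k + 1)) st v).support :=
    fun v => mem_support_indep hupd v
  have hout : ∀ v ∉ st.sample, upd v = ⟨none, false, 0⟩ := by
    intro v hv
    have := hu v
    rw [updateLaw, if_neg hv] at this
    exact (PMF.mem_support_pure_iff _ _).1 this
  have hent : (univ.filter fun v => st.rep v = none ∧ (upd v).rep ≠ none) =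
      st.sample ∩ (domain (x (s + k + 1)) \ domain (x (s + k))) := by
    ext v
    simp only [mem_filter, mem_univ, true_and, mem_inter, mem_sdiff]
    by_cases hv : v ∈ st.sample
    · rw [h.rep_eq_none_iff v hv, active_eq_empty_iff, Ne, (h.mem_update hv (hu v)).1,
        ← not_mem_domain_iff, not_not]
      tauto
    · simp [hout v hv, hv]
  have hlft : (univ.filter fun v => st.rep v ≠ none ∧ (upd v).rep = none) =
      st.sample ∩ (domain (x (s + k)) \ domain (x (s + k + 1))) := by
    ext v
    simp only [mem_filter, mem_univ, true_and, mem_inter, mem_sdiff]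
    by_cases hv : v ∈ st.sample
    · rw [Ne, h.rep_eq_none_iff v hv, active_eq_empty_iff, (h.mem_update hv (hu v)).1,
        ← not_mem_domain_iff, not_not]
      tauto
    · simp [h.rep_of_notMem v hv, hv]
  have hbal : st.first + (nextState (x (s + k)) (x (s + k + 1)) st upd).entered =
      (nextState (x (s + k)) (x (s + k + 1)) st upd).left +
        (st.sample ∩ domain (x (s + k + 1))).card := by
    simp only [nextState, hent, hlft]
    have h1 := h.balance
    have h2 : (st.sample ∩ domain (x (s + k))).card +
        (st.sample ∩ (domain (x (s + k + 1)) \ domain (x (s + k)))).card =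
        (st.sample ∩ (domain (x (s + k)) \ domain (x (s + k + 1)))).card +
        (st.sample ∩ domain (x (s + k + 1))).card := by
      have e1 := Finset.card_inter_add_card_sdiff (st.sample ∩ domain (x (s + k)))
        (domain (x (s + k + 1)))
      have e2 := Finset.card_inter_add_card_sdiff (st.sample ∩ domain (x (s + k + 1)))
        (domain (x (s + k)))
      rw [Finset.inter_sdiff_assoc] at e1 e2
      rw [Finset.inter_right_comm] at e2
      omega
    omega
  refine ⟨?_, ?_, ?_, ?_, ?_, h.first_eq, ?_, hbal, ?_⟩
  · simp [nextState, h.clock_eq]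
  · intro v hv
    simp [nextState, hout v hv]
  · intro v hv
    rw [active_eq_empty_iff, not_mem_domain_iff]
    exact (h.mem_update hv (hu v)).1
  · intro v i hi
    by_cases hv : v ∈ st.sample
    · exact (h.mem_update hv (hu v)).2.1 i hi
    · simp [nextState, hout v hv] at hi
  · intro i hi
    exact (h.mem_update hi (hu _)).2.2 i rfl
  · have h1 := h.changes_eq
    have h2 : changes x s (k + 1) st.sample = changes x s k st.sample +
        ((st.sample ∩ (domain (x (s + k + 1)) \ domain (x (s + k)))).card +
          (st.sample ∩ (domain (x (s + k)) \ domain (x (s + k + 1)))).card) :=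
      Finset.sum_range_succ _ _
    simp only [nextState, hent, hlft]
    omega
  · have h1 : (st.first : ℝ) + (nextState (x (s + k)) (x (s + k + 1)) st upd).entered =
      (nextState (x (s + k)) (x (s + k + 1)) st upd).left +
        (st.sample ∩ domain (x (s + k + 1))).card := by exact_mod_cast hbal
    have h2 : (nextState (x (s + k)) (x (s + k + 1)) st upd).output = ((st.first : ℝ) +
        (nextState (x (s + k)) (x (s + k + 1)) st upd).entered -
        (nextState (x (s + k)) (x (s + k + 1)) st upd).left) * 2 ^ st.q := by
      simp only [nextState]; ring
    rw [h2, h1]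
    simp only [nextState]
    rw [add_sub_cancel_left]
    rfl

theorem changes_mono (x : Input n Δ) (s : ℕ) {k k' : ℕ} (h : k ≤ k') (S : Finset (Fin Δ)) :
    changes x s k S ≤ changes x s k' S :=
  Finset.sum_le_sum_of_subset (Finset.range_mono h)

theorem Survives.mono {δ : ℝ} {k k' : ℕ} (h : k ≤ k') {S : Finset (Fin Δ)}
    (hs : Survives x δ s k' S) : Survives x δ s k S := by
  refine ⟨?_, (Nat.mul_le_mul_left 2 (changes_mono x s h S)).trans hs.2⟩
  rcases Nat.eq_zero_or_pos k with h0 | h0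
  · exact Or.inl h0
  · right
    rcases hs.1 with h1 | h1
    · omega
    · have : (k : ℝ) ≤ k' := by exact_mod_cast h
      linarith

theorem Tracks.not_restart_iff {δ : ℝ} (h : Tracks x s (k + 1) st) :
    ¬Restart δ st ↔ Survives x δ s (k + 1) st.sample := by
  have h2 : ((2 : ℝ) ^ st.q) > 0 := by positivity
  have h3 : (st.first : ℝ) * 2 ^ st.q / 2 < ((st.entered : ℝ) + (st.left : ℝ)) * 2 ^ st.q ↔
      st.first < 2 * (st.entered + st.left) := by
    rw [show (st.first : ℝ) * 2 ^ st.q / 2 = (st.first : ℝ) / 2 * 2 ^ st.q by ring,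
      mul_lt_mul_iff_left₀ h2, div_lt_iff₀ (by norm_num)]
    constructor
    · intro h; have : (st.first : ℝ) < ((2 * (st.entered + st.left) : ℕ) : ℝ) := by
        push_cast; linarith
      exact_mod_cast this
    · intro h
      have : (st.first : ℝ) < ((2 * (st.entered + st.left) : ℕ) : ℝ) := by exact_mod_cast h
      push_cast at this; linarith
  rw [Restart, Survives, h3, h.clock_eq, h.changes_eq, h.first_eq]
  push Not
  simp

end Step

/-! ### The law of the sample and of the representatives during a run -/

section Law

variable {n Δ : ℕ} {c κ ε δ : ℝ} {x : Input n Δ}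

theorem exists_tracks {t : ℕ} {st : State n Δ} (h : st ∈ (run c κ ε δ x t).support) :
    ∃ s k, s + k = t ∧ Tracks x s k st := by
  induction t generalizing st with
  | zero => exact ⟨0, 0, rfl, (tracks_start h).1⟩
  | succ t ih =>
    simp only [run, PMF.mem_support_bind_iff] at h
    obtain ⟨st₀, h₀, h⟩ := h
    obtain ⟨s, k, rfl, hT⟩ := ih h₀
    rw [step_eq, PMF.mem_support_bind_iff] at h
    obtain ⟨upd, hupd, h⟩ := h
    split_ifs at h
    · exact ⟨s + k + 1, 0, rfl, (tracks_start h).1⟩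
    · rw [(PMF.mem_support_pure_iff _ _).1 h]
      exact ⟨s, k + 1, rfl, hT.next hupd⟩

/-- The probability that a run starts at time `s`. -/
noncomputable def startProb (c κ ε δ : ℝ) (x : Input n Δ) (s : ℕ) : ℝ≥0∞ :=
  Ex (run c κ ε δ x s) fun st => ind (st.clock = 1)

theorem startProb_zero : startProb c κ ε δ x 0 = 1 := by
  rw [startProb]
  refine (Ex_congr fun st hst => ?_).trans (Ex_const (run c κ ε δ x 0) 1)
  exact ind_true (tracks_start hst).1.clock_eq

/-- The first step of a run uses fresh coins. -/
theorem Ex_run_clock_one (s : ℕ) (Φ : State n Δ → ℝ≥0∞) (C : ℝ≥0∞)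
    (hΦ : ∀ m, Ex (start c κ ε δ (x s) m) Φ = C) :
    Ex (run c κ ε δ x s) (fun st => ind (st.clock = 1) * Φ st) = startProb c κ ε δ x s * C := by
  have hstart : ∀ m, Ex (start c κ ε δ (x s) m) (fun st => ind (st.clock = 1) * Φ st) = C := by
    intro m
    rw [← hΦ m]
    exact Ex_congr fun st hst => by rw [ind_true (tracks_start hst).1.clock_eq, one_mul]
  cases s with
  | zero => rw [startProb_zero, one_mul]; exact hstart 0
  | succ t =>
    have hstart1 : ∀ m, Ex (start c κ ε δ (x (t + 1)) m) (fun st => ind (st.clock = 1)) = 1 := by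
      intro m
      refine (Ex_congr fun st hst => ?_).trans (Ex_const (start c κ ε δ (x (t + 1)) m) 1)
      exact ind_true (tracks_start hst).1.clock_eq
    rw [startProb, run, Ex_bind, Ex_bind, ← Ex_mul_const]
    refine Ex_congr fun st hst => ?_
    rw [Ex_step, Ex_step, ← Ex_mul_const]
    refine Ex_congr fun upd _ => ?_
    obtain ⟨s, k, rfl, hT⟩ := exists_tracks hst
    by_cases hR : Restart δ (nextState (x (s + k)) (x (s + k + 1)) st upd)
    · rw [if_pos hR, if_pos hR, hstart, hstart1, one_mul]
    · rw [if_neg hR, if_neg hR, ind_false, zero_mul, zero_mul]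
      simp [nextState, hT.clock_eq]

open Classical in
/-- The joint law of the sample and of one representative, `k` steps after the beginning `s` of a
run that is still going on: the sample is the one drawn at time `s`, conditioned on the survival of
the run, and the representative of a sampled value is a uniformly random active node. -/
theorem Ex_run_eq (s k : ℕ) (F : ℕ × Finset (Fin Δ) → ℝ≥0∞) (v : Fin Δ)
    (f : Option (Fin n) → ℝ≥0∞) :
    Ex (run c κ ε δ x (s + k)) (fun st => ind (st.clock = k + 1) *
        (F (st.q, st.sample) * if v ∈ st.sample then f (st.rep v) else 1)) =
      startProb c κ ε δ x s * Ex (sampleLaw c κ ε δ (x s)) fun a =>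
        ind (Survives x δ s k a.2) * F a *
          if v ∈ a.2 then Ex (pick (active x s k v)) f else 1 := by
  induction k generalizing F f with
  | zero =>
    have hs : ∀ S : Finset (Fin Δ), Survives x δ s 0 S := fun S => ⟨Or.inl rfl, by simp [changes]⟩
    simp only [ind_true (hs _), one_mul, Nat.zero_add, Nat.add_zero]
    exact Ex_run_clock_one s _ _ fun m => Ex_start_rep c κ ε δ (x s) m F v f
  | succ k ih =>
    have hstep : ∀ st ∈ (run c κ ε δ x (s + k)).support,
        Ex (step c κ ε δ (x (s + k)) (x (s + k + 1)) st) (fun st => ind (st.clock = k + 1 + 1) *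
          (F (st.q, st.sample) * if v ∈ st.sample then f (st.rep v) else 1)) =
        ind (st.clock = k + 1) * ((ind (Survives x δ s (k + 1) st.sample) * F (st.q, st.sample)) *
          if v ∈ st.sample then relocate (active x s k v) (observers (x (s + k + 1)) v) f (st.rep v)
            else 1) := by
      intro st hst
      obtain ⟨s₀, k₀, hsk, hT⟩ := exists_tracks hst
      rw [Ex_step]
      have hzero : ∀ m, Ex (start c κ ε δ (x (s + k + 1)) m) (fun st =>
          ind (st.clock = k + 1 + 1) *
          (F (st.q, st.sample) * if v ∈ st.sample then f (st.rep v) else 1)) = 0 := by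
        intro m
        refine (Ex_congr fun st' hst' => ?_).trans (Ex_const (start c κ ε δ (x (s + k + 1)) m) 0)
        rw [ind_false, zero_mul]
        rw [(tracks_start hst').1.clock_eq]; omega
      by_cases hk : k₀ = k
      · subst hk
        obtain rfl : s₀ = s := by omega
        rw [ind_true hT.clock_eq, one_mul]
        have h1 : ∀ upd ∈ (indep Δ (updateLaw (x (s₀ + k₀)) (x (s₀ + k₀ + 1)) st)).support,
            (if Restart δ (nextState (x (s₀ + k₀)) (x (s₀ + k₀ + 1)) st upd) then
              Ex (start c κ ε δ (x (s₀ + k₀ + 1))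
                (nextState (x (s₀ + k₀)) (x (s₀ + k₀ + 1)) st upd).messages) (fun st =>
                  ind (st.clock = k₀ + 1 + 1) *
                  (F (st.q, st.sample) * if v ∈ st.sample then f (st.rep v) else 1))
              else ind ((nextState (x (s₀ + k₀)) (x (s₀ + k₀ + 1)) st upd).clock = k₀ + 1 + 1) *
                (F (st.q, st.sample) * if v ∈ st.sample then f (upd v).rep else 1)) =
            (ind (Survives x δ s₀ (k₀ + 1) st.sample) * F (st.q, st.sample)) *
              if v ∈ st.sample then f (upd v).rep else 1 := by
          intro upd hupd
          have hT' := hT.next hupd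
          have hiff := hT'.not_restart_iff (δ := δ)
          change _ ↔ Survives x δ s₀ (k₀ + 1) st.sample at hiff
          by_cases hR : Restart δ (nextState (x (s₀ + k₀)) (x (s₀ + k₀ + 1)) st upd)
          · rw [if_pos hR, hzero, ind_false (fun h => hiff.2 h hR), zero_mul, zero_mul]
          · rw [if_neg hR, ind_true (hiff.1 hR), ind_true hT'.clock_eq, one_mul, one_mul]
        refine (Ex_congr h1).trans ?_
        rw [Ex_const_mul]
        congr 1
        by_cases hv : v ∈ st.sample
        · simp only [if_pos hv]
          rw [indep_marginal Δ (updateLaw (x (s₀ + k₀)) (x (s₀ + k₀ + 1)) st) v fun u => f u.rep,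
            updateLaw, if_pos hv, Ex_updateValue_rep (hT.newStatus_iff hv)
              (hT.rep_eq_none_iff v hv) f]
        · simp only [if_neg hv, Ex_const]
      · have h1 : st.clock ≠ k + 1 := by rw [hT.clock_eq]; omega
        rw [ind_false h1, zero_mul]
        refine (Ex_congr fun upd _ => ?_).trans
          (Ex_const (indep Δ (updateLaw (x (s + k)) (x (s + k + 1)) st)) 0)
        by_cases hR : Restart δ (nextState (x (s + k)) (x (s + k + 1)) st upd)
        · rw [if_pos hR]; exact hzero _
        · rw [if_neg hR, ind_false, zero_mul]
          simp only [nextState]; omega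
    rw [← Nat.add_assoc, run, Ex_bind, Ex_congr hstep,
      ih (fun a => ind (Survives x δ s (k + 1) a.2) * F a)]
    congr 1
    refine Ex_congr fun a _ => ?_
    rw [Ex_pick_relocate, ← mul_assoc, ← ind_and]
    congr 3
    exact propext ⟨fun h => h.2, fun h => ⟨h.mono (Nat.le_succ k), h⟩⟩

theorem Ex_run_eq_sample (s k : ℕ) (v : Fin Δ) (F : ℕ × Finset (Fin Δ) → ℝ≥0∞) :
    Ex (run c κ ε δ x (s + k)) (fun st => ind (st.clock = k + 1) * F (st.q, st.sample)) =
      startProb c κ ε δ x s * Ex (sampleLaw c κ ε δ (x s)) fun a =>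
        ind (Survives x δ s k a.2) * F a := by
  have h := Ex_run_eq (c := c) (κ := κ) (ε := ε) (δ := δ) (x := x) s k F v fun _ => 1
  simpa only [Ex_const, ite_self, mul_one] using h

theorem Ex_run_eq_rep (s k : ℕ) (v : Fin Δ) (f : Option (Fin n) → ℝ≥0∞) :
    Ex (run c κ ε δ x (s + k)) (fun st => ind (st.clock = k + 1) *
        (ind (v ∈ st.sample) * f (st.rep v))) =
      startProb c κ ε δ x s * (Ex (sampleLaw c κ ε δ (x s)) (fun a =>
        ind (Survives x δ s k a.2) * ind (v ∈ a.2)) * Ex (pick (active x s k v)) f) := by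
  have h := Ex_run_eq (c := c) (κ := κ) (ε := ε) (δ := δ) (x := x) s k
    (fun a => ind (v ∈ a.2)) v f
  rw [← Ex_mul_const]
  refine (Ex_congr fun st _ => ?_).trans (h.trans (congrArg _ (Ex_congr fun a _ => ?_)))
  · by_cases hv : v ∈ st.sample <;> simp [hv]
  · by_cases hv : v ∈ a.2 <;> simp [hv]

/-- Every state belongs to exactly one run. -/
theorem sum_ind_clock {t : ℕ} {st : State n Δ} (h : st ∈ (run c κ ε δ x t).support) :
    ∑ s ∈ range (t + 1), ind (st.clock = t - s + 1) = 1 := by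
  obtain ⟨s, k, rfl, hT⟩ := exists_tracks h
  rw [Finset.sum_eq_single s]
  · rw [ind_true]; rw [hT.clock_eq]; omega
  · intro b hb hbs
    rw [ind_false]
    rw [hT.clock_eq]
    have := Finset.mem_range.1 hb
    omega
  · intro hs
    exact absurd (Finset.mem_range.2 (by omega)) hs

theorem Ex_run_decomp (t : ℕ) (Φ : State n Δ → ℝ≥0∞) :
    Ex (run c κ ε δ x t) Φ = ∑ s ∈ range (t + 1),
      Ex (run c κ ε δ x t) fun st => ind (st.clock = t - s + 1) * Φ st := by
  rw [← Ex_sum]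
  refine Ex_congr fun st hst => ?_
  rw [← Finset.sum_mul, sum_ind_clock hst, one_mul]

end Law

/-! ### Quality of the estimates -/

/-- The constant in the sampling probability, large enough that the Chernoff exponents of the
sample size, which lose a factor `4096`, are still `4 log (1/δ')`. -/
noncomputable def cConst : ℝ := 16384

/-- The constant in the number of repetitions of the rough estimation, chosen so that the median
fails with probability at most `δ' ^ 4`. -/
noncomputable def κConst : ℝ := 4

theorem log_two_le_log_inv {δ : ℝ} (h0 : 0 < δ) (h1 : δ ≤ 1 / 2) :
    Real.log 2 ≤ Real.log (1 / (2 * δ ^ 2)) := by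
  refine Real.log_le_log (by norm_num) ?_
  rw [le_div_iff₀ (by positivity)]
  nlinarith

theorem log_inv_pos {δ : ℝ} (h0 : 0 < δ) (h1 : δ ≤ 1 / 2) : 0 < Real.log (1 / (2 * δ ^ 2)) :=
  (Real.log_pos (by norm_num)).trans_le (log_two_le_log_inv h0 h1)

theorem exp_neg_mul_log_inv {δ : ℝ} (h0 : 0 < δ) (m : ℕ) :
    Real.exp (-(m * Real.log (1 / (2 * δ ^ 2)))) = (2 * δ ^ 2) ^ m := by
  rw [one_div, Real.log_inv, mul_neg, neg_neg, Real.exp_nat_mul, Real.exp_log (by positivity)]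

theorem quarter_pow_ceil_le {y : ℝ} :
    (4⁻¹ : ℝ≥0∞) ^ ⌈y⌉₊ ≤ ENNReal.ofReal (Real.exp (-y)) := by
  have h1 : (4⁻¹ : ℝ≥0∞) = ENNReal.ofReal (1 / 4) := by
    rw [one_div, ENNReal.ofReal_inv_of_pos (by norm_num)]; simp
  rw [h1, ← ENNReal.ofReal_pow (by norm_num)]
  refine ENNReal.ofReal_le_ofReal ?_
  have h2 : (1 / 4 : ℝ) ≤ Real.exp (-1) := by
    rw [Real.exp_neg, one_div]
    exact inv_anti₀ (Real.exp_pos _) (by linarith [Real.exp_one_lt_d9])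
  calc (1 / 4 : ℝ) ^ ⌈y⌉₊ ≤ Real.exp (-1) ^ ⌈y⌉₊ := by gcongr
    _ = Real.exp (-(⌈y⌉₊ : ℝ)) := by rw [← Real.exp_nat_mul]; ring_nf
    _ ≤ _ := Real.exp_le_exp.2 (neg_le_neg (Nat.le_ceil y))

/-- An event that is unlikely for every sampling probability that is not too small is unlikely. -/
theorem Ex_sampleLaw_ind_le {n Δ : ℕ} {c κ ε δ : ℝ} (hn : 2 ≤ n) (x : Fin n → Fin Δ) (hc : 0 < c)
    (hε : 0 < ε) (hδ : 0 < Real.log (1 / (2 * δ ^ 2))) (P : ℕ × Finset (Fin Δ) → Prop) (η : ℝ≥0∞)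
    (h : ∀ q : ℕ, (q = 0 ∨ c * Real.log (1 / (2 * δ ^ 2)) / (64 * ε ^ 2) ≤
      (domain x).card * (1 / 2) ^ q) → Ex (coinSample Δ q) (fun S => ind (P (q, S))) ≤ η) :
    Ex (sampleLaw c κ ε δ x) (fun a => ind (P a)) ≤
      η + ENNReal.ofReal (Real.exp (-(κ * Real.log (1 / (2 * δ ^ 2))))) := by
  have hd : (0 : ℝ) < (domain x).card := by exact_mod_cast domain_card_pos hn x
  rw [Ex_sampleLaw]
  have h1 : ∀ est : ℕ × ℕ, Ex (coinSample Δ (sampleExponent c ε (2 * δ ^ 2) est.1))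
      (fun S => ind (P (sampleExponent c ε (2 * δ ^ 2) est.1, S))) ≤
      η + ind (64 * (domain x).card < est.1) := by
    intro est
    by_cases hest : 64 * (domain x).card < est.1
    · rw [ind_true hest]
      exact (Ex_ind_le_one _ _).trans le_add_self
    · refine (h _ ?_).trans le_self_add
      push Not at hest
      rcases Nat.eq_zero_or_pos est.1 with h0 | h0
      · left; simp [h0, sampleExponent]
      · refine (sampleExponent_eq_zero_or hc hε hδ h0).imp_right fun h2 => ?_
        have h3 : (est.1 : ℝ) ≤ 64 * (domain x).card := by exact_mod_cast hest
        have h0' : (0 : ℝ) < est.1 := by exact_mod_cast h0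
        rw [div_le_iff₀ (by positivity)] at h2 ⊢
        refine h2.trans ?_
        have : (0 : ℝ) ≤ (1 / 2) ^ sampleExponent c ε (2 * δ ^ 2) est.1 * ε ^ 2 := by positivity
        nlinarith
  refine (Ex_mono fun est _ => h1 est).trans ?_
  rw [Ex_add, Ex_const]
  gcongr
  exact (Ex_ampConstFactor_large_le κ _ x hn).trans quarter_pow_ceil_le

theorem card_inter_le_add_changes {n Δ : ℕ} (x : Input n Δ) (s k : ℕ) (S : Finset (Fin Δ)) :
    (S ∩ domain (x s)).card ≤ (S ∩ domain (x (s + k))).card + changes x s k S := by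
  induction k with
  | zero => simp
  | succ k ih =>
    have h2 : changes x s (k + 1) S = changes x s k S +
        ((S ∩ (domain (x (s + k + 1)) \ domain (x (s + k)))).card +
          (S ∩ (domain (x (s + k)) \ domain (x (s + k + 1)))).card) := Finset.sum_range_succ _ _
    have e1 := Finset.card_inter_add_card_sdiff (S ∩ domain (x (s + k))) (domain (x (s + k + 1)))
    rw [Finset.inter_sdiff_assoc] at e1
    have e2 : ((S ∩ domain (x (s + k))) ∩ domain (x (s + k + 1))).card ≤
        (S ∩ domain (x (s + k + 1))).card := by
      refine Finset.card_le_card fun v hv => ?_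
      simp only [mem_inter] at hv ⊢
      exact ⟨hv.1.1, hv.2⟩
    rw [← Nat.add_assoc]
    omega

/-- The output of a surviving run is good, for a fixed sampling probability: if the domain has not
shrunk much since the beginning of the run, by concentration at the current time; otherwise the run
would have been ended, unless the sample is far from its mean at one of the two times. -/
theorem Ex_coinSample_bad_le {n Δ : ℕ} {ε δ ℓ : ℝ} (x : Input n Δ) (hε : 0 < ε)
    (hε1 : ε < 1) (hℓ : 0 < ℓ) (s k q : ℕ)
    (hq : q = 0 ∨ cConst * ℓ / (64 * ε ^ 2) ≤ (domain (x s)).card * (1 / 2) ^ q) :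
    Ex (coinSample Δ q) (fun S => ind (Survives x δ s k S ∧
      ¬((1 - ε) * (domain (x (s + k))).card ≤ ((S ∩ domain (x (s + k))).card : ℝ) * 2 ^ q ∧
        ((S ∩ domain (x (s + k))).card : ℝ) * 2 ^ q ≤ (1 + ε) * (domain (x (s + k))).card))) ≤
      2 * ENNReal.ofReal (Real.exp (-(4 * ℓ))) := by
  set D := domain (x s) with hD
  set D' := domain (x (s + k)) with hD'
  rcases hq with rfl | hq
  · refine (Ex_le_of_forall (c := 0) fun S hS => ?_).trans zero_le
    rw [coinSample_zero hS, ind_false]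
    rintro ⟨-, h⟩
    refine h ⟨?_, ?_⟩ <;> simp only [Finset.univ_inter, pow_zero, mul_one] <;>
      nlinarith [(Nat.cast_nonneg D'.card : (0 : ℝ) ≤ D'.card)]
  set p : ℝ := (1 / 2) ^ q with hp
  have hp0 : 0 < p := by positivity
  have hp2 : p * 2 ^ q = 1 := by rw [hp, ← mul_pow]; norm_num
  have hK : cConst * ℓ ≤ D.card * p * (64 * ε ^ 2) := by
    rwa [div_le_iff₀ (by positivity)] at hq
  simp only [cConst] at hK
  have two : ∀ {P Q R : Finset (Fin Δ) → Prop}, (∀ S, P S → Q S ∨ R S) →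
      Ex (coinSample Δ q) (fun S => ind (Q S)) ≤ ENNReal.ofReal (Real.exp (-(4 * ℓ))) →
      Ex (coinSample Δ q) (fun S => ind (R S)) ≤ ENNReal.ofReal (Real.exp (-(4 * ℓ))) →
      Ex (coinSample Δ q) (fun S => ind (P S)) ≤ 2 * ENNReal.ofReal (Real.exp (-(4 * ℓ))) := by
    intro P Q R h hQ hR
    refine (Ex_mono fun S _ => (ind_mono (h S)).trans (ind_or_le _ _)).trans ?_
    rw [Ex_add, two_mul]
    exact add_le_add hQ hR
  -- If `|D| ≤ 4 |D'|`, the sample estimates `|D'|` with relative error `ε`.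
  by_cases hlarge : (D.card : ℝ) ≤ 4 * D'.card
  · have hmu : 4 * ℓ ≤ ε ^ 2 * (D'.card * p) / 4 := by
      have : (D.card : ℝ) * p * (64 * ε ^ 2) ≤ 4 * D'.card * p * (64 * ε ^ 2) := by gcongr
      nlinarith
    have hexp : ENNReal.ofReal (Real.exp (-(ε ^ 2 * (D'.card * p) / 4))) ≤
        ENNReal.ofReal (Real.exp (-(4 * ℓ))) :=
      ENNReal.ofReal_le_ofReal (Real.exp_le_exp.2 (neg_le_neg hmu))
    refine two (Q := fun S => ((S ∩ D').card : ℝ) ≤ (1 - ε) * (D'.card * p))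
      (R := fun S => (1 + ε) * (D'.card * p) ≤ ((S ∩ D').card : ℝ)) (fun S hS => ?_)
      ((Ex_coinSample_lower_le Δ q D' hε.le hε1.le le_rfl).trans hexp)
      ((Ex_coinSample_upper_le Δ q D' hε.le hε1.le le_rfl).trans hexp)
    obtain ⟨-, hS⟩ := hS
    by_contra hcon
    push Not at hcon
    have h2q : (0 : ℝ) < 2 ^ q := by positivity
    refine hS ⟨?_, ?_⟩
    · have := mul_lt_mul_of_pos_right hcon.1 h2q
      rw [mul_assoc, mul_assoc, hp2, mul_one] at this
      exact this.le
    · have := mul_lt_mul_of_pos_right hcon.2 h2q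
      rw [mul_assoc (1 + ε), mul_assoc (D'.card : ℝ), hp2, mul_one] at this
      exact this.le
  -- Otherwise more than `3/4 |D|` values have left, so survival forces the sample to be too small
  -- on `D` or too large on `D'`, by a constant factor.
  · push Not at hlarge
    have hε2 : ε ^ 2 ≤ 1 := by nlinarith
    have hmu : 256 * ℓ ≤ D.card * p := by
      have h0 : 0 ≤ (D.card : ℝ) * p := by positivity
      nlinarith
    refine two (Q := fun S => ((S ∩ D).card : ℝ) ≤ (1 - 1 / 4) * (D.card * p))
      (R := fun S => (1 + 1 / 2) * (D.card * p / 4) ≤ ((S ∩ D').card : ℝ)) (fun S hS => ?_)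
      ((Ex_coinSample_lower_le Δ q D (by norm_num) (by norm_num) le_rfl).trans
        (ENNReal.ofReal_le_ofReal (Real.exp_le_exp.2 (by linarith))))
      ((Ex_coinSample_upper_le Δ q D' (by norm_num) (by norm_num) ?_).trans
        (ENNReal.ofReal_le_ofReal (Real.exp_le_exp.2 (by linarith))))
    · by_contra hcon
      push Not at hcon
      have h1 := hS.1.2
      have h2 := card_inter_le_add_changes x s k S
      have h3 : ((S ∩ D).card : ℝ) ≤ 2 * (S ∩ D').card := by
        have : (S ∩ D).card ≤ 2 * (S ∩ D').card := by
          rw [← hD] at h1 h2; rw [← hD'] at h2; omega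
        exact_mod_cast this
      linarith
    · rw [← hp]
      nlinarith

theorem Ex_sampleLaw_bad_le {n Δ : ℕ} {ε δ : ℝ} (hn : 2 ≤ n) (x : Input n Δ) (hε : 0 < ε)
    (hε1 : ε < 1) (h0 : 0 < δ) (h1 : δ ≤ 1 / 2) (s k : ℕ) :
    Ex (sampleLaw cConst κConst ε δ (x s)) (fun a => ind (Survives x δ s k a.2 ∧
      ¬((1 - ε) * (domain (x (s + k))).card ≤ ((a.2 ∩ domain (x (s + k))).card : ℝ) * 2 ^ a.1 ∧
        ((a.2 ∩ domain (x (s + k))).card : ℝ) * 2 ^ a.1 ≤ (1 + ε) * (domain (x (s + k))).card))) ≤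
      ENNReal.ofReal (δ ^ 2) := by
  have hℓ := log_inv_pos h0 h1
  refine (Ex_sampleLaw_ind_le hn (x s) (by norm_num [cConst]) hε hℓ _ _
    fun q hq => Ex_coinSample_bad_le x hε hε1 hℓ s k q hq).trans ?_
  have h4 : Real.exp (-(4 * Real.log (1 / (2 * δ ^ 2)))) = (2 * δ ^ 2) ^ 4 := by
    exact_mod_cast exp_neg_mul_log_inv h0 4
  rw [κConst, h4, ← ENNReal.ofReal_ofNat 2, ← ENNReal.ofReal_mul (by norm_num),
    ← ENNReal.ofReal_add (by positivity) (by positivity)]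
  refine ENNReal.ofReal_le_ofReal ?_
  have h5 : δ ^ 6 ≤ (1 / 2) ^ 6 := by gcongr
  nlinarith [mul_le_mul_of_nonneg_left h5 (by positivity : 0 ≤ δ ^ 2)]

/-- Union bound over the possible beginnings of the current run, of which there are at most
`1 / δ`. -/
theorem isApproximation {n Δ : ℕ} {ε δ : ℝ} (hn : 2 ≤ n) (x : Input n Δ) (T : ℕ) (hε : 0 < ε)
    (hε1 : ε < 1) (h0 : 0 < δ) (h1 : δ ≤ 1 / 2) :
    IsApproximation cConst κConst ε δ x T := by
  intro t _
  rw [toOuterMeasure_eq_Ex]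
  set good : State n Δ → Prop := fun st => (1 - ε) * ((domain (x t)).card : ℝ) ≤ st.output ∧
      st.output ≤ (1 + ε) * ((domain (x t)).card : ℝ) with hgood
  change _ ≤ Ex _ fun st => ind (good st)
  have hsum := Ex_ind_add_not (run cConst κConst ε δ x t) good
  have hterm : ∀ s ∈ range (t + 1), Ex (run cConst κConst ε δ x t)
      (fun st => ind (st.clock = t - s + 1) * ind (¬good st)) ≤
      ind (t - s = 0 ∨ ((t - s : ℕ) : ℝ) + 1 < 1 / δ) * ENNReal.ofReal (δ ^ 2) := by
    intro s hs
    obtain ⟨k, rfl⟩ : ∃ k, t = s + k := ⟨t - s, by have := Finset.mem_range.1 hs; omega⟩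
    rw [Nat.add_sub_cancel_left]
    set G : ℕ × Finset (Fin Δ) → Prop := fun a =>
      (1 - ε) * (domain (x (s + k))).card ≤ ((a.2 ∩ domain (x (s + k))).card : ℝ) * 2 ^ a.1 ∧
        ((a.2 ∩ domain (x (s + k))).card : ℝ) * 2 ^ a.1 ≤ (1 + ε) * (domain (x (s + k))).card
      with hG
    have h2 : ∀ st ∈ (run cConst κConst ε δ x (s + k)).support,
        ind (st.clock = k + 1) * ind (¬good st) =
        ind (st.clock = k + 1) * ind (¬G (st.q, st.sample)) := by
      intro st hst
      by_cases hc : st.clock = k + 1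
      · obtain ⟨s', k', hsk, hT⟩ := exists_tracks hst
        have hck := hT.clock_eq
        obtain rfl : k' = k := by omega
        obtain rfl : s' = s := by omega
        simp only [hgood, hG, hT.output_eq]
      · rw [ind_false hc, zero_mul, zero_mul]
    rw [Ex_congr h2, Ex_run_eq_sample s k (x 0 ⟨0, by omega⟩) fun a => ind (¬G a)]
    by_cases hk : k = 0 ∨ (k : ℝ) + 1 < 1 / δ
    · rw [ind_true hk, one_mul]
      calc _ ≤ 1 * Ex (sampleLaw cConst κConst ε δ (x s)) (fun a =>
            ind (Survives x δ s k a.2) * ind (¬G a)) := by gcongr; exact Ex_ind_le_one _ _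
        _ = Ex (sampleLaw cConst κConst ε δ (x s)) (fun a =>
            ind (Survives x δ s k a.2 ∧ ¬G a)) := by
            rw [one_mul]; exact Ex_congr fun a _ => (ind_and _ _).symm
        _ ≤ _ := Ex_sampleLaw_bad_le hn x hε hε1 h0 h1 s k
    · rw [ind_false hk, zero_mul]
      have : ∀ a : ℕ × Finset (Fin Δ), ind (Survives x δ s k a.2) * ind (¬G a) = 0 := by
        intro a
        rw [ind_false fun h => hk h.1, zero_mul]
      simp only [this, Ex_const, mul_zero, le_refl]
  have hbad : Ex (run cConst κConst ε δ x t) (fun st => ind (¬good st)) ≤ ENNReal.ofReal δ := by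
    rw [Ex_run_decomp]
    refine (Finset.sum_le_sum hterm).trans ?_
    rw [← Finset.sum_mul]
    have h3 : ∑ s ∈ range (t + 1), ind (t - s = 0 ∨ ((t - s : ℕ) : ℝ) + 1 < 1 / δ) ≤
        ENNReal.ofReal (1 / δ) := by
      have h4 := Finset.sum_range_reflect
        (fun k : ℕ => ind (k = 0 ∨ (k : ℝ) + 1 < 1 / δ)) (t + 1)
      simp only [Nat.add_sub_cancel] at h4
      classical
      rw [h4, ← card_filter_eq_sum_ind, ← ENNReal.ofReal_natCast]
      refine ENNReal.ofReal_le_ofReal (le_trans ?_ (Nat.floor_le (by positivity : 0 ≤ 1 / δ)))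
      rw [Nat.cast_le, ← Finset.card_range ⌊1 / δ⌋₊]
      refine Finset.card_le_card fun k hk => ?_
      rw [Finset.mem_range, ← Nat.succ_le_iff, Nat.le_floor_iff (by positivity)]
      have h5 : (2 : ℝ) ≤ 1 / δ := by rw [le_div_iff₀ h0]; linarith
      rcases (Finset.mem_filter.1 hk).2 with rfl | h6
      · norm_num at h5 ⊢; linarith
      · push_cast; exact h6.le
    calc _ ≤ ENNReal.ofReal (1 / δ) * ENNReal.ofReal (δ ^ 2) := by gcongr
      _ = ENNReal.ofReal δ := by
        rw [← ENNReal.ofReal_mul (by positivity)]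
        congr 1
        field_simp
  rw [ENNReal.ofReal_sub _ h0.le, ENNReal.ofReal_one, tsub_le_iff_right, ← hsum]
  gcongr

/-! ### The number of restarts -/

theorem changes_univ_le {n Δ : ℕ} {x : Input n Δ} {T : ℕ} {σ : ℝ} (h0 : 0 ≤ σ) (h1 : σ ≤ 1 / 2)
    (hx : DomainChangeRate x T σ) {s k : ℕ} (hk : s + k < T) (hσ : σ * k ≤ 1 / 64) :
    (changes x s k univ : ℝ) ≤ (domain (x s)).card / 16 := by
  have hgrow : ∀ j ≤ k, ((domain (x (s + j))).card : ℝ) * (1 - σ) ^ j ≤ (domain (x s)).card := by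
    intro j
    induction j with
    | zero => intro _; simp
    | succ j ih =>
      intro hj
      have h2 := hx (s + j) (by omega)
      have h3 : ((domain (x (s + j + 1))).card : ℝ) ≤
          (domain (x (s + j))).card + (domain (x (s + j + 1)) \ domain (x (s + j))).card := by
        have h := Finset.card_le_card_sdiff_add_card (s := domain (x (s + j + 1)))
          (t := domain (x (s + j)))
        rw [Nat.add_comm (domain (x (s + j + 1)) \ domain (x (s + j))).card] at h
        exact_mod_cast h
      have h4 : ((domain (x (s + j + 1))).card : ℝ) * (1 - σ) ≤ (domain (x (s + j))).card := by
        have : (0 : ℝ) ≤ (domain (x (s + j)) \ domain (x (s + j + 1))).card := by positivity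
        linarith
      have h5 : 0 ≤ (1 - σ) ^ j := pow_nonneg (by linarith) _
      calc ((domain (x (s + j + 1))).card : ℝ) * (1 - σ) ^ (j + 1)
          = (domain (x (s + j + 1))).card * (1 - σ) * (1 - σ) ^ j := by ring
        _ ≤ (domain (x (s + j))).card * (1 - σ) ^ j := by gcongr
        _ ≤ _ := ih (by omega)
  have hsize : ∀ j ≤ k, ((domain (x (s + j))).card : ℝ) ≤ 2 * (domain (x s)).card := by
    intro j hj
    have h2 : 1 - 1 / 64 ≤ (1 - σ) ^ j := by
      have h3 := one_add_mul_le_pow (a := -σ) (by linarith) j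
      have h4 : (j : ℝ) ≤ k := by exact_mod_cast hj
      have h5 : σ * j ≤ σ * k := by gcongr
      rw [← sub_eq_add_neg] at h3
      linarith
    have h3 := hgrow j hj
    have h4 : (0 : ℝ) ≤ (domain (x (s + j))).card := by positivity
    nlinarith
  rw [changes]
  push_cast
  simp only [Finset.univ_inter]
  have hterm : ∀ j ∈ range k, ((domain (x (s + j + 1)) \ domain (x (s + j))).card : ℝ) +
      (domain (x (s + j)) \ domain (x (s + j + 1))).card ≤ σ * (2 * (domain (x s)).card) := by
    intro j hj
    have hj' := Finset.mem_range.1 hj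
    have h2 := hx (s + j) (by omega)
    have h3 := mul_le_mul_of_nonneg_left (hsize (j + 1) (by omega)) h0
    rw [← Nat.add_assoc] at h3
    linarith
  refine (Finset.sum_le_sum hterm).trans ?_
  rw [Finset.sum_const, Finset.card_range, nsmul_eq_mul]
  have : (0 : ℝ) ≤ (domain (x s)).card := by positivity
  nlinarith

theorem Ex_coinSample_changes {n Δ : ℕ} (x : Input n Δ) (s k q : ℕ) :
    Ex (coinSample Δ q) (fun S => (changes x s k S : ℝ≥0∞)) = changes x s k univ * 2⁻¹ ^ q := by
  simp only [changes, Nat.cast_sum, Nat.cast_add, Ex_sum, Ex_add, Ex_coinSample_card_inter,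
    Finset.univ_inter, ← add_mul, ← Finset.sum_mul]

theorem half_le_of_add_eq_one {a b : ℝ≥0∞} (h : a + b = 1) (hb : b ≤ 2⁻¹) : 2⁻¹ ≤ a := by
  by_contra hlt
  push Not at hlt
  have := ENNReal.add_lt_add_of_lt_of_le (ne_top_of_le_ne_top (by simp) hb) hlt hb
  rw [h, ENNReal.inv_two_add_inv_two] at this
  exact lt_irrefl _ this

/-- As long as few values have entered or left the domain, a run goes on with probability at least
`1 / 2`. -/
theorem half_le_Ex_survives {n Δ : ℕ} {ε δ : ℝ} (hn : 2 ≤ n) (x : Input n Δ) (hε : 0 < ε)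
    (hε1 : ε < 1) (h0 : 0 < δ) (h1 : δ ≤ 1 / 2) {s k : ℕ}
    (hk : k = 0 ∨ (k : ℝ) + 1 < 1 / δ)
    (hch : (changes x s k univ : ℝ) ≤ (domain (x s)).card / 16) :
    2⁻¹ ≤ Ex (sampleLaw cConst κConst ε δ (x s)) (fun a => ind (Survives x δ s k a.2)) := by
  have hd : (0 : ℝ) < (domain (x s)).card := by exact_mod_cast domain_card_pos hn (x s)
  have hℓ := log_inv_pos h0 h1
  have hexp : ∀ m : ℕ, 4 ≤ m →
      Real.exp (-(m * Real.log (1 / (2 * δ ^ 2)))) ≤ 1 / 8 := by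
    intro m hm
    rw [exp_neg_mul_log_inv h0]
    have h2 : 2 * δ ^ 2 ≤ 1 / 2 := by nlinarith
    calc (2 * δ ^ 2) ^ m ≤ (1 / 2) ^ m := by gcongr
      _ ≤ (1 / 2) ^ 4 := pow_le_pow_of_le_one (by norm_num) (by norm_num) hm
      _ ≤ 1 / 8 := by norm_num
  have hnot : Ex (sampleLaw cConst κConst ε δ (x s)) (fun a => ind (¬Survives x δ s k a.2)) ≤
      2⁻¹ := by
    refine (Ex_sampleLaw_ind_le hn (x s) (by norm_num [cConst]) hε hℓ _
      (ENNReal.ofReal (1 / 8) + ENNReal.ofReal (1 / 4)) fun q hq => ?_).trans ?_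
    · have hns : ∀ S, ¬Survives x δ s k S → (S ∩ domain (x s)).card < 2 * changes x s k S := by
        intro S hS
        by_contra hcon
        exact hS ⟨hk, not_lt.1 hcon⟩
      rcases hq with rfl | hq
      · refine (Ex_le_of_forall (c := 0) fun S hS => ?_).trans zero_le
        rw [coinSample_zero hS, ind_false]
        intro h
        have h2 := hns _ h
        rw [Finset.univ_inter] at h2
        have h3 : ((domain (x s)).card : ℝ) < 2 * changes x s k univ := by exact_mod_cast h2
        linarith
      set p : ℝ := (1 / 2) ^ q with hp
      have hp0 : 0 < p := by positivity
      have hmu : 256 * Real.log (1 / (2 * δ ^ 2)) ≤ (domain (x s)).card * p := by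
        rw [div_le_iff₀ (by positivity), cConst] at hq
        have hε2 : ε ^ 2 ≤ 1 := by nlinarith
        have h0 : 0 ≤ ((domain (x s)).card : ℝ) * p := by positivity
        nlinarith
      have hsplit : ∀ S, ind (¬Survives x δ s k S) ≤
          ind (((S ∩ domain (x s)).card : ℝ) ≤ (1 - 1 / 2) * ((domain (x s)).card * p)) +
          changes x s k S * ENNReal.ofReal (4 / ((domain (x s)).card * p)) := by
        intro S
        by_cases hS : Survives x δ s k S
        · rw [ind_false (not_not.2 hS)]; exact zero_le
        by_cases h2 : ((S ∩ domain (x s)).card : ℝ) ≤ (1 - 1 / 2) * ((domain (x s)).card * p)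
        · rw [ind_true h2]
          exact (ind_le_one _).trans le_self_add
        · refine (ind_le_one _).trans (le_trans ?_ le_add_self)
          have h3 : ((S ∩ domain (x s)).card : ℝ) < 2 * changes x s k S := by
            exact_mod_cast hns S hS
          rw [← ENNReal.ofReal_natCast, ← ENNReal.ofReal_mul (by positivity),
            ENNReal.one_le_ofReal, ← mul_div_assoc, le_div_iff₀ (by positivity)]
          push Not at h2
          linarith
      refine (Ex_mono fun S _ => hsplit S).trans ?_
      rw [Ex_add, Ex_mul_const, Ex_coinSample_changes]
      gcongr
      · refine (Ex_coinSample_lower_le Δ q _ (by norm_num) (by norm_num) le_rfl).trans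
          (ENNReal.ofReal_le_ofReal (le_trans (Real.exp_le_exp.2 ?_) (hexp 16 (by norm_num))))
        push_cast
        linarith
      · rw [half_pow_eq_ofReal, ← ENNReal.ofReal_natCast, ← ENNReal.ofReal_mul (by positivity),
          ← ENNReal.ofReal_mul (by positivity), ← hp]
        refine ENNReal.ofReal_le_ofReal ?_
        rw [← mul_div_assoc, div_le_iff₀ (by positivity)]
        nlinarith
    · have h2 := hexp 4 le_rfl
      rw [← ENNReal.ofReal_add (by norm_num) (by norm_num),
        ← ENNReal.ofReal_add (by norm_num) (by positivity)]
      calc _ ≤ ENNReal.ofReal (1 / 2) := by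
            refine ENNReal.ofReal_le_ofReal ?_
            simp only [κConst]
            push_cast at h2
            linarith
        _ = 2⁻¹ := by rw [one_div, ENNReal.ofReal_inv_of_pos (by norm_num)]; simp
  have hsum := Ex_ind_add_not (sampleLaw cConst κConst ε δ (x s)) fun a => Survives x δ s k a.2
  exact half_le_of_add_eq_one hsum hnot

/-- Among the runs starting within a short interval of time, each is still going on at its end with
probability at least `1 / 2`, but at most one is. -/
theorem sum_startProb_Ico_le {n Δ : ℕ} {ε δ σ : ℝ} {x : Input n Δ} {T : ℕ} (hn : 2 ≤ n)
    (hε : 0 < ε) (hε1 : ε < 1) (h0 : 0 < δ) (h1 : δ ≤ 1 / 2) (hσ0 : 0 ≤ σ) (hσ1 : σ ≤ 1 / 2)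
    (hx : DomainChangeRate x T σ) {a e : ℕ} (heT : e ≤ T)
    (hlen : e ≤ a + (⌊1 / (32 * max (2 * σ) δ)⌋₊ + 1)) :
    ∑ s ∈ Ico a e, startProb cConst κConst ε δ x s ≤ 2 := by
  rcases Nat.eq_zero_or_pos e with rfl | he
  · simp
  obtain ⟨t, rfl⟩ : ∃ t, e = t + 1 := ⟨e - 1, by omega⟩
  have hM : 0 < max (2 * σ) δ := lt_max_of_lt_right h0
  have hone : ∑ s ∈ Ico a (t + 1), Ex (run cConst κConst ε δ x t)
      (fun st => ind (st.clock = t - s + 1)) ≤ 1 := by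
    have h2 := Ex_run_decomp (c := cConst) (κ := κConst) (ε := ε) (δ := δ) (x := x) t fun _ => 1
    simp only [mul_one, Ex_const] at h2
    rw [h2]
    refine Finset.sum_le_sum_of_subset fun s hs => ?_
    exact Finset.mem_range.2 (Finset.mem_Ico.1 hs).2
  have hterm : ∀ s ∈ Ico a (t + 1), startProb cConst κConst ε δ x s ≤
      2 * Ex (run cConst κConst ε δ x t) (fun st => ind (st.clock = t - s + 1)) := by
    intro s hs
    obtain ⟨has, hst⟩ := Finset.mem_Ico.1 hs
    obtain ⟨k, rfl⟩ : ∃ k, t = s + k := ⟨t - s, by omega⟩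
    have hkW : k ≤ ⌊1 / (32 * max (2 * σ) δ)⌋₊ := by omega
    have hkr : (k : ℝ) ≤ 1 / (32 * max (2 * σ) δ) :=
      (Nat.cast_le.2 hkW).trans (Nat.floor_le (by positivity))
    rw [le_div_iff₀ (by positivity)] at hkr
    have hk0 : (0 : ℝ) ≤ k := by positivity
    have hkσ : σ * k ≤ 1 / 64 := by
      have := mul_le_mul_of_nonneg_left (le_max_left (2 * σ) δ) hk0
      linarith
    have hkδ : (k : ℝ) + 1 < 1 / δ := by
      have := mul_le_mul_of_nonneg_left (le_max_right (2 * σ) δ) hk0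
      rw [lt_div_iff₀ h0]
      linarith
    have h2 := half_le_Ex_survives hn x hε hε1 h0 h1 (s := s) (Or.inr hkδ)
      (changes_univ_le hσ0 hσ1 hx (by omega) hkσ)
    have h3 := Ex_run_eq_sample (c := cConst) (κ := κConst) (ε := ε) (δ := δ) (x := x) s k
      (x 0 ⟨0, by omega⟩) fun _ => 1
    simp only [mul_one] at h3
    rw [Nat.add_sub_cancel_left, h3, mul_left_comm]
    calc startProb cConst κConst ε δ x s = startProb cConst κConst ε δ x s * (2 * 2⁻¹) := by
          rw [ENNReal.mul_inv_cancel (by norm_num) (by norm_num), mul_one]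
      _ ≤ _ := by gcongr
  refine (Finset.sum_le_sum hterm).trans ?_
  rw [← Finset.mul_sum]
  calc _ ≤ (2 : ℝ≥0∞) * 1 := by gcongr
    _ = 2 := mul_one _

/-- The expected number of runs. -/
theorem sum_startProb_le {n Δ : ℕ} {ε δ σ : ℝ} {x : Input n Δ} {T : ℕ} (hn : 2 ≤ n)
    (hε : 0 < ε) (hε1 : ε < 1) (h0 : 0 < δ) (h1 : δ ≤ 1 / 2) (hσ0 : 0 ≤ σ) (hσ1 : σ ≤ 1 / 2)
    (hx : DomainChangeRate x T σ) :
    ∑ s ∈ range T, startProb cConst κConst ε δ x s ≤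
      ENNReal.ofReal (64 * (1 + T * max (2 * σ) δ)) := by
  have hM : 0 < max (2 * σ) δ := lt_max_of_lt_right h0
  set w := ⌊1 / (32 * max (2 * σ) δ)⌋₊ + 1 with hw
  have hblocks : ∀ j : ℕ, ∀ e ≤ T, e ≤ j * w →
      ∑ s ∈ range e, startProb cConst κConst ε δ x s ≤ 2 * j := by
    intro j
    induction j with
    | zero =>
      intro e _ he
      rw [zero_mul, Nat.le_zero] at he
      simp [he]
    | succ j ih =>
      intro e heT he
      rw [← Finset.sum_range_add_sum_Ico _ (Nat.sub_le e w), Nat.cast_succ, mul_add, mul_one]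
      have : (j + 1) * w = j * w + w := by ring
      exact add_le_add (ih _ (by omega) (by omega))
        (sum_startProb_Ico_le hn hε hε1 h0 h1 hσ0 hσ1 hx heT (by omega))
  refine (hblocks (T / w + 1) T le_rfl ?_).trans ?_
  · have := Nat.lt_div_mul_add (a := T) (b := w) (by omega)
    rw [add_mul, one_mul]; exact this.le
  · rw [← ENNReal.ofReal_natCast, ← ENNReal.ofReal_ofNat 2, ← ENNReal.ofReal_mul (by norm_num)]
    refine ENNReal.ofReal_le_ofReal ?_
    have h2 : ((T / w : ℕ) : ℝ) ≤ T * (32 * max (2 * σ) δ) := by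
      refine Nat.cast_div_le.trans ?_
      have h3 : 1 / (32 * max (2 * σ) δ) ≤ (w : ℝ) := by
        rw [hw]; push_cast; exact (Nat.lt_floor_add_one _).le
      rw [div_le_iff₀ (by rw [hw]; positivity)]
      rw [div_le_iff₀ (by positivity)] at h3
      have h4 : (0 : ℝ) ≤ T := by positivity
      nlinarith
    push_cast
    linarith

/-! ### The cost of monitoring a single value -/

/-- The number of changes of the representative of `v` in a sequence of representatives. -/
def repChangesAt {n Δ : ℕ} (R : ℕ → Fin Δ → Option (Fin n)) (T : ℕ) (v : Fin Δ) : ℕ :=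
  ∑ t ∈ range T, if R t v ≠ R (t + 1) v then 1 else 0

/-- A new phase of `v` starts with step `k + 1` after the beginning `s` of the run. -/
def NewPhase {n Δ : ℕ} (x : Input n Δ) (s : ℕ) (v : Fin Δ) (k : ℕ) : Prop :=
  ¬(active x s k v ∩ observers (x (s + k + 1)) v).Nonempty ∧ (observers (x (s + k + 1)) v).Nonempty

instance {n Δ : ℕ} (x : Input n Δ) (s : ℕ) (v : Fin Δ) : DecidablePred (NewPhase x s v) :=
  fun k => by unfold NewPhase; infer_instance

/-- At the end of a phase no node has observed the value since its beginning, so that every sequence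
of representatives has changed in the meantime. -/
theorem card_newPhase_le {n Δ : ℕ} {x : Input n Δ} {T : ℕ} {R : ℕ → Fin Δ → Option (Fin n)}
    (hR : ∀ t < T, ValidReps (x t) (R (t + 1))) (s : ℕ) (v : Fin Δ) (m : ℕ) (hm : s + m < T) :
    (∑ k ∈ range m, if NewPhase x s v k then 1 else 0) ≤
        (∑ k ∈ range m, if R (s + k + 1) v ≠ R (s + k + 2) v then 1 else 0) ∧
      ((active x s m v).Nonempty → (∀ i ∈ active x s m v, R (s + m + 1) v ≠ some i) →
        (∑ k ∈ range m, if NewPhase x s v k then 1 else 0) + 1 ≤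
          ∑ k ∈ range m, if R (s + k + 1) v ≠ R (s + k + 2) v then 1 else 0) := by
  induction m with
  | zero =>
    refine ⟨le_rfl, fun hne hno => ?_⟩
    rw [active_nonempty_iff] at hne
    obtain ⟨i, hi, hxi⟩ := (hR (s + 0) hm).1 v hne
    exact absurd hi (hno i (mem_observers.2 hxi))
  | succ m ih =>
    obtain ⟨ih1, ih2⟩ := ih (by omega)
    rw [Finset.sum_range_succ, Finset.sum_range_succ]
    set P := ∑ k ∈ range m, if NewPhase x s v k then 1 else 0
    set C := ∑ k ∈ range m, if R (s + k + 1) v ≠ R (s + k + 2) v then 1 else 0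
    have hval := hR (s + m + 1) (by omega)
    have hval0 := hR (s + m) (by omega)
    have hact : active x s (m + 1) v =
        nextActive (active x s m v) (observers (x (s + m + 1)) v) := rfl
    -- a representative that stays the same while observing `v` but is not active was inactive before
    have hkey : R (s + m + 1) v = R (s + m + 2) v → ∀ i, R (s + m + 2) v = some i →
        i ∉ active x s m v ∩ observers (x (s + m + 1)) v → P + 1 ≤ C := by
      intro hsame i hi hnot
      have hdom : v ∈ domain (x (s + m)) := by
        by_contra hnd
        have := hval0.2 v hnd
        rw [hsame, hi] at this
        cases this
      have hdom' : v ∈ domain (x (s + m + 1)) := by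
        by_contra hnd
        have := hval.2 v hnd
        rw [hi] at this
        cases this
      obtain ⟨i', hi', hxi'⟩ := hval.1 v hdom'
      have hii : i' = i := by
        have : some i' = some i := by rw [← hi', ← hi]
        exact Option.some.inj this
      subst hii
      refine ih2 ((active_nonempty_iff x s m v).2 hdom) fun j hj hRj => ?_
      rw [hsame, hi] at hRj
      obtain rfl := Option.some.inj hRj
      exact hnot (mem_inter.2 ⟨hj, mem_observers.2 hxi'⟩)
    by_cases hnew : NewPhase x s v m
    · have hO : active x s (m + 1) v = observers (x (s + m + 1)) v := by
        rw [hact, nextActive, if_neg hnew.1]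
      obtain ⟨i, hi, hxi⟩ := hval.1 v ((mem_domain_iff _ _).2 hnew.2)
      have hfirst : P + 1 ≤ C + if R (s + m + 1) v ≠ R (s + m + 2) v then 1 else 0 := by
        by_cases hsame : R (s + m + 1) v = R (s + m + 2) v
        · have := hkey hsame i hi fun h => hnew.1 ⟨i, h⟩
          omega
        · rw [if_pos hsame]; omega
      rw [if_pos hnew]
      refine ⟨hfirst, fun _ hno => ?_⟩
      exact absurd hi (hno i (by rw [hO]; exact mem_observers.2 hxi))
    · rw [if_neg hnew, Nat.add_zero]
      refine ⟨by omega, fun hne hno => ?_⟩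
      have hOne : (observers (x (s + m + 1)) v).Nonempty := (nextActive_nonempty_iff _ _).1 hne
      have hB : (active x s m v ∩ observers (x (s + m + 1)) v).Nonempty := by
        by_contra hB; exact hnew ⟨hB, hOne⟩
      have hA : active x s (m + 1) v = active x s m v ∩ observers (x (s + m + 1)) v := by
        rw [hact, nextActive, if_pos hB]
      obtain ⟨i, hi, hxi⟩ := hval.1 v ((mem_domain_iff _ _).2 hOne)
      by_cases hsame : R (s + m + 1) v = R (s + m + 2) v
      · have := hkey hsame i hi fun h => hno i (by rw [hA]; exact h) hi
        omega
      · rw [if_pos hsame]; omega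

theorem add_card_newPhase_le {n Δ : ℕ} {x : Input n Δ} {T : ℕ} {R : ℕ → Fin Δ → Option (Fin n)}
    (hR0 : ∀ v, R 0 v = none) (hR : ∀ t < T, ValidReps (x t) (R (t + 1))) (s : ℕ) (v : Fin Δ)
    (m : ℕ) (hm : s + m < T) :
    (if v ∈ domain (x s) then 1 else 0) + (∑ k ∈ range m, if NewPhase x s v k then 1 else 0) ≤
      repChangesAt R T v := by
  have h1 := (card_newPhase_le hR s v m hm).1
  have h2 : (if v ∈ domain (x s) then 1 else 0) ≤
      ∑ t ∈ range (s + 1), if R t v ≠ R (t + 1) v then 1 else 0 := by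
    split_ifs with hv
    · by_contra hlt
      have hzero : ∀ t ∈ range (s + 1), (if R t v ≠ R (t + 1) v then 1 else 0) = 0 := by
        rw [← Finset.sum_eq_zero_iff]; omega
      have hconst : ∀ t ≤ s + 1, R t v = none := by
        intro t
        induction t with
        | zero => intro _; exact hR0 v
        | succ t ih =>
          intro ht
          have h := hzero t (Finset.mem_range.2 (by omega))
          by_contra hne
          rw [if_pos] at h
          · exact one_ne_zero h
          · rw [ih (by omega)]; exact fun h => hne h.symm
      obtain ⟨i, hi, _⟩ := (hR s (by omega)).1 v hv
      rw [hconst (s + 1) le_rfl] at hi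
      cases hi
    · exact Nat.zero_le _
  have h3 : (∑ t ∈ range (s + 1), if R t v ≠ R (t + 1) v then 1 else 0) +
      (∑ k ∈ range m, if R (s + k + 1) v ≠ R (s + k + 2) v then 1 else 0) ≤ repChangesAt R T v := by
    have h4 := Finset.sum_range_add (fun t => if R t v ≠ R (t + 1) v then 1 else 0) (s + 1) m
    have h5 : (∑ k ∈ range m, if R (s + 1 + k) v ≠ R (s + 1 + k + 1) v then 1 else 0) =
        ∑ k ∈ range m, if R (s + k + 1) v ≠ R (s + k + 2) v then 1 else 0 := by
      refine Finset.sum_congr rfl fun k _ => ?_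
      rw [show s + 1 + k = s + k + 1 by omega]
    rw [h5] at h4
    rw [← h4, repChangesAt]
    exact Finset.sum_le_sum_of_subset (Finset.range_mono (by omega))
  omega

/-- The harmonic numbers. -/
noncomputable def harm (a : ℕ) : ℝ≥0∞ := ∑ j ∈ range a, ((j + 1 : ℕ) : ℝ≥0∞)⁻¹

theorem harm_mono {a b : ℕ} (h : a ≤ b) : harm a ≤ harm b :=
  Finset.sum_le_sum_of_subset (Finset.range_mono h)

theorem div_add_harm_le (d b : ℕ) :
    ((d + b : ℕ) : ℝ≥0∞)⁻¹ * d + harm b ≤ harm (d + b) := by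
  induction d with
  | zero => simp
  | succ d ih =>
    have h1 : harm (d + 1 + b) = harm (d + b) + ((d + 1 + b : ℕ) : ℝ≥0∞)⁻¹ := by
      rw [show d + 1 + b = (d + b) + 1 by omega, harm, Finset.sum_range_succ]
      rfl
    rw [h1]
    refine le_trans ?_ (add_le_add_left ih _)
    push_cast
    have h2 : ((d : ℝ≥0∞) + 1 + b)⁻¹ ≤ ((d : ℝ≥0∞) + b)⁻¹ := by
      rw [ENNReal.inv_le_inv]
      gcongr
      exact le_self_add
    calc ((d : ℝ≥0∞) + 1 + b)⁻¹ * (d + 1) + harm b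
        = ((d : ℝ≥0∞) + 1 + b)⁻¹ * d + harm b + ((d : ℝ≥0∞) + 1 + b)⁻¹ := by ring
      _ ≤ _ := by gcongr

theorem harm_add_one_le {n : ℕ} (hn : 2 ≤ n) :
    harm n + 1 ≤ ENNReal.ofReal (3 * Real.logb 2 n) := by
  have h1 : harm n = ENNReal.ofReal ((harmonic n : ℚ) : ℝ) := by
    rw [harm, harmonic, Rat.cast_sum, ENNReal.ofReal_sum_of_nonneg (fun i _ => by positivity)]
    refine Finset.sum_congr rfl fun j _ => ?_
    rw [Rat.cast_inv, ENNReal.ofReal_inv_of_pos (by positivity)]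
    congr 1
    rw [Rat.cast_natCast, ENNReal.ofReal_natCast]
  have h2 := harmonic_le_one_add_log n
  have hn' : (2 : ℝ) ≤ n := by exact_mod_cast hn
  have hlog2 : 0 < Real.log 2 := Real.log_pos (by norm_num)
  have h3 : 1 ≤ Real.logb 2 n := by
    rw [Real.le_logb_iff_rpow_le (by norm_num) (by linarith)]
    simpa using hn'
  have h4 : Real.log n ≤ Real.logb 2 n := by
    rw [Real.logb, le_div_iff₀ hlog2]
    have : 0 ≤ Real.log n := Real.log_nonneg (by linarith)
    nlinarith [Real.log_two_lt_d9]
  have hh : (0 : ℝ) ≤ (harmonic n : ℚ) := by exact_mod_cast (harmonic_pos (by omega)).le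
  rw [h1, ← ENNReal.ofReal_one, ← ENNReal.ofReal_add hh (by norm_num)]
  exact ENNReal.ofReal_le_ofReal (by linarith)

/-- The probability that a uniformly random active node drops out in the next step. -/
noncomputable def lossProb {n Δ : ℕ} (x : Input n Δ) (s k : ℕ) (v : Fin Δ) : ℝ≥0∞ :=
  Ex (pick (active x s k v)) fun r => ind (Lost (x (s + k + 1)) v r)

theorem Ex_pick_lost {n Δ : ℕ} {A : Finset (Fin n)} (hA : A.Nonempty) (x : Fin n → Fin Δ)
    (v : Fin Δ) : Ex (pick A) (fun r => ind (Lost x v r)) =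
      (A.card : ℝ≥0∞)⁻¹ * (A \ observers x v).card := by
  rw [Ex_pick_of_nonempty hA, ← Finset.filter_notMem_eq_sdiff, card_filter_eq_sum_ind]
  congr 1
  refine Finset.sum_congr rfl fun i _ => ?_
  congr 1
  simp [Lost, mem_observers]

theorem card_le_of_fin {n : ℕ} (A : Finset (Fin n)) : A.card ≤ n := by
  simpa using Finset.card_le_univ A

/-- The harmonic number of the number of active nodes is a potential that pays for the losses of the
representative within a phase. -/
theorem lossProb_add_harm_le {n Δ : ℕ} (x : Input n Δ) (s k : ℕ) (v : Fin Δ) :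
    lossProb x s k v + harm (active x s (k + 1) v).card ≤
      harm (active x s k v).card + harm n * ((if NewPhase x s v k then 1 else 0 : ℕ) : ℝ≥0∞) := by
  set A := active x s k v with hA
  set O := observers (x (s + k + 1)) v with hO
  have h1 : lossProb x s k v + harm (A ∩ O).card ≤ harm A.card := by
    rw [lossProb, ← hA]
    rcases A.eq_empty_or_nonempty with h | h
    · rw [h, Ex_pick_empty]
      simp [Lost]
    · rw [Ex_pick_lost h, ← hO]
      have h2 := div_add_harm_le (A \ O).card (A ∩ O).card
      rwa [Finset.card_sdiff_add_card_inter] at h2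
  have hact : active x s (k + 1) v = nextActive A O := rfl
  rw [hact, nextActive]
  by_cases hB : (A ∩ O).Nonempty
  · rw [if_pos hB]
    exact h1.trans le_self_add
  · rw [if_neg hB]
    refine add_le_add (le_self_add.trans h1) ?_
    by_cases hOne : O.Nonempty
    · rw [if_pos ⟨hB, hOne⟩, Nat.cast_one, mul_one]
      exact harm_mono (card_le_of_fin O)
    · rw [Finset.not_nonempty_iff_eq_empty.1 hOne]
      simp [harm]

/-- The expected number of losses of the representative of `v` and of entries of `v` in a run is at
most logarithmic in `n`, relative to the number of changes in any sequence of representatives. -/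
theorem sum_lossProb_le {n Δ : ℕ} {x : Input n Δ} {T : ℕ} {R : ℕ → Fin Δ → Option (Fin n)}
    (hR0 : ∀ v, R 0 v = none) (hR : ∀ t < T, ValidReps (x t) (R (t + 1))) (s : ℕ) (v : Fin Δ)
    (m : ℕ) (hm : s + m < T) :
    ∑ k ∈ range m, (lossProb x s k v +
        ind (v ∉ domain (x (s + k)) ∧ v ∈ domain (x (s + k + 1)))) ≤
      (harm n + 1) * repChangesAt R T v := by
  set P := fun m => ∑ k ∈ range m, if NewPhase x s v k then 1 else 0 with hP
  have h1 : ∀ m, ∑ k ∈ range m, lossProb x s k v + harm (active x s m v).card ≤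
      harm (active x s 0 v).card + harm n * (P m : ℝ≥0∞) := by
    intro m
    induction m with
    | zero => simp [hP]
    | succ m ih =>
      simp only [hP] at ih ⊢
      rw [Finset.sum_range_succ, Finset.sum_range_succ, Nat.cast_add, mul_add, ← add_assoc]
      calc _ = ∑ k ∈ range m, lossProb x s k v +
            (lossProb x s m v + harm (active x s (m + 1) v).card) := by rw [add_assoc]
        _ ≤ ∑ k ∈ range m, lossProb x s k v + (harm (active x s m v).card +
            harm n * ((if NewPhase x s v m then 1 else 0 : ℕ) : ℝ≥0∞)) := by
              exact add_le_add le_rfl (lossProb_add_harm_le x s m v)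
        _ ≤ _ := by rw [← add_assoc]; gcongr
  have h2 : harm (active x s 0 v).card ≤ harm n * ((if v ∈ domain (x s) then 1 else 0 : ℕ) : ℝ≥0∞) := by
    by_cases hv : v ∈ domain (x s)
    · rw [if_pos hv, Nat.cast_one, mul_one]
      exact harm_mono (card_le_of_fin _)
    · have : active x s 0 v = ∅ := (active_eq_empty_iff x s 0 v).2 hv
      simp [this, harm]
  have h3 : ∑ k ∈ range m, ind (v ∉ domain (x (s + k)) ∧ v ∈ domain (x (s + k + 1))) ≤
      (P m : ℝ≥0∞) := by
    simp only [hP, Nat.cast_sum]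
    refine Finset.sum_le_sum fun k _ => ?_
    by_cases h : v ∉ domain (x (s + k)) ∧ v ∈ domain (x (s + k + 1))
    · have hnew : NewPhase x s v k := by
        refine ⟨?_, (mem_domain_iff _ _).1 h.2⟩
        rw [(active_eq_empty_iff x s k v).2 h.1]
        simp
      rw [ind_true h, if_pos hnew, Nat.cast_one]
    · rw [ind_false h]; exact zero_le
  have h4 : (((if v ∈ domain (x s) then 1 else 0) + P m : ℕ) : ℝ≥0∞) ≤ repChangesAt R T v := by
    exact_mod_cast add_card_newPhase_le hR0 hR s v m hm
  rw [Finset.sum_add_distrib]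
  calc _ ≤ (harm n * ((if v ∈ domain (x s) then 1 else 0 : ℕ) : ℝ≥0∞) + harm n * (P m : ℝ≥0∞)) +
        (P m : ℝ≥0∞) := by
        gcongr
        exact (le_self_add.trans (h1 m)).trans (by gcongr)
    _ ≤ (harm n + 1) * (((if v ∈ domain (x s) then 1 else 0) + P m : ℕ) : ℝ≥0∞) := by
        rw [Nat.cast_add, add_mul, one_mul, mul_add]
        gcongr
        exact le_add_self
    _ ≤ _ := by gcongr

/-! ### Optimal sequences of representatives -/

theorem exists_optimal_reps {n Δ : ℕ} (x : Input n Δ) (T : ℕ) :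
    ∃ R : ℕ → Fin Δ → Option (Fin n), (∀ v, R 0 v = none) ∧
      (∀ t < T, ValidReps (x t) (R (t + 1))) ∧
      minRepChanges x T = ∑ v, repChangesAt R T v := by
  classical
  have hne : {k | ∃ R : ℕ → Fin Δ → Option (Fin n), (∀ v, R 0 v = none) ∧
      (∀ t < T, ValidReps (x t) (R (t + 1))) ∧
      k = ∑ t ∈ range T, repChanges (R t) (R (t + 1))}.Nonempty := by
    have hobs : ∀ t v, v ∈ domain (x t) → ∃ i, x t i = v := by
      intro t v hv
      obtain ⟨i, _, hi⟩ := Finset.mem_image.1 hv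
      exact ⟨i, hi⟩
    refine ⟨_, fun t v => match t with
      | 0 => none
      | t + 1 => if h : v ∈ domain (x t) then some (hobs t v h).choose else none,
      fun v => rfl, fun t _ => ⟨fun v hv => ?_, fun v hv => ?_⟩, rfl⟩
    · exact ⟨(hobs t v hv).choose, dif_pos hv, (hobs t v hv).choose_spec⟩
    · exact dif_neg hv
  obtain ⟨R, hR0, hR, hsum⟩ := Nat.sInf_mem hne
  refine ⟨R, hR0, hR, ?_⟩
  rw [minRepChanges, hsum]
  simp only [repChanges, repChangesAt, Finset.card_filter]
  exact Finset.sum_comm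

theorem minDomainSize_le {n Δ : ℕ} (x : Input n Δ) {T t : ℕ} (ht : t < T) :
    minDomainSize x T ≤ (domain (x t)).card := Nat.sInf_le ⟨t, ht, rfl⟩

theorem exists_minDomainSize {n Δ : ℕ} (x : Input n Δ) {T : ℕ} (hT : 1 ≤ T) :
    ∃ t < T, minDomainSize x T = (domain (x t)).card :=
  Nat.sInf_mem (s := {k | ∃ t < T, k = (domain (x t)).card}) ⟨_, 0, hT, rfl⟩

theorem minDomainSize_le_minRepChanges {n Δ : ℕ} (x : Input n Δ) {T : ℕ} (hT : 1 ≤ T) :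
    minDomainSize x T ≤ minRepChanges x T := by
  obtain ⟨R, hR0, hR, hsum⟩ := exists_optimal_reps x T
  rw [hsum]
  calc minDomainSize x T ≤ (domain (x 0)).card := minDomainSize_le x hT
    _ = ∑ v, if v ∈ domain (x 0) then 1 else 0 := by simp
    _ ≤ _ := Finset.sum_le_sum fun v _ => by
        simpa using add_card_newPhase_le hR0 hR 0 v 0 hT

/-! ### The total cost -/

section Cost

variable {n Δ : ℕ} {c κ ε δ : ℝ} {x : Input n Δ}

theorem Ex_step_messages_le (hn : 2 ≤ n) (hc : 0 < c) (hκ : 0 < κ) (hε : 0 < ε)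
    (hδ : 0 < Real.log (1 / (2 * δ ^ 2))) {t : ℕ} {st : State n Δ}
    (hst : st ∈ (run c κ ε δ x t).support) :
    Ex (step c κ ε δ (x t) (x (t + 1)) st) (fun st => (st.messages : ℝ≥0∞)) ≤
      st.messages + (∑ v, ind (v ∈ st.sample) * (25 * (ind (Lost (x (t + 1)) v (st.rep v)) +
        ind (v ∉ domain (x t) ∧ v ∈ domain (x (t + 1)))))) +
      ENNReal.ofReal (startCost c κ ε δ) *
        Ex (step c κ ε δ (x t) (x (t + 1)) st) (fun st => ind (st.clock = 1)) := by
  classical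
  obtain ⟨s, k, rfl, hT⟩ := exists_tracks hst
  have hupd : ∀ v, Ex (updateLaw (x (s + k)) (x (s + k + 1)) st v)
      (fun u => (u.messages : ℝ≥0∞)) ≤ ind (v ∈ st.sample) *
        (25 * (ind (Lost (x (s + k + 1)) v (st.rep v)) +
        ind (v ∉ domain (x (s + k)) ∧ v ∈ domain (x (s + k + 1))))) := by
    intro v
    rw [updateLaw]
    by_cases hv : v ∈ st.sample
    · rw [if_pos hv, ind_true hv, one_mul]
      refine (Ex_updateValue_messages_le _).trans ?_
      rw [hT.rep_eq_none_iff v hv, active_eq_empty_iff, mem_domain_iff (x (s + k + 1))]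
    · rw [if_neg hv, Ex_pure]
      simp
  have hclock : ∀ m, Ex (start c κ ε δ (x (s + k + 1)) m) (fun st => ind (st.clock = 1)) = 1 := by
    intro m
    refine (Ex_congr fun st hst => ?_).trans (Ex_const (start c κ ε δ (x (s + k + 1)) m) 1)
    exact ind_true (tracks_start hst).1.clock_eq
  rw [Ex_step, Ex_step, ← Ex_const_mul]
  calc _ ≤ Ex (indep Δ (updateLaw (x (s + k)) (x (s + k + 1)) st)) fun upd =>
        ((st.messages : ℝ≥0∞) + ∑ v, ((upd v).messages : ℝ≥0∞)) +
        ENNReal.ofReal (startCost c κ ε δ) *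
          if Restart δ (nextState (x (s + k)) (x (s + k + 1)) st upd) then
            Ex (start c κ ε δ (x (s + k + 1))
              (nextState (x (s + k)) (x (s + k + 1)) st upd).messages) fun st => ind (st.clock = 1)
          else ind ((nextState (x (s + k)) (x (s + k + 1)) st upd).clock = 1) := by
        refine Ex_mono fun upd _ => ?_
        have hm : ((nextState (x (s + k)) (x (s + k + 1)) st upd).messages : ℝ≥0∞) =
            st.messages + ∑ v, ((upd v).messages : ℝ≥0∞) := by
          simp [nextState]
        rw [← hm]
        by_cases hR : Restart δ (nextState (x (s + k)) (x (s + k + 1)) st upd)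
        · rw [if_pos hR, if_pos hR, hclock, mul_one]
          exact Ex_start_messages_le hn _ hc hκ hε hδ _
        · rw [if_neg hR, if_neg hR]
          exact le_self_add
    _ ≤ _ := by
        rw [Ex_add, Ex_add, Ex_const, Ex_sum]
        gcongr with v
        rw [indep_marginal Δ (updateLaw (x (s + k)) (x (s + k + 1)) st) v
          fun u => (u.messages : ℝ≥0∞)]
        exact hupd v

/-- The expected cost of monitoring in step `t + 1`, split by the beginning of the current run. -/
theorem Ex_run_monitoring_le (hn : 2 ≤ n) (hc : 0 < c) (hκ : 0 < κ) (hε : 0 < ε)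
    (hδ : 0 < Real.log (1 / (2 * δ ^ 2))) {d : ℕ} (hd0 : 0 < d) {t : ℕ}
    (hd : ∀ s ≤ t, d ≤ (domain (x s)).card) :
    Ex (run c κ ε δ x t) (fun st => ∑ v, ind (v ∈ st.sample) *
        (25 * (ind (Lost (x (t + 1)) v (st.rep v)) +
          ind (v ∉ domain (x t) ∧ v ∈ domain (x (t + 1)))))) ≤
      ∑ s ∈ range (t + 1), startProb c κ ε δ x s *
        (ENNReal.ofReal (12 * (c * Real.log (1 / (2 * δ ^ 2))) / ε ^ 2 / d) *
        (25 * ∑ v, (lossProb x s (t - s) v +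
          ind (v ∉ domain (x (s + (t - s))) ∧ v ∈ domain (x (s + (t - s) + 1)))))) := by
  rw [Ex_run_decomp]
  refine Finset.sum_le_sum fun s hs => ?_
  obtain ⟨k, rfl⟩ : ∃ k, t = s + k := ⟨t - s, by have := Finset.mem_range.1 hs; omega⟩
  rw [Nat.add_sub_cancel_left]
  simp only [Finset.mul_sum]
  rw [Ex_sum]
  refine Finset.sum_le_sum fun v _ => ?_
  rw [Ex_run_eq_rep s k v fun r => 25 * (ind (Lost (x (s + k + 1)) v r) +
    ind (v ∉ domain (x (s + k)) ∧ v ∈ domain (x (s + k + 1)))), Ex_const_mul, Ex_add, Ex_const,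
    lossProb]
  gcongr
  calc _ ≤ Ex (sampleLaw c κ ε δ (x s)) (fun a => ind (v ∈ a.2)) :=
        Ex_mono fun a _ => ind_mul_le _ _
    _ ≤ _ := by
        rw [Ex_sampleLaw_mem]
        refine (Ex_sampleLaw_prob_le hn (x s) hc hκ hε hδ).trans (ENNReal.ofReal_le_ofReal ?_)
        have h1 : (d : ℝ) ≤ (domain (x s)).card := by exact_mod_cast hd s (by omega)
        have h2 : (0 : ℝ) < d := by exact_mod_cast hd0
        gcongr

/-- Every run is charged for its first step, and for the monitoring of the whole input. -/
theorem Ex_run_messages_le (hn : 2 ≤ n) (hc : 0 < c) (hκ : 0 < κ) (hε : 0 < ε)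
    (hδ : 0 < Real.log (1 / (2 * δ ^ 2))) {T : ℕ} (hT : 1 ≤ T) :
    expectedMessages c κ ε δ x T ≤ (∑ s ∈ range T, startProb c κ ε δ x s) *
      (ENNReal.ofReal (startCost c κ ε δ) +
        ENNReal.ofReal (12 * (c * Real.log (1 / (2 * δ ^ 2))) / ε ^ 2 / minDomainSize x T) *
        (25 * ((harm n + 1) * minRepChanges x T))) := by
  obtain ⟨R, hR0, hR, hopt⟩ := exists_optimal_reps x T
  have hd0 : 0 < minDomainSize x T := by
    obtain ⟨t, _, ht⟩ := exists_minDomainSize x hT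
    rw [ht]; exact domain_card_pos hn _
  set π := ENNReal.ofReal (12 * (c * Real.log (1 / (2 * δ ^ 2))) / ε ^ 2 / minDomainSize x T) with hπ
  set K := ENNReal.ofReal (startCost c κ ε δ) with hK
  set g : ℕ → ℕ → ℝ≥0∞ := fun s k => startProb c κ ε δ x s * (π * (25 * ∑ v, (lossProb x s k v +
          ind (v ∉ domain (x (s + k)) ∧ v ∈ domain (x (s + k + 1)))))) with hg
  have hrec : ∀ t < T, Ex (run c κ ε δ x t) (fun st => (st.messages : ℝ≥0∞)) ≤
      K * ∑ s ∈ range (t + 1), startProb c κ ε δ x s +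
        ∑ r ∈ range t, ∑ s ∈ range (r + 1), g s (r - s) := by
    intro t
    induction t with
    | zero =>
      intro _
      have := Ex_start_messages_le hn (x 0) hc hκ hε hδ 0
      simpa [startProb_zero, run] using this
    | succ t ih =>
      intro ht
      rw [run, Ex_bind]
      refine (Ex_mono fun st hst => Ex_step_messages_le hn hc hκ hε hδ hst).trans ?_
      rw [Ex_add, Ex_add, Ex_const_mul, ← Ex_bind]
      have h1 : Ex ((run c κ ε δ x t).bind fun s => step c κ ε δ (x t) (x (t + 1)) s)
          (fun st => ind (st.clock = 1)) = startProb c κ ε δ x (t + 1) := rfl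
      have h2 := Ex_run_monitoring_le (t := t) hn hc hκ hε hδ hd0 (x := x)
        fun s hs => minDomainSize_le x (show s < T by omega)
      rw [h1, Finset.sum_range_succ _ (t + 1),
        Finset.sum_range_succ (fun r => ∑ s ∈ range (r + 1), g s (r - s)) t, mul_add]
      calc _ ≤ (K * ∑ s ∈ range (t + 1), startProb c κ ε δ x s +
            ∑ r ∈ range t, ∑ s ∈ range (r + 1), g s (r - s)) +
            (∑ s ∈ range (t + 1), g s (t - s)) + K * startProb c κ ε δ x (t + 1) := by
            gcongr
            exact ih (by omega)
        _ = _ := by ring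
  have hlast := hrec (T - 1) (by omega)
  rw [Nat.sub_add_cancel hT, Finset.sum_range_diag_flip] at hlast
  refine hlast.trans ?_
  rw [mul_add, mul_comm K]
  gcongr
  rw [Finset.sum_mul]
  calc _ ≤ ∑ s ∈ range (T - 1), startProb c κ ε δ x s *
        (π * (25 * ((harm n + 1) * minRepChanges x T))) := by
        refine Finset.sum_le_sum fun s hs => ?_
        simp only [hg, ← Finset.mul_sum]
        gcongr
        rw [Finset.sum_comm, hopt, Nat.cast_sum, Finset.mul_sum]
        have hs' := Finset.mem_range.1 hs
        exact Finset.sum_le_sum fun v _ => sum_lossProb_le hR0 hR s v _ (by omega)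
    _ ≤ _ := Finset.sum_le_sum_of_subset (Finset.range_mono (by omega))

end Cost

/-- The constant in the upper bound. -/
noncomputable def upperConst : ℝ := 64 * 2100 * cConst

theorem expectedMessages_le {n Δ : ℕ} {ε δ σ : ℝ} {x : Input n Δ} {T : ℕ} (hn : 2 ≤ n)
    (hT : 1 ≤ T) (hε : 0 < ε) (hε1 : ε < 1) (h0 : 0 < δ) (h1 : δ ≤ 1 / 2) (hσ0 : 0 ≤ σ)
    (hσ1 : σ ≤ 1 / 2) (hx : DomainChangeRate x T σ) :
    expectedMessages cConst κConst ε δ x T ≤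
      ENNReal.ofReal (upperConst * messageBound ε δ σ x T) := by
  have hℓ := log_inv_pos h0 h1
  refine (Ex_run_messages_le hn (by norm_num [cConst]) (by norm_num [κConst]) hε hℓ hT).trans ?_
  have hd : (0 : ℝ) < minDomainSize x T := by
    obtain ⟨t, _, ht⟩ := exists_minDomainSize x hT
    rw [ht]; exact_mod_cast domain_card_pos hn _
  have hdR : (minDomainSize x T : ℝ) ≤ minRepChanges x T := by
    exact_mod_cast minDomainSize_le_minRepChanges x hT
  have hn' : (2 : ℝ) ≤ n := by exact_mod_cast hn
  have hlogn : 1 ≤ Real.logb 2 n := by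
    rw [Real.le_logb_iff_rpow_le (by norm_num) (by linarith)]
    simpa using hn'
  set ℓ := Real.log (1 / (2 * δ ^ 2)) with hℓdef
  set Λ := Real.log (1 / δ) with hΛ
  have hΛ1 : 1 / 2 ≤ Λ := by
    have h2 : Real.log 2 ≤ Λ := Real.log_le_log (by norm_num) (by rw [le_div_iff₀ h0]; linarith)
    linarith [Real.log_two_gt_d9]
  have hℓΛ : ℓ ≤ 2 * Λ := by
    have h2 : 2 * Λ = Real.log (1 / δ ^ 2) := by
      rw [hΛ, one_div, one_div, Real.log_inv, Real.log_inv, Real.log_pow]; push_cast; ring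
    rw [h2]
    refine Real.log_le_log (by positivity) (one_div_le_one_div_of_le (by positivity) ?_)
    nlinarith [sq_nonneg δ]
  set r := (minRepChanges x T : ℝ) / minDomainSize x T with hr
  have hr1 : 1 ≤ r := by rw [hr, le_div_iff₀ hd, one_mul]; exact hdR
  have hε2 : 0 < ε ^ 2 := by positivity
  have hε21 : 1 ≤ 1 / ε ^ 2 := by
    rw [le_div_iff₀ hε2]; nlinarith
  set X := Real.logb 2 n * r * (Λ * (1 / ε ^ 2)) with hX
  have hM : 0 < max (2 * σ) δ := lt_max_of_lt_right h0
  have hlr : 1 ≤ Real.logb 2 n * r := one_le_mul_of_one_le_of_one_le hlogn hr1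
  have hΛε : 1 / 2 ≤ Λ * (1 / ε ^ 2) := by nlinarith
  have hXΛ : Λ * (1 / ε ^ 2) ≤ X := by rw [hX]; nlinarith
  have hstart : startCost cConst κConst ε δ ≤ 265 * cConst * X := by
    have h2 : startCost cConst κConst ε δ =
        12 + 40 * ℓ + 132 * cConst * (ℓ * (1 / ε ^ 2)) := by
      rw [startCost, κConst]; ring
    have h3 : ℓ * (1 / ε ^ 2) ≤ 2 * (Λ * (1 / ε ^ 2)) := by
      rw [← mul_assoc]; gcongr
    have h4 : Λ ≤ Λ * (1 / ε ^ 2) := le_mul_of_one_le_right (by linarith) hε21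
    rw [h2]
    simp only [cConst]
    linarith
  have hmon : 12 * (cConst * ℓ) / ε ^ 2 / minDomainSize x T * (25 * (3 * Real.logb 2 n *
      minRepChanges x T)) ≤ 1800 * cConst * X := by
    have h2 : 12 * (cConst * ℓ) / ε ^ 2 / minDomainSize x T * (25 * (3 * Real.logb 2 n *
        minRepChanges x T)) = 900 * cConst * (Real.logb 2 n * r * (ℓ * (1 / ε ^ 2))) := by
      rw [hr]; ring
    have h3 : Real.logb 2 n * r * (ℓ * (1 / ε ^ 2)) ≤
        Real.logb 2 n * r * (2 * Λ * (1 / ε ^ 2)) := by gcongr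
    rw [h2, hX]
    simp only [cConst]
    linarith
  have hX0 : 0 ≤ X := by linarith
  calc _ ≤ ENNReal.ofReal (64 * (1 + T * max (2 * σ) δ)) *
        (ENNReal.ofReal (265 * cConst * X) +
        ENNReal.ofReal (12 * (cConst * ℓ) / ε ^ 2 / minDomainSize x T) *
          (ENNReal.ofReal 25 * (ENNReal.ofReal (3 * Real.logb 2 n) *
            ENNReal.ofReal (minRepChanges x T)))) := by
        gcongr
        · exact sum_startProb_le hn hε hε1 h0 h1 hσ0 hσ1 hx
        · simp
        · exact harm_add_one_le hn
        · simp
    _ ≤ ENNReal.ofReal (64 * (1 + T * max (2 * σ) δ)) *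
        (ENNReal.ofReal (265 * cConst * X) + ENNReal.ofReal (1800 * cConst * X)) := by
        rw [← ENNReal.ofReal_mul (by positivity), ← ENNReal.ofReal_mul (by positivity),
          ← ENNReal.ofReal_mul (by simp only [cConst]; positivity)]
        gcongr
    _ = ENNReal.ofReal (64 * (1 + T * max (2 * σ) δ) * (2065 * cConst * X)) := by
        have hc : 0 ≤ cConst := by norm_num [cConst]
        rw [← ENNReal.ofReal_add (by positivity) (by positivity),
          ← ENNReal.ofReal_mul (by positivity)]
        congr 1
        ring
    _ ≤ _ := by
        refine ENNReal.ofReal_le_ofReal ?_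
        have h2 : messageBound ε δ σ x T = (1 + T * max (2 * σ) δ) * X := by
          rw [messageBound, ← hΛ, hX, hr]
          ring
        have h3 : 0 ≤ (1 + T * max (2 * σ) δ) * X := by positivity
        rw [h2, upperConst]
        simp only [cConst]
        linarith

/-! ### A lower bound for the cost -/

section Lower

variable {n Δ : ℕ} {c κ ε δ : ℝ} {x : Input n Δ}

theorem le_Ex_step_messages {t : ℕ} {st : State n Δ} (hst : st ∈ (run c κ ε δ x t).support) :
    (st.messages : ℝ≥0∞) + ∑ v, ind (v ∈ st.sample) * ind (Lost (x (t + 1)) v (st.rep v)) ≤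
      Ex (step c κ ε δ (x t) (x (t + 1)) st) (fun st => (st.messages : ℝ≥0∞)) := by
  classical
  rw [Ex_step]
  refine le_Ex_of_forall fun upd hupd => ?_
  have h1 : (st.messages : ℝ≥0∞) +
      ∑ v, ind (v ∈ st.sample) * ind (Lost (x (t + 1)) v (st.rep v)) ≤
      (nextState (x t) (x (t + 1)) st upd).messages := by
    simp only [nextState, Nat.cast_add, Nat.cast_sum]
    gcongr with v
    by_cases hv : v ∈ st.sample
    · have h2 := mem_support_indep hupd v
      rw [updateLaw, if_pos hv] at h2
      rw [ind_true hv, one_mul]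
      exact ind_lost_le_messages h2
    · rw [ind_false hv, zero_mul]; exact zero_le
  obtain ⟨s, k, rfl, _⟩ := exists_tracks hst
  refine h1.trans ?_
  split_ifs with hR
  · refine le_Ex_of_forall fun st' hst' => ?_
    exact_mod_cast (tracks_start hst').2
  · exact le_rfl

/-- If the first run cannot end before time `T`, then every loss of a representative in it costs a
message. -/
theorem le_expectedMessages {T : ℕ}
    (hS : ∀ t, t + 1 < T → ∀ S, Survives x δ 0 t S) :
    ∑ t ∈ range (T - 1), ∑ v, Ex (sampleLaw c κ ε δ (x 0)) (fun a => 2⁻¹ ^ a.1) *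
      lossProb x 0 t v ≤ expectedMessages c κ ε δ x T := by
  have hrec : ∀ t < T ⊔ 1, ∑ r ∈ range t, ∑ v, Ex (sampleLaw c κ ε δ (x 0)) (fun a => 2⁻¹ ^ a.1) *
      lossProb x 0 r v ≤ Ex (run c κ ε δ x t) (fun st => (st.messages : ℝ≥0∞)) := by
    intro t
    induction t with
    | zero => intro _; simp
    | succ t ih =>
      intro ht
      rw [Finset.sum_range_succ, run, Ex_bind]
      refine le_trans ?_ (Ex_mono fun st hst => le_Ex_step_messages hst)
      rw [Ex_add, Ex_sum]
      refine add_le_add (ih (by omega)) (Finset.sum_le_sum fun v _ => ?_)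
      have h1 := Ex_run_eq_rep (c := c) (κ := κ) (ε := ε) (δ := δ) (x := x) 0 t v
        fun r => ind (Lost (x (0 + t + 1)) v r)
      have hsurv : ∀ S, Survives x δ 0 t S := hS t (by omega)
      simp only [ind_true (hsurv _), one_mul, startProb_zero, Ex_sampleLaw_mem] at h1
      rw [lossProb, ← h1, Nat.zero_add]
      exact Ex_mono fun st _ => ind_mul_le _ _
  exact hrec (T - 1) (by omega)

theorem le_Ex_sampleLaw_prob (hn : 2 ≤ n) (y : Fin n → Fin Δ) (hc : 0 < c) (hκ : 1 ≤ κ)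
    (hε : 0 < ε) (h0 : 0 < δ) (h1 : δ ≤ 1 / 2)
    (hp : c * Real.log (1 / (2 * δ ^ 2)) / (ε ^ 2 * (64 * (domain y).card)) ≤ 1) :
    ENNReal.ofReal (c * Real.log (1 / (2 * δ ^ 2)) / (ε ^ 2 * (64 * (domain y).card))) * 2⁻¹ ≤
      Ex (sampleLaw c κ ε δ y) (fun a => 2⁻¹ ^ a.1) := by
  have hd : (0 : ℝ) < (domain y).card := by exact_mod_cast domain_card_pos hn y
  have hℓ := log_inv_pos h0 h1
  have hlarge : Ex (ampConstFactor κ (2 * δ ^ 2) y)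
      (fun r => ind (64 * (domain y).card < r.1)) ≤ 2⁻¹ := by
    refine (Ex_ampConstFactor_large_le κ _ y hn).trans (quarter_pow_ceil_le.trans ?_)
    calc _ ≤ ENNReal.ofReal (1 / 2) := by
          refine ENNReal.ofReal_le_ofReal ?_
          have h2 := exp_neg_mul_log_inv h0 1
          calc Real.exp (-(κ * Real.log (1 / (2 * δ ^ 2))))
              ≤ Real.exp (-((1 : ℕ) * Real.log (1 / (2 * δ ^ 2)))) := by
                refine Real.exp_le_exp.2 (neg_le_neg ?_)
                rw [Nat.cast_one]; gcongr
            _ ≤ 1 / 2 := by rw [h2]; nlinarith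
      _ = 2⁻¹ := by rw [one_div, ENNReal.ofReal_inv_of_pos (by norm_num)]; simp
  have hsmall := half_le_of_add_eq_one ((add_comm _ _).trans (Ex_ind_add_not
    (ampConstFactor κ (2 * δ ^ 2) y) fun r => 64 * (domain y).card < r.1)) hlarge
  rw [Ex_sampleLaw]
  simp only [Ex_const]
  refine (mul_le_mul_right hsmall _).trans ?_
  rw [← Ex_const_mul]
  refine Ex_mono fun est _ => ?_
  by_cases hest : 64 * (domain y).card < est.1
  · rw [ind_false (not_not.2 hest), mul_zero]; exact zero_le
  rw [ind_true hest, mul_one, half_pow_eq_ofReal]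
  refine ENNReal.ofReal_le_ofReal ?_
  rcases Nat.eq_zero_or_pos est.1 with he | he
  · have : sampleExponent c ε (2 * δ ^ 2) est.1 = 0 := by simp [he, sampleExponent]
    rw [this, pow_zero]; exact hp
  · rcases sampleExponent_eq_zero_or hc hε hℓ he with h2 | h2
    · rw [h2, pow_zero]; exact hp
    · refine le_trans ?_ h2
      have h3 : (est.1 : ℝ) ≤ 64 * (domain y).card := by exact_mod_cast not_lt.1 hest
      have h4 : (0 : ℝ) < est.1 := by exact_mod_cast he
      gcongr

end Lower

/-! ### An input on which the bound is attained -/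

theorem div_mod_bound {k : ℕ} (i : Fin (2 ^ k * 2 ^ k)) : (i : ℕ) % 2 ^ k < 2 ^ k :=
  Nat.mod_lt _ (by positivity)

/-- There are `2 ^ k` values with `2 ^ k` nodes each. In every time step half of the remaining nodes
of each value move to the value `0`, until one is left. -/
def halvingInput (k : ℕ) : Input (2 ^ k * 2 ^ k) (2 ^ k) := fun t i =>
  if (i : ℕ) / 2 ^ k < 2 ^ (k - t) then ⟨(i : ℕ) % 2 ^ k, div_mod_bound i⟩ else ⟨0, by positivity⟩

/-- The node of the value `v` that never moves. -/
def stableNode (k : ℕ) (v : Fin (2 ^ k)) : Fin (2 ^ k * 2 ^ k) :=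
  ⟨v, v.isLt.trans_le (Nat.le_mul_of_pos_right _ (by positivity))⟩

theorem halvingInput_stableNode (k t : ℕ) (v : Fin (2 ^ k)) :
    halvingInput k t (stableNode k v) = v := by
  have h1 : (v : ℕ) / 2 ^ k = 0 := Nat.div_eq_of_lt v.isLt
  have h2 : (v : ℕ) % 2 ^ k = v := Nat.mod_eq_of_lt v.isLt
  simp only [halvingInput, stableNode, h1, h2]
  rw [if_pos (by positivity)]

theorem domain_halvingInput (k t : ℕ) : domain (halvingInput k t) = univ := by
  ext v
  simp only [mem_univ, iff_true]
  exact Finset.mem_image.2 ⟨stableNode k v, Finset.mem_univ _, halvingInput_stableNode k t v⟩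

theorem mem_observers_halvingInput {k t : ℕ} {v : Fin (2 ^ k)} (hv : (v : ℕ) ≠ 0)
    (i : Fin (2 ^ k * 2 ^ k)) : i ∈ observers (halvingInput k t) v ↔
      (i : ℕ) % 2 ^ k = v ∧ (i : ℕ) / 2 ^ k < 2 ^ (k - t) := by
  rw [mem_observers, halvingInput, Fin.ext_iff]
  split_ifs with h
  · simp [h]
  · simp only [h, and_false, iff_false]
    exact fun h => hv h.symm

theorem card_observers_halvingInput {k t : ℕ} {v : Fin (2 ^ k)} (hv : (v : ℕ) ≠ 0) :
    (observers (halvingInput k t) v).card = 2 ^ (k - t) := by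
  rw [← Finset.card_range (2 ^ (k - t))]
  have hle : 2 ^ (k - t) ≤ 2 ^ k := Nat.pow_le_pow_right (by norm_num) (Nat.sub_le k t)
  have hpos : 0 < 2 ^ k := by positivity
  refine Finset.card_bij (fun i _ => (i : ℕ) / 2 ^ k) (fun i hi => ?_) (fun i hi j hj hij => ?_)
    fun j hj => ?_
  · exact Finset.mem_range.2 ((mem_observers_halvingInput hv i).1 hi).2
  · have h1 := ((mem_observers_halvingInput hv i).1 hi).1
    have h2 := ((mem_observers_halvingInput hv j).1 hj).1
    rw [Fin.ext_iff, ← Nat.div_add_mod (i : ℕ) (2 ^ k), ← Nat.div_add_mod (j : ℕ) (2 ^ k), hij, h1,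
      h2]
  · have hj' := Finset.mem_range.1 hj
    have hlt : (v : ℕ) + 2 ^ k * j < 2 ^ k * 2 ^ k := by
      have h1 : 2 ^ k * (j + 1) ≤ 2 ^ k * 2 ^ k := Nat.mul_le_mul_left _ (by omega)
      have h2 := v.isLt
      rw [mul_add, mul_one] at h1
      omega
    have hdiv : ((v : ℕ) + 2 ^ k * j) / 2 ^ k = j := by
      rw [Nat.add_mul_div_left _ _ hpos, Nat.div_eq_of_lt v.isLt, zero_add]
    refine ⟨⟨(v : ℕ) + 2 ^ k * j, hlt⟩, ?_, hdiv⟩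
    rw [mem_observers_halvingInput hv]
    refine ⟨?_, ?_⟩
    · simp only [Nat.add_mul_mod_self_left]
      exact Nat.mod_eq_of_lt v.isLt
    · simp only [hdiv]
      exact hj'

theorem observers_halvingInput_subset {k t : ℕ} {v : Fin (2 ^ k)} (hv : (v : ℕ) ≠ 0) :
    observers (halvingInput k (t + 1)) v ⊆ observers (halvingInput k t) v := by
  intro i hi
  rw [mem_observers_halvingInput hv] at hi ⊢
  exact ⟨hi.1, hi.2.trans_le (Nat.pow_le_pow_right (by norm_num) (by omega))⟩

theorem active_halvingInput {k : ℕ} {v : Fin (2 ^ k)} (hv : (v : ℕ) ≠ 0) (t : ℕ) :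
    active (halvingInput k) 0 t v = observers (halvingInput k t) v := by
  induction t with
  | zero => rfl
  | succ t ih =>
    have h1 : observers (halvingInput k t) v ∩ observers (halvingInput k (t + 1)) v =
        observers (halvingInput k (t + 1)) v :=
      Finset.inter_eq_right.2 (observers_halvingInput_subset hv)
    rw [active, ih, Nat.zero_add, nextActive, h1]
    simp

theorem lossProb_halvingInput {k t : ℕ} (ht : t < k) {v : Fin (2 ^ k)} (hv : (v : ℕ) ≠ 0) :
    lossProb (halvingInput k) 0 t v = 2⁻¹ := by
  have hne : (active (halvingInput k) 0 t v).Nonempty := by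
    rw [active_nonempty_iff, domain_halvingInput]; exact Finset.mem_univ v
  obtain ⟨m, hm⟩ : ∃ m, k - t = m + 1 := ⟨k - t - 1, by omega⟩
  have hm' : k - (t + 1) = m := by omega
  rw [lossProb, Ex_pick_lost hne, active_halvingInput hv, Nat.zero_add,
    Finset.card_sdiff_of_subset (observers_halvingInput_subset hv), card_observers_halvingInput hv,
    card_observers_halvingInput hv, hm, hm', pow_succ, mul_two, Nat.add_sub_cancel, ← mul_two,
    Nat.cast_mul, ENNReal.mul_inv (by simp) (by simp), mul_right_comm,
    ENNReal.inv_mul_cancel (by simp) (by simp), one_mul]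
  simp

theorem minDomainSize_halvingInput (k : ℕ) {T : ℕ} (hT : 1 ≤ T) :
    minDomainSize (halvingInput k) T = 2 ^ k := by
  obtain ⟨t, _, ht⟩ := exists_minDomainSize (halvingInput k) hT
  rw [ht, domain_halvingInput, Finset.card_univ, Fintype.card_fin]

theorem minRepChanges_halvingInput_le (k T : ℕ) : minRepChanges (halvingInput k) T ≤ 2 ^ k := by
  let R : ℕ → Fin (2 ^ k) → Option (Fin (2 ^ k * 2 ^ k)) := fun t v =>
    if t = 0 then none else some (stableNode k v)
  have h1 : minRepChanges (halvingInput k) T ≤ ∑ t ∈ range T, repChanges (R t) (R (t + 1)) := by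
    refine Nat.sInf_le ⟨R, fun v => rfl, fun t _ => ⟨fun v _ => ?_, fun v hv => ?_⟩, rfl⟩
    · exact ⟨stableNode k v, if_neg (Nat.succ_ne_zero t), halvingInput_stableNode k t v⟩
    · rw [domain_halvingInput] at hv
      exact absurd (Finset.mem_univ v) hv
  refine h1.trans ?_
  have h2 : ∀ t ∈ range T, repChanges (R t) (R (t + 1)) ≤ if t = 0 then 2 ^ k else 0 := by
    intro t _
    by_cases ht : t = 0
    · rw [if_pos ht]
      exact (Finset.card_filter_le _ _).trans (by simp)
    · simp [repChanges, R, ht]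
  refine (Finset.sum_le_sum h2).trans ?_
  rw [Finset.sum_ite_eq']
  split_ifs <;> simp

theorem survives_halvingInput {k : ℕ} {δ : ℝ} {t : ℕ} (ht : (t : ℝ) + 1 < 1 / δ)
    (S : Finset (Fin (2 ^ k))) : Survives (halvingInput k) δ 0 t S := by
  refine ⟨Or.inr ht, ?_⟩
  simp [changes, domain_halvingInput]

/-- The constant in the lower bound. -/
noncomputable def lowerConst : ℝ := cConst / 2048

theorem le_expectedMessages_halvingInput {ε : ℝ} (hε : 0 < ε) {k : ℕ} (hk : 1 ≤ k)
    (hlarge : cConst * (2 * (k + 1)) ≤ ε ^ 2 * (64 * 2 ^ k)) :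
    ENNReal.ofReal (lowerConst * messageBound ε (1 / (k + 2)) 0 (halvingInput k) (k + 1)) ≤
      expectedMessages cConst κConst ε (1 / (k + 2)) (halvingInput k) (k + 1) := by
  set δ : ℝ := 1 / (k + 2) with hδ
  have hk0 : (0 : ℝ) ≤ k := by positivity
  have hk1 : (1 : ℝ) ≤ k := by exact_mod_cast hk
  have hδ0 : 0 < δ := by positivity
  have hδ1 : δ ≤ 1 / 2 := by
    rw [hδ]; exact one_div_le_one_div_of_le (by norm_num) (by linarith)
  have hδk : 1 / δ = k + 2 := by rw [hδ, one_div_one_div]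
  have hpow : 2 ≤ 2 ^ k := by
    calc 2 = 2 ^ 1 := rfl
      _ ≤ 2 ^ k := Nat.pow_le_pow_right (by norm_num) hk
  have hn : 2 ≤ 2 ^ k * 2 ^ k := by nlinarith
  have hpowR : (2 : ℝ) ≤ 2 ^ k := by exact_mod_cast hpow
  have hc : 0 < cConst := by norm_num [cConst]
  have hcard : ((domain (halvingInput k 0)).card : ℝ) = 2 ^ k := by
    rw [domain_halvingInput]; simp
  set ℓ := Real.log (1 / (2 * δ ^ 2)) with hℓ
  have hℓ0 : 0 < ℓ := log_inv_pos hδ0 hδ1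
  have hℓle : ℓ ≤ 2 * (k + 1) := by
    have h1 : ℓ ≤ Real.log (((k : ℝ) + 2) ^ 2) := by
      refine Real.log_le_log (by positivity) ?_
      have h2 : ((k : ℝ) + 2) ^ 2 = 1 / δ ^ 2 := by rw [← hδk, one_div_pow]
      rw [h2]
      exact one_div_le_one_div_of_le (by positivity) (by nlinarith [sq_nonneg δ])
    have h2 := Real.log_le_sub_one_of_pos (show (0 : ℝ) < k + 2 by positivity)
    rw [Real.log_pow] at h1
    push_cast at h1
    linarith
  set p := cConst * ℓ / (ε ^ 2 * (64 * 2 ^ k)) with hp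
  have hp1 : p ≤ 1 := by
    rw [hp, div_le_one (by positivity)]
    exact le_trans (by gcongr) hlarge
  have hprob := le_Ex_sampleLaw_prob (κ := κConst) hn (halvingInput k 0) hc (by norm_num [κConst])
    hε hδ0 hδ1 (by rw [hcard]; exact hp1)
  rw [hcard] at hprob
  have hsurv : ∀ t, t + 1 < k + 1 → ∀ S, Survives (halvingInput k) δ 0 t S := by
    intro t ht S
    refine survives_halvingInput ?_ S
    have : (t : ℝ) < k := by exact_mod_cast (by omega : t < k)
    rw [hδk]; linarith
  refine le_trans ?_ (le_expectedMessages hsurv)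
  rw [Nat.add_sub_cancel]
  have hterm : ∀ t ∈ range k, ENNReal.ofReal (p / 4 * (2 ^ k - 1)) ≤
      ∑ v, Ex (sampleLaw cConst κConst ε δ (halvingInput k 0)) (fun a => 2⁻¹ ^ a.1) *
        lossProb (halvingInput k) 0 t v := by
    intro t ht
    have ht' := Finset.mem_range.1 ht
    set z : Fin (2 ^ k) := ⟨0, by positivity⟩ with hz
    have h1 : ENNReal.ofReal (p / 4 * (2 ^ k - 1)) =
        ∑ v ∈ univ.erase z, (ENNReal.ofReal p * 2⁻¹ * 2⁻¹) := by
      rw [Finset.sum_const, Finset.card_erase_of_mem (Finset.mem_univ z), Finset.card_univ,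
        Fintype.card_fin, nsmul_eq_mul]
      have e1 : ((2 ^ k - 1 : ℕ) : ℝ≥0∞) = ENNReal.ofReal (2 ^ k - 1) := by
        rw [← ENNReal.ofReal_natCast, Nat.cast_sub (by omega)]; simp
      have e2 : (2⁻¹ : ℝ≥0∞) = ENNReal.ofReal (1 / 2) := by
        have := half_pow_eq_ofReal 1
        rwa [pow_one, pow_one] at this
      have hp0 : 0 ≤ p := by positivity
      rw [e1, e2, ← ENNReal.ofReal_mul hp0, ← ENNReal.ofReal_mul (by positivity),
        ← ENNReal.ofReal_mul (by linarith)]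
      congr 1
      ring
    rw [h1]
    refine le_trans (Finset.sum_le_sum fun v hv => ?_)
      (Finset.sum_le_sum_of_subset (Finset.erase_subset z univ))
    have hv0 : (v : ℕ) ≠ 0 := fun h => Finset.ne_of_mem_erase hv (Fin.ext h)
    rw [lossProb_halvingInput ht' hv0]
    gcongr
  refine le_trans ?_ (Finset.sum_le_sum hterm)
  rw [Finset.sum_const, Finset.card_range, nsmul_eq_mul, ← ENNReal.ofReal_natCast,
    ← ENNReal.ofReal_mul hk0]
  refine ENNReal.ofReal_le_ofReal ?_
  have hΛ : Real.log (1 / δ) ≤ ℓ := by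
    refine Real.log_le_log (by positivity) (one_div_le_one_div_of_le (by positivity) ?_)
    nlinarith
  have hΛ0 : 0 ≤ Real.log (1 / δ) := Real.log_nonneg (by rw [hδk]; linarith)
  have hlogn : Real.logb 2 ((2 ^ k * 2 ^ k : ℕ) : ℝ) = 2 * k := by
    push_cast
    rw [← pow_add, Real.logb_pow, Real.logb_self_eq_one (by norm_num)]
    push_cast; ring
  have hR : (minRepChanges (halvingInput k) (k + 1) : ℝ) ≤ 2 ^ k := by
    exact_mod_cast minRepChanges_halvingInput_le k (k + 1)
  have hbound : messageBound ε δ 0 (halvingInput k) (k + 1) ≤ 2 * (2 * k * (1 / ε ^ 2)) * ℓ := by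
    rw [messageBound, minDomainSize_halvingInput k (by omega), hlogn, mul_zero, max_eq_right hδ0.le]
    have h1 : 1 + ((k + 1 : ℕ) : ℝ) * δ ≤ 2 := by
      rw [hδ]; push_cast
      have : ((k : ℝ) + 1) * (1 / (k + 2)) ≤ 1 := by
        rw [mul_one_div, div_le_one (by positivity)]; linarith
      linarith
    have h2 : 2 * (k : ℝ) * (minRepChanges (halvingInput k) (k + 1)) / (((2 ^ k : ℕ) : ℝ) * ε ^ 2) ≤
        2 * k * (1 / ε ^ 2) := by
      push_cast
      rw [div_le_iff₀ (by positivity)]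
      have : 2 * (k : ℝ) * (1 / ε ^ 2) * (2 ^ k * ε ^ 2) = 2 * k * 2 ^ k := by field_simp
      rw [this]
      gcongr
    gcongr
  have hlower : lowerConst * messageBound ε δ 0 (halvingInput k) (k + 1) ≤
      lowerConst * (2 * (2 * k * (1 / ε ^ 2)) * ℓ) :=
    mul_le_mul_of_nonneg_left hbound (by norm_num [lowerConst, cConst])
  refine hlower.trans ?_
  have h3 : (k : ℝ) * (p / 4 * (2 ^ k - 1)) =
      lowerConst * (2 * (2 * k * (1 / ε ^ 2)) * ℓ) * (2 * ((2 ^ k - 1) / 2 ^ k)) := by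
    rw [hp, lowerConst]
    field_simp
    ring
  rw [h3]
  refine le_mul_of_one_le_right (by norm_num [lowerConst, cConst]; positivity) ?_
  rw [← mul_div_assoc, le_div_iff₀ (by positivity)]
  linarith

theorem exists_large_exponent {a b : ℝ} (hb : 0 < b) (N : ℕ) :
    ∃ k : ℕ, N ≤ k ∧ 1 ≤ k ∧ a * (2 * (k + 1)) ≤ b * (64 * 2 ^ k) := by
  have h1 := tendsto_pow_const_div_const_pow_of_one_lt 1 (r := (2 : ℝ)) (by norm_num)
  have hc : 0 < b / (|a| + 1) := by positivity
  obtain ⟨k, hkc, hkN⟩ := ((h1.eventually (gt_mem_nhds hc)).and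
    (Filter.eventually_ge_atTop (max N 1))).exists
  have hk1 : 1 ≤ k := le_trans (le_max_right _ _) hkN
  refine ⟨k, le_trans (le_max_left _ _) hkN, hk1, ?_⟩
  have hk1' : (1 : ℝ) ≤ k := by exact_mod_cast hk1
  rw [pow_one, div_lt_div_iff₀ (by positivity) (by positivity)] at hkc
  have h2 : a * (2 * (k + 1)) ≤ (|a| + 1) * (4 * k) := by
    have := le_abs_self a
    have h3 : (0 : ℝ) ≤ |a| := abs_nonneg a
    calc a * (2 * (k + 1)) ≤ |a| * (2 * (k + 1)) := by gcongr
      _ ≤ |a| * (4 * k) := mul_le_mul_of_nonneg_left (by linarith) h3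
      _ ≤ _ := by nlinarith
  have h3 : 0 < b * 2 ^ k := by positivity
  linarith

end CountDistinct

theorem mainTheorem6 :
    ∃ c κ C₁ C₂ : ℝ, 0 < c ∧ 0 < κ ∧ 0 < C₁ ∧ 0 < C₂ ∧
      -- approximation and upper bound, for every input
      (∀ (n Δ T : ℕ) (ε δ σ : ℝ) (x : CountDistinct.Input n Δ),
        2 ≤ n → 1 ≤ T → 0 < ε → ε < 1 → 0 < δ → δ ≤ 1 / 2 → 0 ≤ σ → σ ≤ 1 / 2 →
        CountDistinct.DomainChangeRate x T σ →
          CountDistinct.IsApproximation c κ ε δ x T ∧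
          CountDistinct.expectedMessages c κ ε δ x T
            ≤ ENNReal.ofReal (C₂ * CountDistinct.messageBound ε δ σ x T)) ∧
      -- the upper bound is attained up to a constant factor, for every `ε` and arbitrarily large `n`
      (∀ ε : ℝ, 0 < ε → ε < 1 → ∀ N : ℕ, ∃ (n Δ T : ℕ) (δ σ : ℝ) (x : CountDistinct.Input n Δ),
        N ≤ n ∧ 2 ≤ n ∧ 1 ≤ T ∧ 0 < δ ∧ δ ≤ 1 / 2 ∧ 0 ≤ σ ∧ σ ≤ 1 / 2 ∧
        CountDistinct.DomainChangeRate x T σ ∧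
          ENNReal.ofReal (C₁ * CountDistinct.messageBound ε δ σ x T)
            ≤ CountDistinct.expectedMessages c κ ε δ x T) := by
  refine ⟨CountDistinct.cConst, CountDistinct.κConst, CountDistinct.lowerConst,
    CountDistinct.upperConst, by norm_num [CountDistinct.cConst],
    by norm_num [CountDistinct.κConst],
    by norm_num [CountDistinct.lowerConst, CountDistinct.cConst],
    by norm_num [CountDistinct.upperConst, CountDistinct.cConst], ?_, ?_⟩
  · intro n Δ T ε δ σ x hn hT hε hε1 h0 h1 hσ0 hσ1 hx
    exact ⟨CountDistinct.isApproximation hn x T hε hε1 h0 h1,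
      CountDistinct.expectedMessages_le hn hT hε hε1 h0 h1 hσ0 hσ1 hx⟩
  · intro ε hε _ N
    obtain ⟨k, hkN, hk, hlarge⟩ := CountDistinct.exists_large_exponent
      (a := CountDistinct.cConst) (b := ε ^ 2) (by positivity) N
    have hk1 : (1 : ℝ) ≤ k := by exact_mod_cast hk
    have hpow : k < 2 ^ k := Nat.lt_two_pow_self
    refine ⟨2 ^ k * 2 ^ k, 2 ^ k, k + 1, 1 / (k + 2), 0, CountDistinct.halvingInput k, by nlinarith,
      by nlinarith, by omega, by positivity, ?_, le_rfl, by norm_num, ?_,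
      CountDistinct.le_expectedMessages_halvingInput hε hk hlarge⟩
    · exact one_div_le_one_div_of_le (by norm_num) (by linarith)
    · intro t _
      rw [CountDistinct.domain_halvingInput, CountDistinct.domain_halvingInput]
      simp
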